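/- **Setting.** Let $r>0$ and let $\|x\|=\max_{\theta\in[-r,0]}|x(\theta)|$ be the norm of $C^0([-r,0];\mathbb R^n)$ ($|\cdot|$ is the Euclidean norm); $x_t(\theta)=x(t+\theta)$, $\theta\in[-r,0]$. For a set $S\subseteq\mathbb R^p$, $L^\infty_{loc}(\mathbb R_+;S)$ is the class of Lebesgue measurable, locally bounded $v:\mathbb R_+\to S$ (all suprema below are actual suprema). $K$ is the class of (strictly) increasing continuous $\rho:\mathbb R_+\to\mathbb R_+$ with $\rho(0)=0$, and $K_\infty$ the class of the unbounded ones. Solutions of delay equations are continuous, equal to the initial function on $[-r,0]$, absolutely continuous on compact intervals of non-negative times, and satisfy the equation almost everywhere. Let $U\subseteq\mathbb R^m$, $D\subseteq\mathbb R^q$ be convex with $0\in U$, $0\in D$, and let $f:C^0([-r,0];\mathbb R^n)\times U\times D\to\mathbb R^n$, $h:C^0([-r,0];\mathbb R^n)\to\mathbb R^k$. Consider $$\dot x(t)=f(x_t,u(t),d(t)),\qquad y(t)=h(x_t)+\xi(t).\tag{1.1}$$ Assume: * **(H1)** $f,h$ are continuous and map bounded sets to bounded sets, $f(0,0,0)=0$,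 $h(0)=0$, and for every bounded $S\subset C^0([-r,0];\mathbb R^n)\times U\times D$ there is $L_S\ge 0$ with $(x(0)-\bar x(0))^T(f(x,u,d)-f(\bar x,u,d))\le L_S\|x-\bar x\|^2$ for all $(x,u,d),(\bar x,u,d)\in S$. * **(H2)** For all $x_0\in C^0([-r,0];\mathbb R^n)$, $u\in L^\infty_{loc}(\mathbb R_+;U)$, $d\in L^\infty_{loc}(\mathbb R_+;D)$ the solution of (1.1) exists for all $t\ge0$. * **(H3)** There is a continuous $R:C^0([-r,0];\mathbb R^n)\times U\times D\to\mathbb R^k$ such that along every solution $x$ of (1.1) with inputs as in (H2) the function $t\mapsto h(x_t)$ is locally absolutely continuous on $\mathbb R_+$ with $\frac{d}{dt}h(x_t)=R(x_t,u(t),d(t))$ for almost every $t\ge0$; and there are $L\ge0$, $\kappa\in K$ with $|R(\bar x,u,0)-R(x,u,d)|\le L\|\bar x-x\|+\kappa(|d|)$ for all $x,\bar x$, $u\in U$, $d\in D$. * **(H4)** $U=\mathbb R^m$, and there are $\bar k\in K$, constants $\bar\sigma,M,\bar L>0$ and $\tilde k:C^0([-r,0];\mathbb R^n)\to\mathbb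 R^m$ with $\tilde k(0)=0$ such that $|\tilde k(\bar x)-\tilde k(x)|+|f(\bar x,\bar u,0)-f(x,u,0)|\le\bar L\|\bar x-x\|+\bar L|\bar u-u|$ and $|f(x,u,d)-f(x,u,0)|\le\bar k(|d|)$ for all $x,\bar x,u,\bar u$ and $d\in D$, and such that for every $x_0$ the solution of $\dot x(t)=f(x_t,\tilde k(x_t),0)$ exists for all $t\ge0$ and satisfies $\|x_t\|\le M e^{-\bar\sigma t}\|x_0\|$. Let $F:C^0([-r,0];\mathbb R^l)\times\mathbb R^k\times U\to\mathbb R^l$ and $\Psi:C^0([-r,0];\mathbb R^l)\to C^0([-r,0];\mathbb R^n)$ be continuous with $F(0,0,0)=0$, $\Psi(0)=0$, where $F$ maps bounded sets to bounded sets and for every bounded $\Omega$ there is $L_\Omega\ge0$ with $(z(0)-\bar z(0))^T(F(z,y,u)-F(\bar z,y,u))\le L_\Omega\|z-\bar z\|^2$ for all $(z,y,u),(\bar z,y,u)\in\Omega$. Suppose that $\dot z=F(z_t,y,u)$, $\hat x_t=\Psi(z_t)$ is a Robust Exponential Observer for (1.1): there are $\gamma,\sigma>0$, $g\in K$, $a\in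 K_\infty$ such that for all $(x_0,z_0)$ and all $u\in L^\infty_{loc}(\mathbb R_+;U)$, $d\in L^\infty_{loc}(\mathbb R_+;D)$, $\xi\in L^\infty_{loc}(\mathbb R_+;\mathbb R^k)$ the solution of $\dot x=f(x_t,u,d)$, $\dot z=F(z_t,h(x_t)+\xi,u)$ with initial condition $(x_0,z_0)$ exists for all $t\ge0$ and, for all $t\ge 0$, $$\|\hat x_t-x_t\|\le e^{-\sigma t}a(\|x_0\|+\|z_0\|)+\gamma\sup_{0\le s\le t}\big(|\xi(s)|e^{-\sigma(t-s)}\big)+\sup_{0\le s\le t}g(|d(s)|).\tag{2.5}$$ Suppose moreover that for every bounded $S\subset C^0([-r,0];\mathbb R^l)\times U$ there is $L_S\ge0$ with $|R(\Psi(z),u,0)-R(\Psi(\bar z),u,0)|\le L_S\|z-\bar z\|$ for all $(z,u),(\bar z,u)\in S$. **Corollary 2.4.** There exist constants $\bar\delta,\omega,\hat\gamma>0$ and functions $\hat g,\hat a\in K$ such that, for every sampling sequence with $\tau_0=0$, $\lim_{i\to\infty}\tau_i=+\infty$, $0<\tau_{i+1}-\tau_i\le\bar\delta$ for all $i\ge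 0$, for every $(x_0,z_0)\in C^0([-r,0];\mathbb R^n)\times C^0([-r,0];\mathbb R^l)$, $\xi\in L^\infty_{loc}(\mathbb R_+;\mathbb R^k)$ and $d\in L^\infty_{loc}(\mathbb R_+;D)$, the closed loop of $\dot x(t)=f(x_t,u(t),d(t))$ with $$\begin{aligned}&\dot z(t)=F(z_t,w(t),u(t)),\quad \hat x_t=\Psi(z_t), && t\ge0,\\ &\dot w(t)=R(\Psi(z_t),u(t),0),\quad u(t)=\tilde k(\hat x_{\tau_i}), && t\in[\tau_i,\tau_{i+1}),\\ &w(\tau_i)=h(x_{\tau_i})+\xi(\tau_i), && i=0,1,2,\dots,\end{aligned}$$ and initial condition $(x_0,z_0)$ has a solution $(x,z,w,u)$ on $[0,\infty)$, every solution on a bounded interval $[0,T)$ extends to a solution on $[0,\infty)$, and every solution on $[0,\infty)$ satisfies $$\|x_t\|+\|\hat x_t\|\le e^{-\omega t}\hat a(\|x_0\|+\|z_0\|)+\hat\gamma\sup_{0\le s\le t}|\xi(s)|+\sup_{0\le s\le t}\hat g(|d(s)|),\qquad\forall t\ge0.\tag{2.14}$$ Moreover, if the function $a$ in (2.5) is linear,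 then $\hat a$ can be taken linear too. -/

import Mathlib

open Set Filter Topology MeasureTheory
open scoped NNReal

/-- `ℝⁿ` with its Euclidean norm. -/
abbrev Vec (n : ℕ) : Type := EuclideanSpace ℝ (Fin n)

/-- The space `C⁰([-r, 0]; ℝⁿ)` with the maximum norm. -/
abbrev Hist (r : ℝ≥0) (n : ℕ) : Type := C(Icc (-(r : ℝ)) 0, Vec n)

/-- The point `0` of the interval `[-r, 0]`. -/
def origin (r : ℝ≥0) : Icc (-(r : ℝ)) 0 := ⟨0, by simp⟩

open Classical in
/-- The `r`-history `x_t`, `(x_t)(θ) = x (t + θ)` for `θ ∈ [-r, 0]`. The value `0` is a dummy,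
taken only where `x` is not continuous on `[t - r, t]`; it never occurs along a solution. -/
noncomputable def hist (r : ℝ≥0) {n : ℕ} (x : ℝ → Vec n) (t : ℝ) : Hist r n :=
  if hx : Continuous (fun θ : Icc (-(r : ℝ)) 0 => x (t + θ)) then ⟨_, hx⟩ else 0

theorem hist_apply (r : ℝ≥0) {n : ℕ} {x : ℝ → Vec n} {t : ℝ}
    (hx : ContinuousOn x (Icc (t - r) t)) (θ : Icc (-(r : ℝ)) 0) :
    hist r x t θ = x (t + θ) := by
  have hc : Continuous (fun θ : Icc (-(r : ℝ)) 0 => x (t + θ)) := by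
    refine hx.comp_continuous (by fun_prop) ?_
    rintro ⟨θ, h1, h2⟩
    constructor
    · linarith
    · linarith
  rw [hist, dif_pos hc]
  rfl

/-- Class `K`: (strictly) increasing continuous `ρ : ℝ₊ → ℝ₊` with `ρ 0 = 0`.
Only the values on `[0, ∞)` matter. -/
structure ClassK (ρ : ℝ → ℝ) : Prop where
  strictMonoOn : StrictMonoOn ρ (Ici 0)
  continuousOn : ContinuousOn ρ (Ici 0)
  map_zero : ρ 0 = 0

/-- Class `K_∞`: unbounded functions of class `K`. -/
structure ClassKInf (ρ : ℝ → ℝ) : Prop extends ClassK ρ where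
  tendsto_atTop : Tendsto ρ atTop atTop

/-- Linearity of a function on `[0, ∞)`. -/
def IsLinearGain (ρ : ℝ → ℝ) : Prop := ∃ c : ℝ, ∀ s, 0 ≤ s → ρ s = c * s

/-- `L^∞_loc(ℝ₊; S)`: Lebesgue measurable, locally bounded functions on `[0, ∞)` with values
in `S` (everywhere, not just almost everywhere). -/
structure LInfLoc {p : ℕ} (S : Set (Vec p)) (v : ℝ → Vec p) : Prop where
  aemeasurable : AEMeasurable v (volume.restrict (Ici 0))
  mem : ∀ t, 0 ≤ t → v t ∈ S
  bounded : ∀ T, 0 ≤ T → ∃ C, ∀ t ∈ Icc 0 T, ‖v t‖ ≤ C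

/-- Absolute continuity on every compact subinterval of the interval `J`. -/
def LocallyAC {p : ℕ} (x : ℝ → Vec p) (J : Set ℝ) : Prop :=
  ∀ a ∈ J, ∀ b ∈ J, a ≤ b → AbsolutelyContinuousOnInterval x a b

/-- `x` is a (Carathéodory) solution on the interval `J` (where `J = [0, ∞)` or `J = [0, T)`) of
the time-delay system `ẋ(t) = G(t, x_t)` with initial condition `x₀`. -/
structure IsDelaySol (r : ℝ≥0) {n : ℕ} (G : ℝ → Hist r n → Vec n) (x₀ : Hist r n)
    (J : Set ℝ) (x : ℝ → Vec n) : Prop where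
  history_eq : ∀ θ : Icc (-(r : ℝ)) 0, x θ = x₀ θ
  continuousOn : ContinuousOn x (Icc (-(r : ℝ)) 0 ∪ J)
  locallyAC : LocallyAC x J
  deriv_eq : ∀ᵐ t ∂volume, t ∈ J → HasDerivAt x (G t (hist r x t)) t

/-- Regularity of the right-hand side `f` on `C⁰([-r, 0]; ℝⁿ) × U × D` and of the output map `h`:
continuity, boundedness on bounded sets, the one-sided Lipschitz condition, equilibrium at `0`. -/
structure RegularSystem (r : ℝ≥0) {n m q k : ℕ} (U : Set (Vec m)) (D : Set (Vec q))
    (f : Hist r n → Vec m → Vec q → Vec n) (h : Hist r n → Vec k) : Prop where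
  continuousOn_f : ContinuousOn (fun p : Hist r n × Vec m × Vec q => f p.1 p.2.1 p.2.2)
    (univ ×ˢ (U ×ˢ D))
  continuous_h : Continuous h
  f_zero : f 0 0 0 = 0
  h_zero : h 0 = 0
  bounded_f : ∀ Ω : Set (Hist r n × Vec m × Vec q), Bornology.IsBounded Ω →
    Ω ⊆ univ ×ˢ (U ×ˢ D) →
    Bornology.IsBounded ((fun p : Hist r n × Vec m × Vec q => f p.1 p.2.1 p.2.2) '' Ω)
  bounded_h : ∀ Ω : Set (Hist r n), Bornology.IsBounded Ω → Bornology.IsBounded (h '' Ω)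
  oneSided : ∀ S : Set (Hist r n × Vec m × Vec q), Bornology.IsBounded S →
    S ⊆ univ ×ˢ (U ×ˢ D) → ∃ L : ℝ, 0 ≤ L ∧ ∀ x x' u d, (x, u, d) ∈ S → (x', u, d) ∈ S →
      inner ℝ (x (origin r) - x' (origin r)) (f x u d - f x' u d) ≤ L * ‖x - x'‖ ^ 2

/-- `x` is a solution on `[0, ∞)` of `ẋ = f(x_t, u, d)` with initial condition `x₀`. -/
def IsPlantSol (r : ℝ≥0) {n m q : ℕ} (f : Hist r n → Vec m → Vec q → Vec n)
    (u : ℝ → Vec m) (d : ℝ → Vec q) (x₀ : Hist r n) (x : ℝ → Vec n) : Prop :=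
  IsDelaySol r (fun t φ => f φ (u t) (d t)) x₀ (Ici 0) x

/-- Forward completeness. -/
def ForwardComplete (r : ℝ≥0) {n m q : ℕ} (U : Set (Vec m)) (D : Set (Vec q))
    (f : Hist r n → Vec m → Vec q → Vec n) : Prop :=
  ∀ (x₀ : Hist r n) (u : ℝ → Vec m) (d : ℝ → Vec q), LInfLoc U u → LInfLoc D d →
    ∃ x : ℝ → Vec n, IsPlantSol r f u d x₀ x

/-- Along all solutions the output map is (locally absolutely continuous in time and)
differentiable almost everywhere with derivative `R(x_t, u(t), d(t))`, where `R` is continuous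
and globally Lipschitz in the state, up to a class `K` function of the disturbance. -/
structure OutputDerivative (r : ℝ≥0) {n m q k : ℕ} (U : Set (Vec m)) (D : Set (Vec q))
    (f : Hist r n → Vec m → Vec q → Vec n) (h : Hist r n → Vec k)
    (R : Hist r n → Vec m → Vec q → Vec k) : Prop where
  continuousOn_R : ContinuousOn (fun p : Hist r n × Vec m × Vec q => R p.1 p.2.1 p.2.2)
    (univ ×ˢ (U ×ˢ D))
  deriv_output : ∀ (x₀ : Hist r n) (u : ℝ → Vec m) (d : ℝ → Vec q) (x : ℝ → Vec n),
    LInfLoc U u → LInfLoc D d → IsPlantSol r f u d x₀ x →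
      LocallyAC (fun t => h (hist r x t)) (Ici 0) ∧
      ∀ᵐ t ∂volume, t ∈ Ici (0 : ℝ) →
        HasDerivAt (fun t => h (hist r x t)) (R (hist r x t) (u t) (d t)) t
  lipschitz : ∃ L : ℝ, 0 ≤ L ∧ ∃ κ : ℝ → ℝ, ClassK κ ∧
    ∀ (x x' : Hist r n), ∀ u ∈ U, ∀ d ∈ D, ‖R x' u 0 - R x u d‖ ≤ L * ‖x' - x‖ + κ ‖d‖

/-- The system `ż = F(z_t, y, u)`, `x̂_t = Ψ(z_t)` is a Robust Exponential Observer for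
`ẋ = f(x_t, u, d)`, `y = h(x_t) + ξ`, with convergence rate `σ`, noise gain `γ`, disturbance gain
`g` and bound function `a`. -/
structure IsREOWith (r : ℝ≥0) {n m q k l : ℕ} (U : Set (Vec m)) (D : Set (Vec q))
    (f : Hist r n → Vec m → Vec q → Vec n) (h : Hist r n → Vec k)
    (F : Hist r l → Vec k → Vec m → Vec l) (Ψ : Hist r l → Hist r n)
    (σ γ : ℝ) (g a : ℝ → ℝ) : Prop where
  continuousOn_F : ContinuousOn (fun p : Hist r l × Vec k × Vec m => F p.1 p.2.1 p.2.2)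
    (univ ×ˢ (univ ×ˢ U))
  continuous_Ψ : Continuous Ψ
  F_zero : F 0 0 0 = 0
  Ψ_zero : Ψ 0 = 0
  bounded_F : ∀ Ω : Set (Hist r l × Vec k × Vec m), Bornology.IsBounded Ω →
    Ω ⊆ univ ×ˢ (univ ×ˢ U) →
    Bornology.IsBounded ((fun p : Hist r l × Vec k × Vec m => F p.1 p.2.1 p.2.2) '' Ω)
  oneSided : ∀ Ω : Set (Hist r l × Vec k × Vec m), Bornology.IsBounded Ω →
    Ω ⊆ univ ×ˢ (univ ×ˢ U) → ∃ L : ℝ, 0 ≤ L ∧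
      ∀ z z' y u, (z, y, u) ∈ Ω → (z', y, u) ∈ Ω →
        inner ℝ (z (origin r) - z' (origin r)) (F z y u - F z' y u) ≤ L * ‖z - z'‖ ^ 2
  σ_pos : 0 < σ
  γ_pos : 0 < γ
  classK_g : ClassK g
  classKInf_a : ClassKInf a
  exists_sol : ∀ (x₀ : Hist r n) (z₀ : Hist r l) (u : ℝ → Vec m) (d : ℝ → Vec q) (ξ : ℝ → Vec k),
    LInfLoc U u → LInfLoc D d → LInfLoc univ ξ →
      ∃ (x : ℝ → Vec n) (z : ℝ → Vec l), IsPlantSol r f u d x₀ x ∧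
        IsDelaySol r (fun t φ => F φ (h (hist r x t) + ξ t) (u t)) z₀ (Ici 0) z
  estimate : ∀ (x₀ : Hist r n) (z₀ : Hist r l) (u : ℝ → Vec m) (d : ℝ → Vec q) (ξ : ℝ → Vec k)
    (x : ℝ → Vec n) (z : ℝ → Vec l),
    LInfLoc U u → LInfLoc D d → LInfLoc univ ξ → IsPlantSol r f u d x₀ x →
    IsDelaySol r (fun t φ => F φ (h (hist r x t) + ξ t) (u t)) z₀ (Ici 0) z →
    ∀ t : ℝ, 0 ≤ t →
      ‖Ψ (hist r z t) - hist r x t‖ ≤ Real.exp (-σ * t) * a (‖x₀‖ + ‖z₀‖)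
        + γ * (⨆ s : Icc (0 : ℝ) t, ‖ξ s‖ * Real.exp (-σ * (t - s)))
        + ⨆ s : Icc (0 : ℝ) t, g ‖d s‖

/-- Lipschitz continuity of `z ↦ R(Ψ(z), u, 0)` on bounded sets. -/
def PredictorLipschitz (r : ℝ≥0) {n m q k l : ℕ} (U : Set (Vec m))
    (R : Hist r n → Vec m → Vec q → Vec k) (Ψ : Hist r l → Hist r n) : Prop :=
  ∀ S : Set (Hist r l × Vec m), Bornology.IsBounded S → S ⊆ univ ×ˢ U →
    ∃ L : ℝ, 0 ≤ L ∧ ∀ z z' u, (z, u) ∈ S → (z', u) ∈ S →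
      ‖R (Ψ z) u 0 - R (Ψ z') u 0‖ ≤ L * ‖z - z'‖

/-- Global exponential stabilizability by the globally Lipschitz state feedback `u = kf(x_t)`,
with unconstrained inputs and globally Lipschitz undisturbed dynamics. -/
structure Stabilizable (r : ℝ≥0) {n m q : ℕ} (U : Set (Vec m)) (D : Set (Vec q))
    (f : Hist r n → Vec m → Vec q → Vec n) (kf : Hist r n → Vec m) : Prop where
  f_zero : f 0 0 0 = 0
  input_set : U = univ
  kf_zero : kf 0 = 0
  lipschitz : ∃ Lb : ℝ, 0 < Lb ∧ ∀ (x x' : Hist r n) (u u' : Vec m),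
    ‖kf x' - kf x‖ + ‖f x' u' 0 - f x u 0‖ ≤ Lb * ‖x' - x‖ + Lb * ‖u' - u‖
  disturbance : ∃ kb : ℝ → ℝ, ClassK kb ∧ ∀ (x : Hist r n) (u : Vec m), ∀ d ∈ D,
    ‖f x u d - f x u 0‖ ≤ kb ‖d‖
  stable : ∃ σ M : ℝ, 0 < σ ∧ 0 < M ∧ ∀ x₀ : Hist r n,
    (∃ x : ℝ → Vec n, IsDelaySol r (fun _ φ => f φ (kf φ) 0) x₀ (Ici 0) x) ∧
    ∀ x : ℝ → Vec n, IsDelaySol r (fun _ φ => f φ (kf φ) 0) x₀ (Ici 0) x →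
      ∀ t : ℝ, 0 ≤ t → ‖hist r x t‖ ≤ M * Real.exp (-σ * t) * ‖x₀‖

/-- Sampling sequences with diameter at most `δ`. -/
structure IsSampling (τ : ℕ → ℝ) (δ : ℝ) : Prop where
  zero : τ 0 = 0
  tendsto : Tendsto τ atTop atTop
  pos : ∀ i, 0 < τ (i + 1) - τ i
  le : ∀ i, τ (i + 1) - τ i ≤ δ

/-- `(x, z, w, u)` is a solution on the interval `J` (where `J = [0, ∞)` or `J = [0, T)`) of the
closed loop of the plant, the sampled-data observer with inter-sample output predictor `w`, and
the sample-and-hold feedback `u(t) = kf(x̂_{τ_i})` on `[τ_i, τ_{i+1})`, where `x̂_t = Ψ(z_t)`. -/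
structure IsClosedLoopSol (r : ℝ≥0) {n m q k l : ℕ}
    (f : Hist r n → Vec m → Vec q → Vec n) (h : Hist r n → Vec k)
    (R : Hist r n → Vec m → Vec q → Vec k)
    (F : Hist r l → Vec k → Vec m → Vec l) (Ψ : Hist r l → Hist r n)
    (kf : Hist r n → Vec m) (τ : ℕ → ℝ) (d : ℝ → Vec q) (ξ : ℝ → Vec k)
    (x₀ : Hist r n) (z₀ : Hist r l) (J : Set ℝ)
    (x : ℝ → Vec n) (z : ℝ → Vec l) (w : ℝ → Vec k) (u : ℝ → Vec m) : Prop where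
  plant : IsDelaySol r (fun t φ => f φ (u t) (d t)) x₀ J x
  observer : IsDelaySol r (fun t φ => F φ (w t) (u t)) z₀ J z
  predictor_ac : ∀ i, LocallyAC w (J ∩ Ico (τ i) (τ (i + 1)))
  predictor_deriv : ∀ i, ∀ᵐ t ∂volume, t ∈ J ∩ Ico (τ i) (τ (i + 1)) →
    HasDerivAt w (R (Ψ (hist r z t)) (u t) 0) t
  predictor_reset : ∀ i, τ i ∈ J → w (τ i) = h (hist r x (τ i)) + ξ (τ i)
  feedback : ∀ i, ∀ t ∈ J ∩ Ico (τ i) (τ (i + 1)), u t = kf (Ψ (hist r z (τ i)))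

/-! ### Absolutely continuous functions -/

/-! Sampling closes two feedback loops, and a small sampling period gives each a gain below one. The
observer estimate allows arbitrary measurement noise, so any signal `w` may replace the output once
`w - h(x_t)` is called noise (`error_le`). Between samples `w - h(x_t)` starts from `ξ(τ_i)` and has
derivative `R(x̂, u, 0) - R(x, u, d)`, of size at most `L‖x̂ - x‖ + κ(|d|)`. Over an interval of
length at most `δ` the observer error thus re-enters its own estimate with gain `δ L γ e^σ ≤ 1/2`,
and it is absorbed in an exponentially weighted supremum (`le_exp_of_self_improving`,
`norm_observer_error_le`).

The applied input then differs from the ideal sampled feedback `kf(x_{τ_i})` by `Lb` times an error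
that is a decaying exponential plus a constant. For the state, the nominal closed loop restarted a
time `T` earlier shrinks the state by a fixed factor, and the true trajectory stays close to it by a
Gronwall estimate with memory (`sq_norm_le_of_inner_le`). The mismatch due to sampling is `δ` times
a velocity that is linearly bounded by the recent state. The same self-improvement argument gives
exponential decay (`exists_decay`), and adding the two estimates gives the result.

Existence cannot rest on a contraction argument, since `F` is only continuous in its signal and
one-sided Lipschitz in the state. On one sampling interval the predictor is the limit of lagged
predictors built by the method of steps. Compactness comes from an a priori bound obtained by
comparing the observer with an auxiliary plant trajectory (`exists_predictor_bound`), and the limit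
is identified through continuous dependence of the observer on its signal. The same bound shows that
the signals of an arbitrary solution on `[0, T)` are bounded. By uniqueness that solution is then
the restriction of global plant and observer trajectories, and it can be continued from one sampling
time to the next. -/

theorem AbsolutelyContinuousOnInterval.of_dist_le {X Y : Type*} [PseudoMetricSpace X]
    [PseudoMetricSpace Y] {f : ℝ → X} {g : ℝ → Y} {a b K : ℝ}
    (hf : AbsolutelyContinuousOnInterval f a b)
    (h : ∀ s ∈ uIcc a b, ∀ t ∈ uIcc a b, dist (g s) (g t) ≤ K * dist (f s) (f t)) :
    AbsolutelyContinuousOnInterval g a b := by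
  have h0 := Filter.Tendsto.const_mul K hf
  rw [mul_zero] at h0
  unfold AbsolutelyContinuousOnInterval
  refine squeeze_zero' (Eventually.of_forall fun E => Finset.sum_nonneg fun _ _ => dist_nonneg)
    ?_ h0
  refine Filter.Eventually.filter_mono inf_le_right ?_
  rw [eventually_principal]
  intro E hE
  rw [Finset.mul_sum]
  exact Finset.sum_le_sum fun i hi => h _ (hE.1 i hi).1 _ (hE.1 i hi).2

theorem AbsolutelyContinuousOnInterval.congr_on {X : Type*} [PseudoMetricSpace X]
    {f g : ℝ → X} {a b : ℝ} (hf : AbsolutelyContinuousOnInterval f a b)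
    (h : EqOn g f (uIcc a b)) : AbsolutelyContinuousOnInterval g a b :=
  hf.of_dist_le (K := 1) fun s hs t ht => by rw [h hs, h ht, one_mul]

theorem AbsolutelyContinuousOnInterval.comp_const_add {X : Type*} [PseudoMetricSpace X]
    {f : ℝ → X} {a b c : ℝ} (hf : AbsolutelyContinuousOnInterval f (c + a) (c + b)) :
    AbsolutelyContinuousOnInterval (fun t => f (c + t)) a b := by
  rw [absolutelyContinuousOnInterval_iff] at hf ⊢
  intro ε hε
  obtain ⟨δ, hδ, H⟩ := hf ε hε
  refine ⟨δ, hδ, fun E hE hlt => ?_⟩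
  have hmem : ∀ t, t ∈ uIcc a b → c + t ∈ uIcc (c + a) (c + b) := by
    intro t ht
    rw [mem_uIcc] at ht ⊢
    grind
  refine H (E.1, fun i => (c + (E.2 i).1, c + (E.2 i).2)) ⟨?_, ?_⟩ (by simpa using hlt)
  · intro i hi
    exact ⟨hmem _ (hE.1 i hi).1, hmem _ (hE.1 i hi).2⟩
  · intro i hi j hj hij
    have := hE.2 hi hj hij
    rw [Function.onFun, Set.disjoint_left] at this ⊢
    intro t ht ht'
    refine this (a := t - c) ?_ ?_
    · simp only [mem_uIoc] at ht ⊢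
      grind
    · simp only [mem_uIoc] at ht' ⊢
      grind

/-- The fundamental theorem of calculus for `g - Φ`, whose derivative is nonpositive almost
everywhere. All differential inequalities below reduce to this form. -/
theorem AbsolutelyContinuousOnInterval.sub_le_sub_of_deriv_le {g Φ Φ' : ℝ → ℝ} {a b : ℝ}
    (hab : a ≤ b) (hg : AbsolutelyContinuousOnInterval g a b)
    (hΦ : ∀ t, HasDerivAt Φ (Φ' t) t) (hc : Continuous Φ')
    (h : ∀ᵐ t ∂volume, t ∈ Ioo a b → ∃ y, HasDerivAt g y t ∧ y ≤ Φ' t) :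
    g b - g a ≤ Φ b - Φ a := by
  have hΦc : ContDiff ℝ 1 Φ := by
    rw [contDiff_one_iff_deriv]
    refine ⟨fun t => (hΦ t).differentiableAt, ?_⟩
    rwa [show deriv Φ = Φ' from funext fun t => (hΦ t).deriv]
  have hk := hg.sub (hΦc.contDiffOn.absolutelyContinuousOnInterval (a := a) (b := b))
  have hle : ∫ t in a..b, deriv (g - Φ) t ≤ 0 := by
    rw [intervalIntegral.integral_of_le hab, integral_Ioc_eq_integral_Ioo]
    refine integral_nonpos_of_ae ?_
    rw [EventuallyLE, ae_restrict_iff' measurableSet_Ioo]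
    filter_upwards [h] with t ht htm
    obtain ⟨y, hy, hle⟩ := ht htm
    rw [(hy.sub (hΦ t)).deriv]
    simpa using hle
  rw [hk.integral_deriv_eq_sub] at hle
  simp only [Pi.sub_apply] at hle
  linarith

theorem AbsolutelyContinuousOnInterval.norm_sub_le_of_norm_deriv_le {p : ℕ} {e : ℝ → Vec p}
    {a b C : ℝ} (hab : a ≤ b) (he : AbsolutelyContinuousOnInterval e a b)
    (h : ∀ᵐ t ∂volume, t ∈ Ioo a b → ∃ y, HasDerivAt e y t ∧ ‖y‖ ≤ C) :
    ‖e b - e a‖ ≤ C * (b - a) := by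
  rcases eq_or_ne (e b - e a) 0 with h0 | h0
  · rw [h0, norm_zero]
    rcases hab.eq_or_lt with rfl | hlt
    · simp
    -- A negative `C` would contradict the hypothesis at almost every point of an interval of
    -- positive measure.
    have hC : 0 ≤ C := by
      by_contra hC
      have hz : ∀ᵐ t ∂volume, t ∉ Ioo a b := by
        filter_upwards [h] with t ht htm
        obtain ⟨y, -, hy⟩ := ht htm
        exact hC ((norm_nonneg y).trans hy)
      have h1 : volume (Ioo a b) = 0 := measure_eq_zero_iff_ae_notMem.2 hz
      rw [Real.volume_Ioo, ENNReal.ofReal_eq_zero] at h1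
      linarith
    exact mul_nonneg hC (by linarith)
  -- Pairing with the increment itself reduces the vector bound to the scalar comparison.
  · set v := e b - e a with hv
    have hg : AbsolutelyContinuousOnInterval (fun t => inner ℝ v (e t)) a b := by
      refine he.of_dist_le (K := ‖v‖) fun s _ t _ => ?_
      rw [dist_eq_norm, dist_eq_norm, ← inner_sub_right]
      exact norm_inner_le_norm _ _
    have := hg.sub_le_sub_of_deriv_le (Φ := fun t => ‖v‖ * C * t) (Φ' := fun _ => ‖v‖ * C) hab
      (fun t => by simpa using (hasDerivAt_id t).const_mul (‖v‖ * C)) continuous_const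
      (by
        filter_upwards [h] with t ht htm
        obtain ⟨y, hy, hle⟩ := ht htm
        refine ⟨inner ℝ v y, ?_, ?_⟩
        · simpa using (hasDerivAt_const t v).inner ℝ hy
        · exact (real_inner_le_norm _ _).trans (by gcongr))
    rw [← inner_sub_right, ← hv, real_inner_self_eq_norm_sq] at this
    have hpos : 0 < ‖v‖ := norm_pos_iff.2 h0
    have h2 : ‖v‖ * ‖v‖ ≤ ‖v‖ * (C * (b - a)) := by nlinarith
    exact le_of_mul_le_mul_left h2 hpos

/-! ### Comparison lemmas -/

/-- If every exponential bound on `φ` improves itself by a factor `1 / 2` up to an additive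
constant, then `φ` has an exponential bound with that constant. -/
theorem le_exp_of_self_improving {φ : ℝ → ℝ} {a b c ℓ : ℝ}
    (hφ : BddAbove (φ '' Icc a b)) (hc : 0 ≤ c)
    (H : ∀ t ∈ Icc a b, ∀ μ : ℝ, 0 ≤ μ → (∀ s ∈ Icc a t, φ s ≤ μ * Real.exp (ℓ * s)) →
      φ t ≤ c * Real.exp (ℓ * t) + μ / 2 * Real.exp (ℓ * t)) :
    ∀ t ∈ Icc a b, φ t ≤ 2 * c * Real.exp (ℓ * t) := by
  intro t₀ ht₀
  set ψ : ℝ → ℝ := fun s => φ s * Real.exp (-(ℓ * s)) with hψ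
  have hφψ : ∀ s, φ s = ψ s * Real.exp (ℓ * s) := by
    intro s
    rw [hψ, mul_assoc, ← Real.exp_add, neg_add_cancel, Real.exp_zero, mul_one]
  have hbdd : BddAbove (ψ '' Icc a b) := by
    obtain ⟨B, hB⟩ := hφ
    obtain ⟨B', hB'⟩ := (isCompact_Icc (a := a) (b := b)).bddAbove_image
      (f := fun s => Real.exp (-(ℓ * s))) (by fun_prop)
    refine ⟨max B 0 * B', ?_⟩
    rintro _ ⟨s, hs, rfl⟩
    have h1 : φ s ≤ max B 0 := (hB ⟨s, hs, rfl⟩).trans (le_max_left _ _)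
    have h2 : Real.exp (-(ℓ * s)) ≤ B' := hB' ⟨s, hs, rfl⟩
    exact mul_le_mul h1 h2 (Real.exp_pos _).le (le_max_right _ _)
  set S := sSup (ψ '' Icc a b) with hS
  have hle : ∀ s ∈ Icc a b, ψ s ≤ S := fun s hs => le_csSup hbdd ⟨s, hs, rfl⟩
  -- The best constant `S` is finite, so the hypothesis may be applied with `μ = max S 0`, and the
  -- factor `1 / 2` lets `S` be absorbed.
  have hmain : S ≤ c + max S 0 / 2 := by
    refine csSup_le ⟨_, t₀, ht₀, rfl⟩ ?_
    rintro _ ⟨t, ht, rfl⟩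
    have := H t ht (max S 0) (le_max_right _ _) (fun s hs => by
      rw [hφψ]
      gcongr
      exact (hle s ⟨hs.1, hs.2.trans ht.2⟩).trans (le_max_left _ _))
    rw [hφψ, ← add_mul] at this
    exact le_of_mul_le_mul_right this (Real.exp_pos _)
  rw [hφψ]
  gcongr
  refine (hle t₀ ht₀).trans ?_
  rcases le_total S 0 with h | h
  · linarith
  · rw [max_eq_left h] at hmain
    linarith

/-- A Gronwall estimate with memory: the one-sided growth condition may involve the running
supremum of `‖e‖`. -/
theorem sq_norm_le_of_inner_le {p : ℕ} {e : ℝ → Vec p} {a₀ a b A β ε : ℝ}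
    (hab : a ≤ b) (hA : 0 < A)
    (he : AbsolutelyContinuousOnInterval e a b) (hε : ∀ s ∈ Icc a₀ a, ‖e s‖ ≤ ε)
    (ha₀ : a₀ ≤ a)
    (h : ∀ᵐ t ∂volume, t ∈ Ioo a b → ∃ y, HasDerivAt e y t ∧
      ∀ N, (∀ s ∈ Icc a₀ t, ‖e s‖ ≤ N) → inner ℝ (e t) y ≤ A * N ^ 2 + β ^ 2) :
    ∀ t ∈ Icc a b, ‖e t‖ ^ 2 ≤
      2 * (ε ^ 2 * (1 + 2 * A * (b - a)) + 2 * β ^ 2 * (b - a)) * Real.exp (4 * A * (b - a)) := by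
  have hε0 : 0 ≤ ε := (norm_nonneg _).trans (hε a ⟨ha₀, le_rfl⟩)
  have hsq : AbsolutelyContinuousOnInterval (fun t => ‖e t‖ ^ 2) a b := by
    obtain ⟨B, hB⟩ := he.exists_bound
    have hn : AbsolutelyContinuousOnInterval (fun t => ‖e t‖) a b :=
      he.of_dist_le (K := 1) fun s _ t _ => by
        rw [one_mul, Real.dist_eq, dist_eq_norm]
        exact abs_norm_sub_norm_le _ _
    simpa only [sq] using! hn.mul hn
  set c : ℝ := ε ^ 2 * (1 + 2 * A * (b - a)) + 2 * β ^ 2 * (b - a) with hcdef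
  have hba : 0 ≤ b - a := by linarith
  have hc : 0 ≤ c := by positivity
  have key : ∀ t ∈ Icc a b, ‖e t‖ ^ 2 ≤
      2 * (c * Real.exp (-(4 * A * a))) * Real.exp (4 * A * t) := by
    refine le_exp_of_self_improving (φ := fun t => ‖e t‖ ^ 2) ?_ (by positivity) ?_
    · have := hsq.continuousOn
      rw [uIcc_of_le hab] at this
      exact isCompact_Icc.bddAbove_image this
    · intro t ht μ hμ hs
      have hAC : AbsolutelyContinuousOnInterval (fun t => ‖e t‖ ^ 2) a t :=
        hsq.mono (by rw [uIcc_of_le ht.1, uIcc_of_le hab]; exact Icc_subset_Icc_right ht.2)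
      -- The running supremum is at most `N` with `N² = ε² + μ e^{4As}`. Integrating the
      -- contribution `2Aμ e^{4As}` to the derivative of `‖e‖²` yields the factor `μ / 2`; this
      -- fixes the rate `4A`.
      have hstep := hAC.sub_le_sub_of_deriv_le
        (Φ := fun s => 2 * (A * ε ^ 2 + β ^ 2) * s + μ / 2 * Real.exp (4 * A * s))
        (Φ' := fun s => 2 * (A * (ε ^ 2 + μ * Real.exp (4 * A * s)) + β ^ 2)) ht.1
        (fun s => by
          have h1 : HasDerivAt (fun s : ℝ => Real.exp (4 * A * s))
              (Real.exp (4 * A * s) * (4 * A)) s := by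
            simpa using ((hasDerivAt_id s).const_mul (4 * A)).exp
          have h2 := ((hasDerivAt_id s).const_mul (2 * (A * ε ^ 2 + β ^ 2))).add
            (h1.const_mul (μ / 2))
          convert! h2 using 1
          ring)
        (by fun_prop)
        (by
          filter_upwards [h] with s hs' hsm
          obtain ⟨y, hy, hle⟩ := hs' ⟨hsm.1, hsm.2.trans_le ht.2⟩
          refine ⟨2 * inner ℝ (e s) y, hy.norm_sq, ?_⟩
          have hN : 0 ≤ ε ^ 2 + μ * Real.exp (4 * A * s) := by positivity
          have := hle (Real.sqrt (ε ^ 2 + μ * Real.exp (4 * A * s))) (fun q hq => by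
            apply Real.le_sqrt_of_sq_le
            rcases le_total q a with hqa | hqa
            · have := hε q ⟨hq.1, hqa⟩
              have h3 : ‖e q‖ ^ 2 ≤ ε ^ 2 := by gcongr
              have : 0 ≤ μ * Real.exp (4 * A * s) := by positivity
              linarith
            · have h3 := hs q ⟨hqa, hq.2.trans hsm.2.le⟩
              have h4 : μ * Real.exp (4 * A * q) ≤ μ * Real.exp (4 * A * s) := by
                gcongr
                exact hq.2
              have : 0 ≤ ε ^ 2 := by positivity
              linarith)
          rw [Real.sq_sqrt hN] at this
          linarith)
      have hea : ‖e a‖ ^ 2 ≤ ε ^ 2 := by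
        have := hε a ⟨ha₀, le_rfl⟩
        gcongr
      have hexp : (1 : ℝ) ≤ Real.exp (4 * A * (t - a)) :=
        Real.one_le_exp (mul_nonneg (by positivity) (by linarith [ht.1]))
      have hct : c ≤ c * Real.exp (-(4 * A * a)) * Real.exp (4 * A * t) := by
        rw [mul_assoc, ← Real.exp_add, show -(4 * A * a) + 4 * A * t = 4 * A * (t - a) by ring]
        exact le_mul_of_one_le_right hc hexp
      have h5 : 0 ≤ μ / 2 * Real.exp (4 * A * a) := by positivity
      have h6 : 2 * (A * ε ^ 2 + β ^ 2) * (t - a) ≤ 2 * (A * ε ^ 2 + β ^ 2) * (b - a) := by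
        have := ht.2
        gcongr
      have h7 : c = ε ^ 2 + 2 * (A * ε ^ 2 + β ^ 2) * (b - a) := by rw [hcdef]; ring
      linarith
  intro t ht
  refine (key t ht).trans ?_
  rw [← mul_assoc, mul_assoc (2 * c), ← Real.exp_add]
  gcongr
  have := ht.2
  nlinarith

/-! ### Histories -/

theorem hist_congr {r : ℝ≥0} {n : ℕ} {x x' : ℝ → Vec n} {t t' : ℝ}
    (h : ∀ θ ∈ Icc (-(r : ℝ)) 0, x (t + θ) = x' (t' + θ)) : hist r x t = hist r x' t' := by
  have : (fun θ : Icc (-(r : ℝ)) 0 => x (t + θ)) = fun θ : Icc (-(r : ℝ)) 0 => x' (t' + θ) :=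
    funext fun θ => h θ θ.2
  by_cases hx : Continuous fun θ : Icc (-(r : ℝ)) 0 => x (t + θ)
  · have hx' := hx
    rw [this] at hx'
    rw [hist, hist, dif_pos hx, dif_pos hx']
    ext1 θ
    exact h θ θ.2
  · have hx' := hx
    rw [this] at hx'
    rw [hist, hist, dif_neg hx, dif_neg hx']

theorem hist_congr_Icc {r : ℝ≥0} {n : ℕ} {x x' : ℝ → Vec n} {t : ℝ}
    (h : EqOn x x' (Icc (t - r) t)) : hist r x t = hist r x' t :=
  hist_congr fun θ hθ => h ⟨by linarith [hθ.1], by linarith [hθ.2]⟩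

theorem norm_hist_le {r : ℝ≥0} {n : ℕ} {x : ℝ → Vec n} {t N : ℝ} (hN : 0 ≤ N)
    (h : ∀ s ∈ Icc (t - r) t, ‖x s‖ ≤ N) : ‖hist r x t‖ ≤ N := by
  unfold hist
  split_ifs with hx
  · refine (ContinuousMap.norm_le _ hN).2 fun θ => ?_
    exact h _ ⟨by linarith [θ.2.1], by linarith [θ.2.2]⟩
  -- The dummy history satisfies the bound too, so continuity is not required.
  · rwa [norm_zero]

theorem hist_apply_origin {r : ℝ≥0} {n : ℕ} {x : ℝ → Vec n} {t : ℝ}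
    (hx : ContinuousOn x (Icc (t - r) t)) : hist r x t (origin r) = x t := by
  rw [hist_apply r hx]
  simp [origin]

theorem hist_sub {r : ℝ≥0} {n : ℕ} {x x' : ℝ → Vec n} {t : ℝ}
    (hx : ContinuousOn x (Icc (t - r) t)) (hx' : ContinuousOn x' (Icc (t - r) t)) :
    hist r (fun s => x s - x' s) t = hist r x t - hist r x' t := by
  ext1 θ
  rw [hist_apply r (x := fun s => x s - x' s) (hx.sub hx'), ContinuousMap.sub_apply,
    hist_apply r hx, hist_apply r hx']

theorem norm_hist_sub_le {r : ℝ≥0} {n : ℕ} {x x' : ℝ → Vec n} {t t' N : ℝ}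
    (hx : ContinuousOn x (Icc (t - r) t)) (hx' : ContinuousOn x' (Icc (t' - r) t')) (hN : 0 ≤ N)
    (h : ∀ θ ∈ Icc (-(r : ℝ)) 0, ‖x (t + θ) - x' (t' + θ)‖ ≤ N) :
    ‖hist r x t - hist r x' t'‖ ≤ N := by
  refine (ContinuousMap.norm_le _ hN).2 fun θ => ?_
  rw [ContinuousMap.sub_apply, hist_apply r hx, hist_apply r hx']
  exact h θ θ.2

theorem hist_comp_const_add {r : ℝ≥0} {n : ℕ} (x : ℝ → Vec n) (c t : ℝ) :
    hist r (fun s => x (c + s)) t = hist r x (c + t) :=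
  hist_congr fun θ _ => by rw [add_assoc]

theorem continuousOn_hist_Icc {r : ℝ≥0} {n : ℕ} {x : ℝ → Vec n} {c : ℝ}
    (hx : ContinuousOn x (Icc (-(r : ℝ)) c)) : ContinuousOn (hist r x) (Icc 0 c) := by
  rcases lt_or_ge c 0 with hc | hc
  · exact fun t ht => absurd (ht.1.trans ht.2) (not_le.2 hc)
  have hr : -(r : ℝ) ≤ c := by linarith [r.2]
  -- Clamping time to `[-r, c]` makes `x` continuous on the line; currying `(t, θ) ↦ x(t + θ)` then
  -- gives continuity in the maximum norm.
  have hy : Continuous fun s : ℝ => x (max (-(r : ℝ)) (min s c)) :=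
    hx.comp_continuous (by fun_prop) fun s => ⟨le_max_left _ _, max_le hr (min_le_right _ _)⟩
  let Y : C(ℝ × Icc (-(r : ℝ)) 0, Vec n) :=
    ⟨fun p => x (max (-(r : ℝ)) (min (p.1 + p.2) c)), hy.comp (by fun_prop)⟩
  refine (Y.curry.continuous.continuousOn (s := Icc 0 c)).congr fun t ht => ?_
  have hxt : ContinuousOn x (Icc (t - r) t) :=
    hx.mono (Icc_subset_Icc (by linarith [ht.1]) ht.2)
  ext1 θ
  rw [hist_apply r hxt]
  change x (t + θ) = x (max (-(r : ℝ)) (min (t + θ) c))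
  rw [min_eq_left (by linarith [θ.2.2, ht.2]), max_eq_right (by linarith [θ.2.1, ht.1])]

theorem continuousOn_hist_Ici {r : ℝ≥0} {n : ℕ} {x : ℝ → Vec n}
    (hx : ContinuousOn x (Ici (-(r : ℝ)))) : ContinuousOn (hist r x) (Ici 0) := by
  intro t ht
  have h := continuousOn_hist_Icc (c := t + 1) (hx.mono Icc_subset_Ici_self) t
    ⟨ht, by linarith⟩
  refine h.mono_of_mem_nhdsWithin ?_
  filter_upwards [self_mem_nhdsWithin, mem_nhdsWithin_of_mem_nhds (Iio_mem_nhds (lt_add_one t))]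
    with s h1 h2
  exact ⟨h1, le_of_lt h2⟩

/-! ### Solutions of delay equations -/

section Solutions

variable {r : ℝ≥0} {n : ℕ} {G G' : ℝ → Hist r n → Vec n} {x₀ : Hist r n} {J J' : Set ℝ}
  {x x' : ℝ → Vec n}

theorem IsDelaySol.mono (hx : IsDelaySol r G x₀ J x) (h : J' ⊆ J) : IsDelaySol r G x₀ J' x where
  history_eq := hx.history_eq
  continuousOn := hx.continuousOn.mono (union_subset_union_right _ h)
  locallyAC := fun a ha b hb hab => hx.locallyAC a (h ha) b (h hb) hab
  deriv_eq := by
    filter_upwards [hx.deriv_eq] with t ht htJ using ht (h htJ)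

theorem IsDelaySol.congr_rhs (hx : IsDelaySol r G x₀ J x)
    (h : ∀ t ∈ J, G t (hist r x t) = G' t (hist r x t)) : IsDelaySol r G' x₀ J x where
  history_eq := hx.history_eq
  continuousOn := hx.continuousOn
  locallyAC := hx.locallyAC
  deriv_eq := by
    filter_upwards [hx.deriv_eq] with t ht htJ
    rw [← h t htJ]
    exact ht htJ

theorem IsDelaySol.continuousOn_Icc (hx : IsDelaySol r G x₀ J x) {c : ℝ} (h : Icc 0 c ⊆ J) :
    ContinuousOn x (Icc (-(r : ℝ)) c) := by
  refine hx.continuousOn.mono fun t ht => ?_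
  rcases le_total t 0 with h0 | h0
  · exact Or.inl ⟨ht.1, h0⟩
  · exact Or.inr (h ⟨h0, ht.2⟩)

theorem IsDelaySol.continuousOn_Ici (hx : IsDelaySol r G x₀ (Ici 0) x) :
    ContinuousOn x (Ici (-(r : ℝ))) := by
  refine hx.continuousOn.mono fun t ht => ?_
  rcases le_total t 0 with h0 | h0
  · exact Or.inl ⟨ht, h0⟩
  · exact Or.inr h0

theorem IsDelaySol.continuousOn_hist (hx : IsDelaySol r G x₀ (Ici 0) x) :
    ContinuousOn (hist r x) (Ici 0) :=
  continuousOn_hist_Ici hx.continuousOn_Ici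

theorem IsDelaySol.continuousOn_window (hx : IsDelaySol r G x₀ (Ici 0) x) {t : ℝ} (ht : 0 ≤ t) :
    ContinuousOn x (Icc (t - r) t) :=
  hx.continuousOn_Ici.mono fun s hs => by
    have := hs.1
    rw [mem_Ici]
    linarith

theorem IsDelaySol.hist_zero (hx : IsDelaySol r G x₀ J x) : hist r x 0 = x₀ := by
  have h : (fun θ : Icc (-(r : ℝ)) 0 => x (0 + θ)) = x₀ :=
    funext fun θ => by rw [zero_add]; exact hx.history_eq θ
  have hc : Continuous (fun θ : Icc (-(r : ℝ)) 0 => x (0 + θ)) := by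
    rw [h]
    exact x₀.continuous
  unfold hist
  rw [dif_pos hc]
  ext1 θ
  exact congrFun h θ

theorem IsDelaySol.eqOn_history (hx : IsDelaySol r G x₀ J x) (hx' : IsDelaySol r G' x₀ J' x') :
    EqOn x x' (Icc (-(r : ℝ)) 0) := fun t ht =>
  (hx.history_eq ⟨t, ht⟩).trans (hx'.history_eq ⟨t, ht⟩).symm

/-- Uniqueness of solutions under a one-sided Lipschitz condition on bounded sets. -/
theorem IsDelaySol.eqOn {b : ℝ} (hx : IsDelaySol r G x₀ (Ico 0 b) x)
    (hx' : IsDelaySol r G x₀ (Ico 0 b) x')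
    (hG : ∀ c < b, ∀ B : ℝ, ∃ L : ℝ, 0 ≤ L ∧ ∀ t ∈ Icc 0 c, ∀ φ φ' : Hist r n, ‖φ‖ ≤ B → ‖φ'‖ ≤ B →
      inner ℝ (φ (origin r) - φ' (origin r)) (G t φ - G t φ') ≤ L * ‖φ - φ'‖ ^ 2) :
    EqOn x x' (Ico 0 b) := by
  intro c hc
  have hsub : Icc 0 c ⊆ Ico 0 b := fun t ht => ⟨ht.1, ht.2.trans_lt hc.2⟩
  have hxc := hx.continuousOn_Icc hsub
  have hxc' := hx'.continuousOn_Icc hsub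
  obtain ⟨B, hB⟩ := isCompact_Icc.exists_bound_of_continuousOn hxc
  obtain ⟨B', hB'⟩ := isCompact_Icc.exists_bound_of_continuousOn hxc'
  obtain ⟨L, hL, H⟩ := hG c hc.2 (max (max B B') 0)
  have h0 : (0 : ℝ) ∈ Ico 0 b := ⟨le_rfl, hc.1.trans_lt hc.2⟩
  have hAC := (hx.locallyAC 0 h0 c hc hc.1).fun_sub (hx'.locallyAC 0 h0 c hc hc.1)
  have hr : -(r : ℝ) ≤ 0 := by linarith [r.2]
  -- The difference has zero history and no forcing, so Gronwall makes it vanish. The rate `L + 1`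
  -- replaces `L` to be positive.
  have := sq_norm_le_of_inner_le (a₀ := -(r : ℝ)) (A := L + 1) (β := 0) (ε := 0) hc.1
    (by linarith) hAC (fun s hs => by simp [hx.eqOn_history hx' hs]) hr (by
      filter_upwards [hx.deriv_eq, hx'.deriv_eq] with t ht ht' htm
      have htm1 : t ∈ Ico 0 b := hsub (Ioo_subset_Icc_self htm)
      refine ⟨_, (ht htm1).sub (ht' htm1), fun N hN => ?_⟩
      have hw : ∀ s ∈ Icc (t - r) t, s ∈ Icc (-(r : ℝ)) c := fun s hs =>
        ⟨by linarith [hs.1, htm.1], by linarith [hs.2, htm.2]⟩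
      have hxt := hxc.mono hw
      have hxt' := hxc'.mono hw
      have hM : (0 : ℝ) ≤ max (max B B') 0 := le_max_right _ _
      have h1 := H t ⟨htm.1.le, htm.2.le⟩ (hist r x t) (hist r x' t)
        (norm_hist_le hM fun s hs => (hB s (hw s hs)).trans (by simp))
        (norm_hist_le hM fun s hs => (hB' s (hw s hs)).trans (by simp))
      rw [hist_apply_origin hxt, hist_apply_origin hxt', ← hist_sub hxt hxt'] at h1
      have hN0 : 0 ≤ N := (norm_nonneg _).trans (hN t ⟨by linarith [htm.1], le_rfl⟩)
      have h2 : ‖hist r (fun s => x s - x' s) t‖ ≤ N :=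
        norm_hist_le hN0 fun s hs => hN s ⟨(hw s hs).1, hs.2⟩
      have h3 : ‖hist r (fun s => x s - x' s) t‖ ^ 2 ≤ N ^ 2 := by gcongr
      nlinarith [sq_nonneg N]) c ⟨hc.1, le_rfl⟩
  have h4 : ‖x c - x' c‖ ^ 2 ≤ 0 := by simpa using this
  have h5 : ‖x c - x' c‖ = 0 := by nlinarith [norm_nonneg (x c - x' c)]
  exact sub_eq_zero.1 (norm_eq_zero.1 h5)

end Solutions

/-! ### Locally bounded measurable functions -/

section LInf

variable {p : ℕ} {S : Set (Vec p)} {v v' : ℝ → Vec p}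

theorem LInfLoc.of_continuousOn (hv : ContinuousOn v (Ici 0)) : LInfLoc univ v where
  aemeasurable := hv.aemeasurable measurableSet_Ici
  mem _ _ := mem_univ _
  bounded _ _ := isCompact_Icc.exists_bound_of_continuousOn (hv.mono Icc_subset_Ici_self)

theorem LInfLoc.const (y : Vec p) : LInfLoc univ fun _ => y :=
  .of_continuousOn continuousOn_const

theorem LInfLoc.sub (hv : LInfLoc univ v) (hv' : LInfLoc univ v') :
    LInfLoc univ fun t => v t - v' t where
  aemeasurable := hv.aemeasurable.sub hv'.aemeasurable
  mem _ _ := mem_univ _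
  bounded T hT := by
    obtain ⟨C, hC⟩ := hv.bounded T hT
    obtain ⟨C', hC'⟩ := hv'.bounded T hT
    exact ⟨C + C', fun t ht => (norm_sub_le _ _).trans (add_le_add (hC t ht) (hC' t ht))⟩

theorem LInfLoc.glue (hv : LInfLoc S v) (hv' : LInfLoc S v') (b : ℝ) :
    LInfLoc S fun t => if t < b then v t else v' t where
  aemeasurable := by
    have hun : Ici (0 : ℝ) = (Ici 0 ∩ Iio b) ∪ (Ici 0 ∩ Ici b) := by
      rw [← inter_union_distrib_left, Iio_union_Ici, inter_univ]
    rw [hun, aemeasurable_union_iff]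
    constructor
    · refine (hv.aemeasurable.mono_measure
        (Measure.restrict_mono_set _ inter_subset_left)).congr ?_
      refine (ae_restrict_iff' (measurableSet_Ici.inter measurableSet_Iio)).2 ?_
      exact Eventually.of_forall fun t ht => (if_pos ht.2).symm
    · refine (hv'.aemeasurable.mono_measure
        (Measure.restrict_mono_set _ inter_subset_left)).congr ?_
      refine (ae_restrict_iff' (measurableSet_Ici.inter measurableSet_Ici)).2 ?_
      exact Eventually.of_forall fun t ht => (if_neg (not_lt.2 ht.2)).symm
  mem t ht := by
    split_ifs
    · exact hv.mem t ht
    · exact hv'.mem t ht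
  bounded T hT := by
    obtain ⟨C, hC⟩ := hv.bounded T hT
    obtain ⟨C', hC'⟩ := hv'.bounded T hT
    refine ⟨max C C', fun t ht => ?_⟩
    split_ifs
    · exact (hC t ht).trans (le_max_left _ _)
    · exact (hC' t ht).trans (le_max_right _ _)

theorem LInfLoc.congr (hv : LInfLoc S v) (h : EqOn v' v (Ici 0)) : LInfLoc S v' where
  aemeasurable := hv.aemeasurable.congr ((ae_restrict_iff' measurableSet_Ici).2
    (Eventually.of_forall fun t ht => (h ht).symm))
  mem t ht := by
    rw [h ht]
    exact hv.mem t ht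
  bounded T hT := by
    obtain ⟨C, hC⟩ := hv.bounded T hT
    refine ⟨C, fun t ht => ?_⟩
    rw [h ht.1]
    exact hC t ht

/-- The truncation of `v` to `[0, b)`. -/
noncomputable def truncate {p : ℕ} (v : ℝ → Vec p) (b : ℝ) (t : ℝ) : Vec p :=
  if t < b then v t else 0

theorem truncate_of_lt {b t : ℝ} (h : t < b) : truncate v b t = v t := if_pos h

theorem LInfLoc.truncate (hv : LInfLoc univ v) (b : ℝ) : LInfLoc univ (truncate v b) :=
  hv.glue (.const 0) b

theorem LInfLoc.of_truncate (h : ∀ b, LInfLoc univ (_root_.truncate v b)) : LInfLoc univ v where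
  aemeasurable := by
    have hun : Ici (0 : ℝ) = ⋃ N : ℕ, Ico (0 : ℝ) N := by
      ext t
      simp only [mem_Ici, mem_iUnion, mem_Ico, exists_and_left]
      exact ⟨fun ht => ⟨ht, exists_nat_gt t⟩, fun ht => ht.1⟩
    rw [hun, aemeasurable_iUnion_iff]
    intro N
    refine ((h N).aemeasurable.mono_measure
      (Measure.restrict_mono_set _ Ico_subset_Ici_self)).congr ?_
    refine (ae_restrict_iff' measurableSet_Ico).2 ?_
    exact Eventually.of_forall fun t ht => truncate_of_lt ht.2
  mem _ _ := mem_univ _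
  bounded T hT := by
    obtain ⟨C, hC⟩ := (h (T + 1)).bounded T hT
    refine ⟨C, fun t ht => ?_⟩
    have := hC t ht
    rwa [truncate_of_lt (by linarith [ht.2])] at this

theorem ClassK.nonneg {ρ : ℝ → ℝ} (h : ClassK ρ) {s : ℝ} (hs : 0 ≤ s) : 0 ≤ ρ s := by
  rw [← h.map_zero]
  exact h.strictMonoOn.monotoneOn (mem_Ici.2 le_rfl) hs hs

theorem ClassK.mono {ρ : ℝ → ℝ} (h : ClassK ρ) {s t : ℝ} (hs : 0 ≤ s) (hst : s ≤ t) : ρ s ≤ ρ t :=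
  h.strictMonoOn.monotoneOn hs (hs.trans hst) hst

theorem LInfLoc.bddAbove_classK {ρ : ℝ → ℝ} (h : ClassK ρ) (hv : LInfLoc S v) {T : ℝ}
    (hT : 0 ≤ T) : BddAbove (range fun s : Icc (0 : ℝ) T => ρ ‖v s‖) := by
  obtain ⟨C, hC⟩ := hv.bounded T hT
  refine ⟨ρ C, ?_⟩
  rintro _ ⟨s, rfl⟩
  exact h.mono (norm_nonneg _) (hC s s.2)

theorem LInfLoc.bddAbove_norm (hv : LInfLoc S v) {T : ℝ}
    (hT : 0 ≤ T) : BddAbove (range fun s : Icc (0 : ℝ) T => ‖v s‖) := by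
  obtain ⟨C, hC⟩ := hv.bounded T hT
  refine ⟨C, ?_⟩
  rintro _ ⟨s, rfl⟩
  exact hC s s.2

end LInf

/-! ### The plant and the observer as input-driven systems -/

/-- A stabilizable plant together with a robust exponential observer and an output predictor. -/
structure ObserverLoop (r : ℝ≥0) {n m q k l : ℕ} (D : Set (Vec q))
    (f : Hist r n → Vec m → Vec q → Vec n) (h : Hist r n → Vec k)
    (R : Hist r n → Vec m → Vec q → Vec k)
    (F : Hist r l → Vec k → Vec m → Vec l) (Ψ : Hist r l → Hist r n)
    (kf : Hist r n → Vec m) (σ γ : ℝ) (g a : ℝ → ℝ) : Prop where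
  zero_mem : (0 : Vec q) ∈ D
  regular : RegularSystem r univ D f h
  complete : ForwardComplete r univ D f
  output : OutputDerivative r univ D f h R
  stabilizable : Stabilizable r univ D f kf
  observer : IsREOWith r univ D f h F Ψ σ γ g a
  predictor : PredictorLipschitz r univ R Ψ

namespace ObserverLoop

variable {r : ℝ≥0} {n m q k l : ℕ} {D : Set (Vec q)}
  {f : Hist r n → Vec m → Vec q → Vec n} {h : Hist r n → Vec k}
  {R : Hist r n → Vec m → Vec q → Vec k}
  {F : Hist r l → Vec k → Vec m → Vec l} {Ψ : Hist r l → Hist r n}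
  {kf : Hist r n → Vec m} {σ γ : ℝ} {g a : ℝ → ℝ}

theorem zero_input (S : ObserverLoop r D f h R F Ψ kf σ γ g a) :
    LInfLoc D fun _ : ℝ => (0 : Vec q) where
  aemeasurable := aemeasurable_const
  mem _ _ := S.zero_mem
  bounded _ _ := ⟨0, fun _ _ => by simp⟩

theorem plant_eqOn (S : ObserverLoop r D f h R F Ψ kf σ γ g a) {u : ℝ → Vec m} {d : ℝ → Vec q}
    (hu : LInfLoc univ u) (hd : LInfLoc D d) {x₀ : Hist r n} {b : ℝ} {x x' : ℝ → Vec n}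
    (hx : IsDelaySol r (fun t φ => f φ (u t) (d t)) x₀ (Ico 0 b) x)
    (hx' : IsDelaySol r (fun t φ => f φ (u t) (d t)) x₀ (Ico 0 b) x') :
    EqOn x x' (Ico 0 b) := by
  refine hx.eqOn hx' fun c _ B => ?_
  rcases lt_or_ge c 0 with hc | hc
  · exact ⟨0, le_rfl, fun t ht => absurd (ht.1.trans ht.2) (not_le.2 hc)⟩
  obtain ⟨C, hC⟩ := hu.bounded c hc
  obtain ⟨C', hC'⟩ := hd.bounded c hc
  obtain ⟨L, hL, H⟩ := S.regular.oneSided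
    ((Metric.closedBall 0 B ×ˢ (Metric.closedBall 0 C ×ˢ Metric.closedBall 0 C')) ∩
      univ ×ˢ (univ ×ˢ D))
    ((Metric.isBounded_closedBall.prod
      (Metric.isBounded_closedBall.prod Metric.isBounded_closedBall)).subset inter_subset_left)
    inter_subset_right
  refine ⟨L, hL, fun t ht φ φ' hφ hφ' => H φ φ' _ _ ?_ ?_⟩
  · simpa using ⟨⟨hφ, hC t ht, hC' t ht⟩, hd.mem t ht.1⟩
  · simpa using ⟨⟨hφ', hC t ht, hC' t ht⟩, hd.mem t ht.1⟩

theorem observer_eqOn (S : ObserverLoop r D f h R F Ψ kf σ γ g a) {u : ℝ → Vec m}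
    {w : ℝ → Vec k} (hu : LInfLoc univ u) (hw : LInfLoc univ w) {z₀ : Hist r l} {b : ℝ}
    {z z' : ℝ → Vec l}
    (hz : IsDelaySol r (fun t φ => F φ (w t) (u t)) z₀ (Ico 0 b) z)
    (hz' : IsDelaySol r (fun t φ => F φ (w t) (u t)) z₀ (Ico 0 b) z') :
    EqOn z z' (Ico 0 b) := by
  refine hz.eqOn hz' fun c _ B => ?_
  rcases lt_or_ge c 0 with hc | hc
  · exact ⟨0, le_rfl, fun t ht => absurd (ht.1.trans ht.2) (not_le.2 hc)⟩
  obtain ⟨C, hC⟩ := hu.bounded c hc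
  obtain ⟨C', hC'⟩ := hw.bounded c hc
  obtain ⟨L, hL, H⟩ := S.observer.oneSided
    (Metric.closedBall 0 B ×ˢ (Metric.closedBall 0 C' ×ˢ Metric.closedBall 0 C))
    (Metric.isBounded_closedBall.prod
      (Metric.isBounded_closedBall.prod Metric.isBounded_closedBall))
    (by simp)
  refine ⟨L, hL, fun t ht φ φ' hφ hφ' => H φ φ' _ _ ?_ ?_⟩
  · simpa using ⟨hφ, hC' t ht, hC t ht⟩
  · simpa using ⟨hφ', hC' t ht, hC t ht⟩

/-- Causality of the plant. -/
theorem plant_causal (S : ObserverLoop r D f h R F Ψ kf σ γ g a) {u u' : ℝ → Vec m}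
    {d : ℝ → Vec q} (hu : LInfLoc univ u) (hd : LInfLoc D d) {x₀ : Hist r n} {b : ℝ}
    (heq : EqOn u u' (Ico 0 b)) {x x' : ℝ → Vec n}
    (hx : IsDelaySol r (fun t φ => f φ (u t) (d t)) x₀ (Ico 0 b) x)
    (hx' : IsDelaySol r (fun t φ => f φ (u' t) (d t)) x₀ (Ico 0 b) x') :
    EqOn x x' (Ico 0 b) :=
  S.plant_eqOn hu hd hx (hx'.congr_rhs fun t ht => by rw [heq ht])

/-- Causality of the observer. -/
theorem observer_causal (S : ObserverLoop r D f h R F Ψ kf σ γ g a) {u u' : ℝ → Vec m}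
    {w w' : ℝ → Vec k} (hu : LInfLoc univ u) (hw : LInfLoc univ w) {z₀ : Hist r l} {b : ℝ}
    (heq : EqOn u u' (Ico 0 b)) (heqw : EqOn w w' (Ico 0 b)) {z z' : ℝ → Vec l}
    (hz : IsDelaySol r (fun t φ => F φ (w t) (u t)) z₀ (Ico 0 b) z)
    (hz' : IsDelaySol r (fun t φ => F φ (w' t) (u' t)) z₀ (Ico 0 b) z') :
    EqOn z z' (Ico 0 b) :=
  S.observer_eqOn hu hw hz (hz'.congr_rhs fun t ht => by rw [heq ht, heqw ht])

/-- Solutions that agree on `[0, b)` have the same histories on `[0, b)`. -/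
theorem hist_eq_of_eqOn {p : ℕ} {G G' : ℝ → Hist r p → Vec p} {x₀ : Hist r p} {J J' : Set ℝ}
    {x x' : ℝ → Vec p} (hx : IsDelaySol r G x₀ J x) (hx' : IsDelaySol r G' x₀ J' x') {b t : ℝ}
    (h : EqOn x x' (Ico 0 b)) (ht : t ∈ Ico 0 b) : hist r x t = hist r x' t :=
  hist_congr_Icc fun s hs => by
    rcases le_total s 0 with h0 | h0
    · exact hx.eqOn_history hx' ⟨by linarith [hs.1, ht.1], h0⟩
    · exact h ⟨h0, hs.2.trans_lt ht.2⟩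

/-- Global solutions that agree on `[0, b)` have the same histories on `[0, b]`. -/
theorem hist_eq_of_eqOn_Icc {p : ℕ} {G G' : ℝ → Hist r p → Vec p} {x₀ : Hist r p}
    {x x' : ℝ → Vec p} (hx : IsDelaySol r G x₀ (Ici 0) x) (hx' : IsDelaySol r G' x₀ (Ici 0) x')
    {b t : ℝ} (h : EqOn x x' (Ico 0 b)) (ht : t ∈ Icc 0 b) : hist r x t = hist r x' t := by
  rcases ht.1.eq_or_lt with h0 | h0
  · rw [← h0, hx.hist_zero, hx'.hist_zero]
  have hb : 0 < b := h0.trans_le ht.2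
  -- Continuity adds the endpoint `b`, which is needed when `b` is a sampling time.
  have hcl : EqOn x x' (Icc 0 b) := by
    have hsub : Icc 0 b ⊆ Ici (-(r : ℝ)) := fun s hs =>
      (neg_nonpos.2 r.2).trans hs.1
    refine h.of_subset_closure (hx.continuousOn_Ici.mono hsub)
      (hx'.continuousOn_Ici.mono hsub) Ico_subset_Icc_self ?_
    rw [closure_Ico hb.ne]
  refine hist_congr_Icc fun s hs => ?_
  rcases le_total s 0 with h1 | h1
  · exact hx.eqOn_history hx' ⟨by linarith [hs.1], h1⟩
  · exact hcl ⟨h1, hs.2.trans ht.2⟩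

theorem exists_plant (S : ObserverLoop r D f h R F Ψ kf σ γ g a) {u : ℝ → Vec m} {d : ℝ → Vec q}
    (hu : LInfLoc univ u) (hd : LInfLoc D d) (x₀ : Hist r n) :
    ∃ x, IsPlantSol r f u d x₀ x :=
  S.complete x₀ u d hu hd

theorem linfLoc_output (S : ObserverLoop r D f h R F Ψ kf σ γ g a) {u : ℝ → Vec m}
    {d : ℝ → Vec q} {x₀ : Hist r n} {x : ℝ → Vec n} (hx : IsPlantSol r f u d x₀ x) :
    LInfLoc univ fun t => h (hist r x t) :=
  .of_continuousOn (S.regular.continuous_h.comp_continuousOn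
    (IsDelaySol.continuousOn_hist hx))

/-- The observer has a global solution for every locally bounded signal in place of the output. -/
theorem exists_observer (S : ObserverLoop r D f h R F Ψ kf σ γ g a) {u : ℝ → Vec m}
    {w : ℝ → Vec k} (hu : LInfLoc univ u) (hw : LInfLoc univ w) (z₀ : Hist r l) :
    ∃ z, IsDelaySol r (fun t φ => F φ (w t) (u t)) z₀ (Ici 0) z := by
  obtain ⟨x, hx⟩ := S.exists_plant hu S.zero_input 0
  -- With the noise `w - h(x_t)`, for a plant trajectory `x` from zero, the measured output is
  -- exactly `w`; uniqueness identifies `x'` with `x`.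
  obtain ⟨x', z, hx', hz⟩ := S.observer.exists_sol 0 z₀ u _ _ hu S.zero_input
    (hw.sub (S.linfLoc_output hx))
  refine ⟨z, hz.congr_rhs fun t ht => ?_⟩
  have : hist r x t = hist r x' t := by
    refine hist_eq_of_eqOn (b := t + 1) hx hx' ?_ ⟨ht, by linarith⟩
    exact S.plant_eqOn hu S.zero_input (hx.mono Ico_subset_Ici_self) (hx'.mono Ico_subset_Ici_self)
  rw [this, add_sub_cancel]

/-- The observer error estimate for an arbitrary signal `w` in place of the output. -/
theorem error_le (S : ObserverLoop r D f h R F Ψ kf σ γ g a) {u : ℝ → Vec m}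
    {w : ℝ → Vec k} {d : ℝ → Vec q} (hu : LInfLoc univ u) (hw : LInfLoc univ w)
    (hd : LInfLoc D d) {x₀ : Hist r n} {z₀ : Hist r l} {x : ℝ → Vec n} {z : ℝ → Vec l}
    (hx : IsPlantSol r f u d x₀ x)
    (hz : IsDelaySol r (fun t φ => F φ (w t) (u t)) z₀ (Ici 0) z) {t N N' : ℝ} (ht : 0 ≤ t)
    (hN : ∀ s ∈ Icc 0 t, ‖w s - h (hist r x s)‖ * Real.exp (-σ * (t - s)) ≤ N)
    (hN' : ∀ s ∈ Icc 0 t, g ‖d s‖ ≤ N') :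
    ‖Ψ (hist r z t) - hist r x t‖ ≤
      Real.exp (-σ * t) * a (‖x₀‖ + ‖z₀‖) + γ * N + N' := by
  have hne : Nonempty (Icc (0 : ℝ) t) := ⟨⟨0, le_rfl, ht⟩⟩
  -- Again `w` is read as the true output plus the noise `w - h(x_t)`.
  refine (S.observer.estimate x₀ z₀ u d _ x z hu hd (hw.sub (S.linfLoc_output hx)) hx
    (hz.congr_rhs fun s _ => by rw [add_sub_cancel]) t ht).trans ?_
  have := S.observer.γ_pos
  gcongr
  · exact ciSup_le fun s => hN s s.2
  · exact ciSup_le fun s => hN' s s.2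

end ObserverLoop

/-! ### Existence of the inter-sample predictor by compactness. -/

/-- Arzelà–Ascoli, with equicontinuity from a common Lipschitz constant. The limit is extended by
its endpoint values, so that it is continuous on the line and can be glued to other signals. -/
theorem exists_subseq_uniform_limit {k : ℕ} {v : ℕ → ℝ → Vec k} {t₀ t₁ B C : ℝ} (h01 : t₀ ≤ t₁)
    (hB : ∀ j, ∀ t ∈ Icc t₀ t₁, ‖v j t‖ ≤ B)
    (hC : ∀ j, ∀ s ∈ Icc t₀ t₁, ∀ t ∈ Icc t₀ t₁, ‖v j t - v j s‖ ≤ C * |t - s|) :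
    ∃ (v' : ℝ → Vec k) (φ : ℕ → ℕ), Continuous v' ∧ StrictMono φ ∧
      ∀ η > 0, ∀ᶠ j in atTop, ∀ t ∈ Icc t₀ t₁, ‖v (φ j) t - v' t‖ ≤ η := by
  have hlip : ∀ j, LipschitzWith (Real.toNNReal C) fun t : Icc t₀ t₁ => v j t := by
    intro j
    refine LipschitzWith.of_dist_le_mul fun s t => ?_
    rw [dist_eq_norm, Subtype.dist_eq, Real.dist_eq]
    refine (hC j t t.2 s s.2).trans ?_
    gcongr
    exact Real.le_coe_toNNReal C
  let W : ℕ → BoundedContinuousFunction (Icc t₀ t₁) (Vec k) := fun j =>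
    BoundedContinuousFunction.mkOfCompact ⟨fun t => v j t, (hlip j).continuous⟩
  have hcomp : IsCompact (closure (range W)) := by
    refine BoundedContinuousFunction.arzela_ascoli (Metric.closedBall 0 B)
      (isCompact_closedBall 0 B) (range W) ?_ ?_
    · rintro _ t ⟨j, rfl⟩
      exact mem_closedBall_zero_iff.2 (hB j t t.2)
    · refine UniformEquicontinuous.equicontinuous
        (LipschitzWith.uniformEquicontinuous _ (Real.toNNReal C) ?_)
      rintro ⟨_, j, rfl⟩
      exact hlip j
  obtain ⟨g, -, φ, hφ, hlim⟩ := hcomp.tendsto_subseq (x := W) fun j => subset_closure ⟨j, rfl⟩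
  refine ⟨IccExtend h01 g, φ, (map_continuous g).Icc_extend', hφ, fun η hη => ?_⟩
  filter_upwards [(Metric.tendsto_nhds.1 hlim) η hη] with j hj t ht
  rw [IccExtend_of_mem h01 _ ht, ← dist_eq_norm]
  exact (BoundedContinuousFunction.dist_coe_le_dist (f := W (φ j)) (g := g) ⟨t, ht⟩).trans hj.le

namespace ObserverLoop

variable {r : ℝ≥0} {n m q k l : ℕ} {D : Set (Vec q)}
  {f : Hist r n → Vec m → Vec q → Vec n} {h : Hist r n → Vec k}
  {R : Hist r n → Vec m → Vec q → Vec k}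
  {F : Hist r l → Vec k → Vec m → Vec l} {Ψ : Hist r l → Hist r n}
  {kf : Hist r n → Vec m} {σ γ : ℝ} {g a : ℝ → ℝ}

theorem continuous_R_zero (S : ObserverLoop r D f h R F Ψ kf σ γ g a) (u₀ : Vec m) :
    Continuous fun φ : Hist r n => R φ u₀ 0 :=
  S.output.continuousOn_R.comp_continuous (f := fun φ : Hist r n => (φ, u₀, (0 : Vec q)))
    (by fun_prop) fun φ => ⟨mem_univ _, mem_univ _, S.zero_mem⟩

theorem continuousOn_predictor (S : ObserverLoop r D f h R F Ψ kf σ γ g a) (u₀ : Vec m)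
    {z : ℝ → Vec l} {J : Set ℝ} (hz : ContinuousOn (hist r z) J) :
    ContinuousOn (fun s => R (Ψ (hist r z s)) u₀ 0) J :=
  ((S.continuous_R_zero u₀).comp S.observer.continuous_Ψ).comp_continuousOn hz

/-- A priori bound: over short horizons, a signal `v` that grows no faster than the predictor
driven by it remains bounded, by a bound independent of `v`. -/
theorem exists_predictor_bound (S : ObserverLoop r D f h R F Ψ kf σ γ g a) {L : ℝ} (hL : 0 ≤ L)
    (hR : ∀ x x' u, ‖R x' u 0 - R x u 0‖ ≤ L * ‖x' - x‖) {u : ℝ → Vec m} {w : ℝ → Vec k}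
    (hu : LInfLoc univ u) (hw : LInfLoc univ w) (z₀ : Hist r l) {t₀ t₁ : ℝ} (h0 : 0 ≤ t₀)
    (h01 : t₀ ≤ t₁) (hδ : (t₁ - t₀) * (L * γ) ≤ 1 / 2) (u₀ : Vec m) (w₀ : Vec k) :
    ∃ B, 0 ≤ B ∧ ∀ (v : ℝ → Vec k) (z : ℝ → Vec l) (c : ℝ), LInfLoc univ v →
      IsDelaySol r (fun t φ => F φ (v t) (u t)) z₀ (Ici 0) z → c ∈ Icc t₀ t₁ →
      EqOn v w (Ico 0 t₀) →
      (∀ t ∈ Icc t₀ c, ∀ C, 0 ≤ C → (∀ s ∈ Icc t₀ t, ‖R (Ψ (hist r z s)) u₀ 0‖ ≤ C) →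
        ‖v t‖ ≤ ‖w₀‖ + (t₁ - t₀) * C) →
      ∀ t ∈ Icc t₀ c, ‖v t‖ ≤ B ∧ ‖R (Ψ (hist r z t)) u₀ 0‖ ≤ B := by
  -- A reference trajectory that does not depend on `v`. The observer estimate ties `Ψ(z_t)` to it,
  -- which bounds the predictor velocity affinely in the supremum of `‖v‖`.
  obtain ⟨x, hx⟩ := S.exists_plant hu S.zero_input 0
  obtain ⟨Bw, hBw⟩ := hw.bounded t₀ h0
  obtain ⟨Bh, hBh⟩ := (S.linfLoc_output hx).bounded t₁ (h0.trans h01)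
  obtain ⟨BR, hBR⟩ := isCompact_Icc.exists_bound_of_continuousOn
    ((S.continuous_R_zero u₀).comp_continuousOn
      ((IsDelaySol.continuousOn_hist hx).mono (Icc_subset_Ici_self : Icc 0 t₁ ⊆ Ici 0)))
  have hγ := S.observer.γ_pos
  have hσ := S.observer.σ_pos
  have hBw0 : 0 ≤ Bw := (norm_nonneg _).trans (hBw 0 ⟨le_rfl, h0⟩)
  have hBh0 : 0 ≤ Bh := (norm_nonneg _).trans (hBh 0 ⟨le_rfl, h0.trans h01⟩)
  have hBR0 : 0 ≤ BR := (norm_nonneg _).trans (hBR 0 ⟨le_rfl, h0.trans h01⟩)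
  set a₀ := a (‖(0 : Hist r n)‖ + ‖z₀‖) with ha₀def
  have ha₀ : 0 ≤ a₀ := S.observer.classKInf_a.toClassK.nonneg (by positivity)
  have hlen : 0 ≤ t₁ - t₀ := by linarith
  set K := ‖w₀‖ + (t₁ - t₀) * (BR + L * (a₀ + γ * (Bw + Bh))) with hK
  have hK0 : 0 ≤ K := by positivity
  refine ⟨2 * K + (BR + L * (a₀ + γ * (Bw + 2 * K + Bh))), by positivity, ?_⟩
  intro v z c hv hz hc hvw hgrow
  have hvb : BddAbove ((fun t => ‖v t‖) '' Icc t₀ c) := by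
    obtain ⟨C, hC⟩ := hv.bounded c (h0.trans hc.1)
    refine ⟨C, ?_⟩
    rintro _ ⟨t, ht, rfl⟩
    exact hC t ⟨h0.trans ht.1, ht.2⟩
  set V := sSup ((fun t => ‖v t‖) '' Icc t₀ c) with hV
  have hVle : ∀ t ∈ Icc t₀ c, ‖v t‖ ≤ V := fun t ht => le_csSup hvb ⟨t, ht, rfl⟩
  have hV0 : 0 ≤ V := (norm_nonneg _).trans (hVle t₀ ⟨le_rfl, hc.1⟩)
  have hpred : ∀ t ∈ Icc t₀ c,
      ‖R (Ψ (hist r z t)) u₀ 0‖ ≤ BR + L * (a₀ + γ * (Bw + V + Bh)) := by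
    intro t ht
    have ht0 : 0 ≤ t := h0.trans ht.1
    have herr := S.error_le hu hv S.zero_input hx hz (N := Bw + V + Bh) (N' := 0) ht0
      (fun s hs => by
        have h1 : ‖v s‖ ≤ Bw + V := by
          rcases lt_or_ge s t₀ with h2 | h2
          · rw [hvw ⟨hs.1, h2⟩]
            linarith [hBw s ⟨hs.1, h2.le⟩]
          · linarith [hVle s ⟨h2, hs.2.trans ht.2⟩]
        have h3 : ‖v s - h (hist r x s)‖ ≤ Bw + V + Bh :=
          (norm_sub_le _ _).trans (add_le_add h1 (hBh s ⟨hs.1, hs.2.trans (ht.2.trans hc.2)⟩))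
        have h4 : Real.exp (-σ * (t - s)) ≤ 1 := by
          rw [Real.exp_le_one_iff]
          nlinarith [hs.2]
        calc _ ≤ (Bw + V + Bh) * 1 := by gcongr
          _ = _ := mul_one _)
      (fun s _ => by rw [norm_zero, S.observer.classK_g.map_zero])
    have h5 : Real.exp (-σ * t) ≤ 1 := by
      rw [Real.exp_le_one_iff]
      nlinarith
    have h6 : ‖Ψ (hist r z t) - hist r x t‖ ≤ a₀ + γ * (Bw + V + Bh) := by
      have : Real.exp (-σ * t) * a₀ ≤ a₀ := mul_le_of_le_one_left ha₀ h5
      linarith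
    have h7 := hBR t ⟨ht0, ht.2.trans hc.2⟩
    have h8 := (hR (hist r x t) (Ψ (hist r z t)) u₀).trans (mul_le_mul_of_nonneg_left h6 hL)
    have h9 := norm_le_norm_add_norm_sub' (R (Ψ (hist r z t)) u₀ 0) (R (hist r x t) u₀ 0)
    simp only [Function.comp_apply] at h7
    linarith
  -- `V` enters the bound on itself with the factor `(t₁ - t₀) L γ ≤ 1/2`; it is finite because `v`
  -- is locally bounded.
  have hVK : V ≤ K + V / 2 := by
    refine csSup_le ⟨_, t₀, ⟨le_rfl, hc.1⟩, rfl⟩ ?_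
    rintro _ ⟨t, ht, rfl⟩
    have h1 := hgrow t ht (BR + L * (a₀ + γ * (Bw + V + Bh))) (by positivity)
      fun s hs => hpred s ⟨hs.1, hs.2.trans ht.2⟩
    have h2 : (t₁ - t₀) * (L * γ) * V ≤ 1 / 2 * V := by gcongr
    simp only
    rw [hK]
    linarith
  have hV2 : V ≤ 2 * K := by linarith
  intro t ht
  have h1 := hVle t ht
  have h2 : BR + L * (a₀ + γ * (Bw + V + Bh)) ≤ BR + L * (a₀ + γ * (Bw + 2 * K + Bh)) := by
    gcongr
  have h3 : 0 ≤ BR + L * (a₀ + γ * (Bw + 2 * K + Bh)) := by positivity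
  exact ⟨by linarith, by linarith [hpred t ht]⟩

/-- The predictor with a lag `ε`, coupled to the observer, has a solution. -/
theorem exists_delayed_predictor (S : ObserverLoop r D f h R F Ψ kf σ γ g a) {u : ℝ → Vec m}
    {w : ℝ → Vec k} (hu : LInfLoc univ u) (hw : LInfLoc univ w) (z₀ : Hist r l) {t₀ t₁ ε : ℝ}
    (h0 : 0 ≤ t₀) (hε : 0 < ε) (u₀ : Vec m) (w₀ : Vec k) :
    ∃ (v : ℝ → Vec k) (z : ℝ → Vec l), LInfLoc univ v ∧
      IsDelaySol r (fun t φ => F φ (v t) (u t)) z₀ (Ici 0) z ∧ EqOn v w (Ico 0 t₀) ∧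
      ∀ t, t₀ ≤ t → v t = w₀ + ∫ s in t₀..max t₀ (min t t₁ - ε), R (Ψ (hist r z s)) u₀ 0 := by
  -- Method of steps: the value of `v` at `t` uses `z` only up to `t - ε`, so stage `j` satisfies
  -- the lagged equation up to `t₀ + jε`. Taking `min t t₁` freezes `v` after `t₁`.
  have key : ∀ j : ℕ, ∃ (v : ℝ → Vec k) (z : ℝ → Vec l), LInfLoc univ v ∧
      IsDelaySol r (fun t φ => F φ (v t) (u t)) z₀ (Ici 0) z ∧ EqOn v w (Ico 0 t₀) ∧
      ∀ t, t₀ ≤ t → min t t₁ ≤ t₀ + j * ε →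
        v t = w₀ + ∫ s in t₀..max t₀ (min t t₁ - ε), R (Ψ (hist r z s)) u₀ 0 := by
    intro j
    induction j with
    | zero =>
      have hv : LInfLoc univ fun t => if t < t₀ then w t else w₀ := hw.glue (.const w₀) t₀
      obtain ⟨z, hz⟩ := S.exists_observer hu hv z₀
      refine ⟨_, z, hv, hz, fun t ht => if_pos ht.2, fun t ht hle => ?_⟩
      rw [if_neg (not_lt.2 ht), max_eq_left (by push_cast at hle; linarith),
        intervalIntegral.integral_same, add_zero]
    | succ j ih =>
      obtain ⟨v, z, hv, hz, hvw, hvz⟩ := ih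
      have hρ := S.continuousOn_predictor u₀ hz.continuousOn_hist
      -- Evaluating at `max 0 s` makes the integrand continuous on the line and leaves the integral
      -- unchanged, since `s ≥ t₀ ≥ 0`.
      have hint : Continuous fun t : ℝ =>
          w₀ + ∫ s in t₀..max t₀ (min t t₁ - ε), R (Ψ (hist r z (max 0 s))) u₀ 0 := by
        have hc : Continuous fun s : ℝ => R (Ψ (hist r z (max 0 s))) u₀ 0 :=
          hρ.comp_continuous (by fun_prop) fun s => mem_Ici.2 (le_max_left _ _)
        exact continuous_const.add
          ((intervalIntegral.continuous_primitive (fun a b => hc.intervalIntegrable a b) t₀).comp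
            (by fun_prop : Continuous fun t : ℝ => max t₀ (min t t₁ - ε)))
      have hmax : ∀ t : ℝ, (∫ s in t₀..max t₀ (min t t₁ - ε), R (Ψ (hist r z (max 0 s))) u₀ 0)
          = ∫ s in t₀..max t₀ (min t t₁ - ε), R (Ψ (hist r z s)) u₀ 0 := by
        intro t
        refine intervalIntegral.integral_congr fun s hs => ?_
        rw [uIcc_of_le (le_max_left _ _)] at hs
        simp only [max_eq_right (h0.trans hs.1)]
      have hv' := hw.glue (.of_continuousOn hint.continuousOn) t₀
      obtain ⟨z', hz'⟩ := S.exists_observer hu hv' z₀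
      have heq : EqOn v (fun t => if t < t₀ then w t else
          w₀ + ∫ s in t₀..max t₀ (min t t₁ - ε), R (Ψ (hist r z (max 0 s))) u₀ 0)
          (Ico 0 (t₀ + j * ε)) := by
        intro t ht
        rcases lt_or_ge t t₀ with h1 | h1
        · simp only [if_pos h1]
          exact hvw ⟨ht.1, h1⟩
        · simp only [if_neg (not_lt.2 h1)]
          rw [hmax, hvz t h1 ((min_le_left _ _).trans ht.2.le)]
      -- By causality the new observer trajectory agrees with the old one as far as the next lagged
      -- integral reaches.
      have hzz := S.observer_causal hu hv (fun _ _ => rfl) heq (hz.mono Ico_subset_Ici_self)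
        (hz'.mono Ico_subset_Ici_self)
      refine ⟨_, z', hv', hz', fun t ht => if_pos ht.2, fun t ht hle => ?_⟩
      rw [if_neg (not_lt.2 ht), hmax]
      congr 1
      refine intervalIntegral.integral_congr fun s hs => ?_
      rw [uIcc_of_le (le_max_left _ _)] at hs
      have hsb : s ≤ t₀ + j * ε := by
        refine hs.2.trans (max_le ?_ ?_)
        · have : (0 : ℝ) ≤ j * ε := by positivity
          linarith
        · push_cast at hle
          linarith
      simp only [hist_eq_of_eqOn_Icc hz hz' hzz ⟨h0.trans hs.1, hsb⟩]
  obtain ⟨j, hj⟩ := exists_nat_ge ((t₁ - t₀) / ε)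
  obtain ⟨v, z, hv, hz, hvw, hvz⟩ := key j
  refine ⟨v, z, hv, hz, hvw, fun t ht => hvz t ht ((min_le_right _ _).trans ?_)⟩
  rw [div_le_iff₀ hε] at hj
  linarith

/-- Continuous dependence of the observer on its driving signal. -/
theorem observer_continuous_dependence (S : ObserverLoop r D f h R F Ψ kf σ γ g a)
    {u : ℝ → Vec m} {v : ℝ → Vec k} (hu : LInfLoc univ u) (hv : LInfLoc univ v) {z₀ : Hist r l}
    {z : ℝ → Vec l} (hz : IsDelaySol r (fun t φ => F φ (v t) (u t)) z₀ (Ici 0) z) {T η : ℝ}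
    (hT : 0 ≤ T) (hη : 0 < η) :
    ∃ θ > 0, ∀ (v' : ℝ → Vec k) (z' : ℝ → Vec l),
      IsDelaySol r (fun t φ => F φ (v' t) (u t)) z₀ (Ici 0) z' →
      (∀ t ∈ Icc 0 T, ‖v' t - v t‖ ≤ θ) →
      ∀ t ∈ Icc 0 T, ‖hist r z' t - hist r z t‖ ≤ η := by
  -- Deviations below `1` keep `z'` in the ball of radius `B + 1` on which the one-sided constant is
  -- chosen.
  wlog hη1 : η ≤ 1 generalizing η
  · obtain ⟨θ, hθ, H⟩ := this (η := min η 1) (lt_min hη one_pos) (min_le_right _ _)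
    exact ⟨θ, hθ, fun v' z' hz' hv' t ht => (H v' z' hz' hv' t ht).trans (min_le_left _ _)⟩
  have hr : (0 : ℝ) ≤ r := r.2
  have hzc : ContinuousOn z (Icc (-(r : ℝ)) T) := hz.continuousOn_Ici.mono Icc_subset_Ici_self
  obtain ⟨B, hB⟩ := isCompact_Icc.exists_bound_of_continuousOn hzc
  obtain ⟨Bv, hBv⟩ := hv.bounded T hT
  obtain ⟨Bu, hBu⟩ := hu.bounded T hT
  have hB0 : 0 ≤ B := (norm_nonneg _).trans (hB 0 ⟨by linarith, hT⟩)
  obtain ⟨L, hL, hLip⟩ := S.observer.oneSided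
    (Metric.closedBall 0 (B + 1) ×ˢ (Metric.closedBall 0 (Bv + 1) ×ˢ Metric.closedBall 0 Bu))
    (Metric.isBounded_closedBall.prod
      (Metric.isBounded_closedBall.prod Metric.isBounded_closedBall))
    (by simp)
  set A := L + 1 with hA
  set K := 4 * (T + 1) * Real.exp (4 * A * T) with hK
  have hA0 : 0 < A := by positivity
  have hK1 : 1 ≤ K := by
    have : 1 ≤ Real.exp (4 * A * T) := Real.one_le_exp (by positivity)
    nlinarith
  -- `K` dominates the Gronwall factor, so a forcing of size `β` produces a squared deviation of at
  -- most `η² / 4`.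
  set β := η / (2 * K) with hβ
  have hβ0 : 0 < β := by positivity
  have hβK : K * β ^ 2 ≤ η ^ 2 / 4 := by
    have : K * β ^ 2 = η ^ 2 / 4 / K := by
      rw [hβ]
      field_simp
      ring
    rw [this]
    exact div_le_self (by positivity) hK1
  -- Bounded sets of histories need not be relatively compact, but the histories of the fixed
  -- trajectory `z` on `[0, T]` form a compact set, and uniform continuity of `F` is needed only
  -- along it.
  have hcompact : IsCompact ((hist r z '' Icc 0 T) ×ˢ
      ((Metric.closedBall (0 : Vec k) (Bv + 1)) ×ˢ (Metric.closedBall (0 : Vec m) Bu))) :=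
    (isCompact_Icc.image_of_continuousOn (hz.continuousOn_hist.mono Icc_subset_Ici_self)).prod
      ((isCompact_closedBall _ _).prod (isCompact_closedBall _ _))
  have huc := hcompact.uniformContinuousOn_of_continuous
    (S.observer.continuousOn_F.mono (fun p _ => ⟨mem_univ _, mem_univ _, mem_univ _⟩))
  obtain ⟨δ, hδ, hF⟩ := Metric.uniformContinuousOn_iff.1 huc β hβ0
  refine ⟨min (δ / 2) 1, by positivity, fun v' z' hz' hv' => ?_⟩
  have hzc' : ContinuousOn z' (Icc (-(r : ℝ)) T) := hz'.continuousOn_Ici.mono Icc_subset_Ici_self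
  have h00 : (0 : ℝ) ∈ Ici (0 : ℝ) := mem_Ici.2 le_rfl
  have hAC : ∀ b ∈ Icc 0 T, AbsolutelyContinuousOnInterval (fun t => z' t - z t) 0 b :=
    fun b hb => (hz'.locallyAC 0 h00 b hb.1 hb.1).fun_sub (hz.locallyAC 0 h00 b hb.1 hb.1)
  have hsmall : ∀ t ∈ Icc 0 T, ‖z' t - z t‖ ≤ η := by
    by_contra! hcon
    obtain ⟨t₂, ht₂, hgt⟩ := hcon
    have hnc : ContinuousOn (fun t => ‖z' t - z t‖) (Icc 0 T) :=
      ((hzc'.sub hzc).norm).mono (Icc_subset_Icc_left (by linarith))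
    have hcl : IsCompact (Icc 0 T ∩ (fun t => ‖z' t - z t‖) ⁻¹' Ici η) :=
      isCompact_Icc.of_isClosed_subset (hnc.preimage_isClosed_of_isClosed isClosed_Icc isClosed_Ici)
        inter_subset_left
    -- The first time `b` at which the deviation reaches `η`. The local constants are valid before
    -- `b`, and Gronwall at `b` gives a contradiction.
    obtain ⟨b, ⟨hb, hbη⟩, hmin⟩ := hcl.exists_isLeast ⟨t₂, ht₂, hgt.le⟩
    have hbelow : ∀ s, -(r : ℝ) ≤ s → s < b → ‖z' s - z s‖ ≤ 1 := by
      intro s hs hsb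
      rcases le_total s 0 with h1 | h1
      · rw [hz'.eqOn_history hz ⟨hs, h1⟩, sub_self, norm_zero]
        exact zero_le_one
      · by_contra! h2
        exact absurd (hmin ⟨⟨h1, hsb.le.trans hb.2⟩, mem_preimage.2 (hη1.trans h2.le)⟩)
          (not_le.2 hsb)
    have hest := sq_norm_le_of_inner_le (a₀ := -(r : ℝ)) (A := A) (β := β) (ε := 0) hb.1 hA0
      (hAC b hb) (fun s hs => by rw [hz'.eqOn_history hz hs, sub_self, norm_zero]) (by linarith) (by
        filter_upwards [hz.deriv_eq, hz'.deriv_eq] with t ht ht' htm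
        have ht0 : (0 : ℝ) ≤ t := htm.1.le
        have htT : t ∈ Icc 0 T := ⟨ht0, htm.2.le.trans hb.2⟩
        refine ⟨_, (ht' ht0).sub (ht ht0), fun N hN => ?_⟩
        have hN0 : 0 ≤ N := (norm_nonneg _).trans (hN t ⟨by linarith, le_rfl⟩)
        have hw : ∀ s ∈ Icc (t - r) t, s ∈ Icc (-(r : ℝ)) T := fun s hs =>
          ⟨by linarith [hs.1], hs.2.trans htT.2⟩
        have hzt := hzc.mono hw
        have hzt' := hzc'.mono hw
        have hvt : ‖v' t‖ ≤ Bv + 1 := by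
          have h1 := norm_le_norm_add_norm_sub' (v' t) (v t)
          have h2 := (hv' t htT).trans (min_le_right _ _)
          linarith [hBv t htT]
        have h1 := hLip (hist r z' t) (hist r z t) (v' t) (u t)
          (by
            simp only [mem_prod, mem_closedBall_zero_iff]
            refine ⟨norm_hist_le (by positivity) fun s hs => ?_, hvt, hBu t htT⟩
            have h2 := norm_le_norm_add_norm_sub' (z' s) (z s)
            have h3 := hbelow s (hw s hs).1 (hs.2.trans_lt htm.2)
            linarith [hB s (hw s hs)])
          (by
            simp only [mem_prod, mem_closedBall_zero_iff]
            refine ⟨norm_hist_le (by positivity) fun s hs => ?_, hvt, hBu t htT⟩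
            linarith [hB s (hw s hs)])
        rw [hist_apply_origin hzt', hist_apply_origin hzt, ← hist_sub hzt' hzt] at h1
        have h2 : ‖hist r (fun s => z' s - z s) t‖ ≤ N :=
          norm_hist_le hN0 fun s hs => hN s ⟨(hw s hs).1, hs.2⟩
        have h3 : ‖hist r (fun s => z' s - z s) t‖ ^ 2 ≤ N ^ 2 := by gcongr
        have h4 := hF (hist r z t, v' t, u t)
          ⟨mem_image_of_mem _ htT, mem_closedBall_zero_iff.2 hvt,
            mem_closedBall_zero_iff.2 (hBu t htT)⟩
          (hist r z t, v t, u t)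
          ⟨mem_image_of_mem _ htT, mem_closedBall_zero_iff.2 (by linarith [hBv t htT]),
            mem_closedBall_zero_iff.2 (hBu t htT)⟩
          (by
            have h5 := (hv' t htT).trans (min_le_left _ _)
            simp only [Prod.dist_eq, dist_self, dist_eq_norm (v' t)]
            simp only [norm_nonneg, sup_of_le_left, sup_of_le_right]
            linarith)
        rw [dist_eq_norm] at h4
        have h6 : inner ℝ (z' t - z t) (F (hist r z t) (v' t) (u t) - F (hist r z t) (v t) (u t))
            ≤ N * β := by
          refine (real_inner_le_norm _ _).trans ?_
          exact mul_le_mul (hN t ⟨by linarith, le_rfl⟩) h4.le (norm_nonneg _) hN0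
        -- The change of state is taken at the common signal `v'`, for the one-sided condition; the
        -- change of signal is taken along `z`, for uniform continuity.
        have h7 : F (hist r z' t) (v' t) (u t) - F (hist r z t) (v t) (u t) =
            (F (hist r z' t) (v' t) (u t) - F (hist r z t) (v' t) (u t)) +
            (F (hist r z t) (v' t) (u t) - F (hist r z t) (v t) (u t)) := by abel
        rw [h7, inner_add_right]
        nlinarith [sq_nonneg (N - β), sq_nonneg N, sq_nonneg β]) b ⟨hb.1, le_rfl⟩
    have h8 : ‖z' b - z b‖ ^ 2 ≤ K * β ^ 2 := by
      refine hest.trans ?_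
      have h9 : Real.exp (4 * A * (b - 0)) ≤ Real.exp (4 * A * T) := by
        gcongr
        linarith [hb.2]
      calc _ = 4 * b * Real.exp (4 * A * (b - 0)) * β ^ 2 := by ring
        _ ≤ 4 * (T + 1) * Real.exp (4 * A * T) * β ^ 2 := by
          gcongr
          linarith [hb.2]
    have h10 : η ^ 2 ≤ ‖z' b - z b‖ ^ 2 := by
      have : η ≤ ‖z' b - z b‖ := hbη
      gcongr
    nlinarith
  intro t ht
  have hw : ∀ s ∈ Icc (t - r) t, s ∈ Icc (-(r : ℝ)) T := fun s hs =>
    ⟨by linarith [hs.1, ht.1], hs.2.trans ht.2⟩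
  rw [← hist_sub (hzc'.mono hw) (hzc.mono hw)]
  refine norm_hist_le hη.le fun s hs => ?_
  rcases le_total s 0 with h1 | h1
  · rw [hz'.eqOn_history hz ⟨(hw s hs).1, h1⟩, sub_self, norm_zero]
    exact hη.le
  · exact hsmall s ⟨h1, (hw s hs).2⟩

end ObserverLoop

namespace ObserverLoop

variable {r : ℝ≥0} {n m q k l : ℕ} {D : Set (Vec q)}
  {f : Hist r n → Vec m → Vec q → Vec n} {h : Hist r n → Vec k}
  {R : Hist r n → Vec m → Vec q → Vec k}
  {F : Hist r l → Vec k → Vec m → Vec l} {Ψ : Hist r l → Hist r n}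
  {kf : Hist r n → Vec m} {σ γ : ℝ} {g a : ℝ → ℝ}

/-- The predictor coupled to the observer has a solution on short intervals `[t₀, t₁]`. -/
theorem exists_predictor (S : ObserverLoop r D f h R F Ψ kf σ γ g a) {L : ℝ} (hL : 0 ≤ L)
    (hR : ∀ x x' u, ‖R x' u 0 - R x u 0‖ ≤ L * ‖x' - x‖) {u : ℝ → Vec m} {w : ℝ → Vec k}
    (hu : LInfLoc univ u) (hw : LInfLoc univ w) (z₀ : Hist r l) {t₀ t₁ : ℝ} (h0 : 0 ≤ t₀)
    (h01 : t₀ ≤ t₁) (hδ : (t₁ - t₀) * (L * γ) ≤ 1 / 2) (u₀ : Vec m) (w₀ : Vec k) :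
    ∃ (v : ℝ → Vec k) (z : ℝ → Vec l), LInfLoc univ v ∧
      IsDelaySol r (fun t φ => F φ (v t) (u t)) z₀ (Ici 0) z ∧ EqOn v w (Ico 0 t₀) ∧
      ∀ t ∈ Icc t₀ t₁, v t = w₀ + ∫ s in t₀..t, R (Ψ (hist r z s)) u₀ 0 := by
  obtain ⟨B, hB0, hB⟩ := S.exists_predictor_bound hL hR hu hw z₀ h0 h01 hδ u₀ w₀
  have hε : ∀ j : ℕ, (0 : ℝ) < 1 / (j + 1) := fun j => by positivity
  choose v z hv hz hvw hvz using fun j : ℕ =>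
    S.exists_delayed_predictor (t₁ := t₁) hu hw z₀ h0 (hε j) u₀ w₀
  set τ : ℕ → ℝ → ℝ := fun j t => max t₀ (min t t₁ - 1 / ((j : ℝ) + 1)) with hτ
  have hτ0 : ∀ j t, t₀ ≤ τ j t := fun j t => le_max_left _ _
  have hτ1 : ∀ j t, τ j t ≤ t₁ := fun j t =>
    max_le h01 (by linarith [min_le_right t t₁, hε j])
  have hτt : ∀ j t, t₀ ≤ t → τ j t ≤ t := fun j t ht =>
    max_le ht (by linarith [min_le_left t t₁, hε j])
  have hlen : 0 ≤ t₁ - t₀ := by linarith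
  have hbound : ∀ j, ∀ t ∈ Icc t₀ t₁, ‖v j t‖ ≤ B ∧ ‖R (Ψ (hist r (z j) t)) u₀ 0‖ ≤ B := by
    intro j
    refine hB (v j) (z j) t₁ (hv j) (hz j) ⟨h01, le_rfl⟩ (hvw j) fun t ht C hC hle => ?_
    rw [hvz j t ht.1]
    refine (norm_add_le _ _).trans (add_le_add le_rfl ?_)
    have h1 := intervalIntegral.norm_integral_le_of_norm_le_const (a := t₀) (b := τ j t) (C := C)
      (f := fun s => R (Ψ (hist r (z j) s)) u₀ 0) fun s hs => by
        rw [uIoc_of_le (hτ0 j t)] at hs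
        exact hle s ⟨hs.1.le, hs.2.trans (hτt j t ht.1)⟩
    refine h1.trans ?_
    rw [abs_of_nonneg (by linarith [hτ0 j t]), mul_comm]
    gcongr
    exact hτ1 j t
  have hρc : ∀ j, ContinuousOn (fun s => R (Ψ (hist r (z j) s)) u₀ 0) (Ici 0) := fun j =>
    S.continuousOn_predictor u₀ (hz j).continuousOn_hist
  have hint : ∀ {ρ : ℝ → Vec k}, ContinuousOn ρ (Ici 0) → ∀ a b, t₀ ≤ a → t₀ ≤ b →
      IntervalIntegrable ρ volume a b := fun hρ a b ha hb =>
    (hρ.mono fun s hs => (h0.trans (le_min ha hb)).trans hs.1).intervalIntegrable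
  -- The a priori bound on the predictor velocity serves as a common Lipschitz constant; the lag and
  -- the two truncations do not increase time differences.
  have hlip : ∀ j, ∀ s ∈ Icc t₀ t₁, ∀ t ∈ Icc t₀ t₁, ‖v j t - v j s‖ ≤ B * |t - s| := by
    intro j s hs t ht
    rw [hvz j t ht.1, hvz j s hs.1, add_sub_add_left_eq_sub,
      intervalIntegral.integral_interval_sub_left (hint (hρc j) _ _ le_rfl (hτ0 j t))
        (hint (hρc j) _ _ le_rfl (hτ0 j s))]
    refine (intervalIntegral.norm_integral_le_of_norm_le_const (C := B) fun y hy => ?_).trans ?_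
    · refine (hbound j y ⟨?_, ?_⟩).2
      · exact (le_min (hτ0 j s) (hτ0 j t)).trans (uIoc_subset_uIcc hy).1
      · exact (uIoc_subset_uIcc hy).2.trans (max_le (hτ1 j s) (hτ1 j t))
    · refine mul_le_mul_of_nonneg_left ?_ hB0
      have h1 := abs_max_sub_max_le_max t₀ (min t t₁ - 1 / ((j : ℝ) + 1)) t₀
        (min s t₁ - 1 / ((j : ℝ) + 1))
      rw [sub_self, abs_zero, sub_sub_sub_cancel_right, min_eq_left ht.2, min_eq_left hs.2,
        max_eq_right (abs_nonneg (t - s))] at h1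
      simpa only [hτ, min_eq_left ht.2, min_eq_left hs.2] using h1
  obtain ⟨v', φ, hv'c, hφ, hlim⟩ := exists_subseq_uniform_limit h01
    (fun j t ht => (hbound j t ht).1) hlip
  have hvinf : LInfLoc univ fun t => if t < t₀ then w t else v' (max t₀ (min t t₁)) :=
    hw.glue (.of_continuousOn (hv'c.comp (by fun_prop)).continuousOn) t₀
  obtain ⟨z', hz'⟩ := S.exists_observer hu hvinf z₀
  have ht1 : 0 ≤ t₁ := h0.trans h01
  refine ⟨_, z', hvinf, hz', fun t ht => if_pos ht.2, fun t ht => ?_⟩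
  rw [if_neg (not_lt.2 ht.1), min_eq_left ht.2, max_eq_right ht.1]
  have hclose : ∀ η > 0, ∀ᶠ j in atTop, ∀ t ∈ Icc 0 t₁,
      ‖v (φ j) t - (if t < t₀ then w t else v' (max t₀ (min t t₁)))‖ ≤ η := by
    intro η hη
    filter_upwards [hlim η hη] with j hj t ht
    split_ifs with h1
    · rw [hvw (φ j) ⟨ht.1, h1⟩, sub_self, norm_zero]
      exact hη.le
    · have h2 := not_lt.1 h1
      rw [min_eq_left ht.2, max_eq_right h2]
      exact hj t ⟨h2, ht.2⟩
  have hzclose : ∀ η > 0, ∀ᶠ j in atTop, ∀ t ∈ Icc 0 t₁,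
      ‖hist r (z (φ j)) t - hist r z' t‖ ≤ η := by
    intro η hη
    obtain ⟨θ, hθ, H⟩ := S.observer_continuous_dependence hu hvinf hz' ht1 hη
    filter_upwards [hclose θ hθ] with j hj
    exact H _ _ (hz (φ j)) hj
  obtain ⟨Bz, hBz⟩ := isCompact_Icc.exists_bound_of_continuousOn
    (hz'.continuousOn_hist.mono (Icc_subset_Ici_self : Icc 0 t₁ ⊆ Ici 0))
  -- Local Lipschitz continuity of `R ∘ Ψ` turns convergence of the histories into convergence of
  -- the integrands. Radius `Bz + 1` suffices once the histories are within `η ≤ 1`.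
  obtain ⟨L', hL', hLip⟩ := S.predictor (Metric.closedBall 0 (Bz + 1) ×ˢ {u₀})
    (Metric.isBounded_closedBall.prod Bornology.isBounded_singleton) (by simp)
  have hρ' : ContinuousOn (fun s => R (Ψ (hist r z' s)) u₀ 0) (Ici 0) :=
    S.continuousOn_predictor u₀ hz'.continuousOn_hist
  obtain ⟨B', hB'⟩ := isCompact_Icc.exists_bound_of_continuousOn
    (hρ'.mono (Icc_subset_Ici_self : Icc 0 t₁ ⊆ Ici 0))
  have hB'0 : 0 ≤ B' := (norm_nonneg _).trans (hB' 0 ⟨le_rfl, ht1⟩)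
  have hεlim : Tendsto (fun j : ℕ => 1 / ((φ j : ℝ) + 1)) atTop (𝓝 0) :=
    tendsto_one_div_add_atTop_nhds_zero_nat.comp hφ.tendsto_atTop
  -- Three errors: passing to the limit signal, passing to the limit integrand, and removing the lag
  -- from the upper endpoint.
  have hmain : ∀ η > 0, η ≤ 1 →
      ‖v' t - (w₀ + ∫ s in t₀..t, R (Ψ (hist r z' s)) u₀ 0)‖ ≤
        (1 + L' * (t₁ - t₀) + B') * η := by
    intro η hη hη1
    obtain ⟨j, h1, h2, h3⟩ := ((hlim η hη).and ((hzclose η hη).and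
      (hεlim.eventually (gt_mem_nhds hη)))).exists
    have e1 : ‖v' t - v (φ j) t‖ ≤ η := by
      rw [norm_sub_rev]
      exact h1 t ht
    have e2 : ‖(∫ s in t₀..τ (φ j) t, R (Ψ (hist r (z (φ j)) s)) u₀ 0)
        - ∫ s in t₀..τ (φ j) t, R (Ψ (hist r z' s)) u₀ 0‖ ≤ L' * (t₁ - t₀) * η := by
      rw [← intervalIntegral.integral_sub (hint (hρc _) _ _ le_rfl (hτ0 _ t))
        (hint hρ' _ _ le_rfl (hτ0 _ t))]
      refine (intervalIntegral.norm_integral_le_of_norm_le_const (C := L' * η)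
        fun s hs => ?_).trans ?_
      · rw [uIoc_of_le (hτ0 _ t)] at hs
        have hs1 : s ∈ Icc 0 t₁ := ⟨h0.trans hs.1.le, hs.2.trans (hτ1 _ t)⟩
        have h4 := h2 s hs1
        refine (hLip _ _ u₀ ?_ ?_).trans (by gcongr)
        · simp only [mem_prod, mem_closedBall_zero_iff, mem_singleton_iff, and_true]
          have := norm_le_norm_add_norm_sub' (hist r (z (φ j)) s) (hist r z' s)
          linarith [hBz s hs1]
        · simp only [mem_prod, mem_closedBall_zero_iff, mem_singleton_iff, and_true]
          linarith [hBz s hs1]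
      · rw [abs_of_nonneg (by linarith [hτ0 (φ j) t])]
        have := hτ1 (φ j) t
        calc L' * η * (τ (φ j) t - t₀) ≤ L' * η * (t₁ - t₀) := by gcongr
          _ = _ := by ring
    have e3 : ‖(∫ s in t₀..τ (φ j) t, R (Ψ (hist r z' s)) u₀ 0)
        - ∫ s in t₀..t, R (Ψ (hist r z' s)) u₀ 0‖ ≤ B' * η := by
      rw [intervalIntegral.integral_interval_sub_left (hint hρ' _ _ le_rfl (hτ0 _ t))
        (hint hρ' _ _ le_rfl ht.1)]
      refine (intervalIntegral.norm_integral_le_of_norm_le_const (C := B')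
        fun s hs => ?_).trans ?_
      · rw [uIoc_of_ge (hτt _ t ht.1)] at hs
        exact hB' s ⟨(h0.trans (hτ0 _ t)).trans hs.1.le |>.trans le_rfl, hs.2.trans ht.2⟩
      · gcongr
        rw [abs_sub_comm, abs_of_nonneg (by linarith [hτt (φ j) t ht.1])]
        have : min t t₁ - 1 / ((φ j : ℝ) + 1) ≤ τ (φ j) t := le_max_right _ _
        rw [min_eq_left ht.2] at this
        linarith
    have e4 : v' t - (w₀ + ∫ s in t₀..t, R (Ψ (hist r z' s)) u₀ 0) =
        (v' t - v (φ j) t) + ((∫ s in t₀..τ (φ j) t, R (Ψ (hist r (z (φ j)) s)) u₀ 0)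
        - ∫ s in t₀..τ (φ j) t, R (Ψ (hist r z' s)) u₀ 0) +
        ((∫ s in t₀..τ (φ j) t, R (Ψ (hist r z' s)) u₀ 0)
        - ∫ s in t₀..t, R (Ψ (hist r z' s)) u₀ 0) := by
      have := hvz (φ j) t ht.1
      rw [this]
      abel
    rw [e4]
    refine (norm_add₃_le).trans ?_
    linarith
  have hC : 0 < 1 + L' * (t₁ - t₀) + B' := by positivity
  have hzero : ‖v' t - (w₀ + ∫ s in t₀..t, R (Ψ (hist r z' s)) u₀ 0)‖ ≤ 0 := by
    refine le_of_forall_pos_le_add fun e he => ?_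
    have h1 := hmain (min (e / (1 + L' * (t₁ - t₀) + B')) 1) (by positivity) (min_le_right _ _)
    refine h1.trans ?_
    rw [zero_add]
    calc _ ≤ (1 + L' * (t₁ - t₀) + B') * (e / (1 + L' * (t₁ - t₀) + B')) := by
          gcongr
          exact min_le_left _ _
      _ = e := by field_simp
  exact sub_eq_zero.1 (norm_le_zero_iff.1 hzero)

end ObserverLoop

/-! ### Sampling sequences -/

namespace IsSampling

variable {τ : ℕ → ℝ} {δ : ℝ}

theorem strictMono (hτ : IsSampling τ δ) : StrictMono τ :=
  strictMono_nat_of_lt_succ fun i => by linarith [hτ.pos i]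

theorem nonneg (hτ : IsSampling τ δ) (i : ℕ) : 0 ≤ τ i := by
  rw [← hτ.zero]
  exact hτ.strictMono.monotone (Nat.zero_le i)

theorem exists_lt (hτ : IsSampling τ δ) (t : ℝ) : ∃ i, t < τ i :=
  (hτ.tendsto.eventually (eventually_gt_atTop t)).exists

theorem exists_mem_Ico (hτ : IsSampling τ δ) {t : ℝ} (ht : 0 ≤ t) :
    ∃ i, t ∈ Ico (τ i) (τ (i + 1)) := by
  classical
  have hex := hτ.exists_lt t
  have hpos : Nat.find hex ≠ 0 := by
    intro h0
    have := Nat.find_spec hex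
    rw [h0, hτ.zero] at this
    linarith
  obtain ⟨i, hi⟩ := Nat.exists_eq_succ_of_ne_zero hpos
  refine ⟨i, not_lt.1 (Nat.find_min hex (by omega)), ?_⟩
  have := Nat.find_spec hex
  rwa [hi] at this

theorem le_of_mem_of_lt (hτ : IsSampling τ δ) {i j : ℕ} {t : ℝ} (ht : τ j ≤ t)
    (hi : t < τ (i + 1)) : j ≤ i :=
  Nat.lt_succ_iff.1 (hτ.strictMono.lt_iff_lt.1 (ht.trans_lt hi))

end IsSampling

theorem continuousOn_Ico_of_Icc {X : Type*} [TopologicalSpace X] {v : ℝ → X} {a b : ℝ}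
    (h : ∀ c ∈ Ico a b, ContinuousOn v (Icc a c)) : ContinuousOn v (Ico a b) := by
  intro t ht
  obtain ⟨c, htc, hcb⟩ := exists_between ht.2
  refine (h c ⟨ht.1.trans htc.le, hcb⟩ t ⟨ht.1, htc.le⟩).mono_of_mem_nhdsWithin ?_
  filter_upwards [self_mem_nhdsWithin, mem_nhdsWithin_of_mem_nhds (Iio_mem_nhds htc)] with s h1 h2
  exact ⟨h1.1, le_of_lt h2⟩

/-- Continuity on the half-open interval gives measurability, but it does not exclude blow-up at
`b`; hence the separate bound. -/
theorem LInfLoc.truncate_extend {p : ℕ} {v : ℝ → Vec p} {b₀ b B : ℝ}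
    (hv : LInfLoc univ (_root_.truncate v b₀)) (hc : ContinuousOn v (Ico b₀ b))
    (hB : ∀ t ∈ Ico b₀ b, ‖v t‖ ≤ B) : LInfLoc univ (_root_.truncate v b) := by
  rcases le_or_gt b b₀ with hb | hb
  · refine (hv.truncate b).congr fun t _ => ?_
    unfold _root_.truncate
    split_ifs with h1 h2
    · rfl
    · exact absurd (h1.trans_le hb) h2
    · rfl
  have hmeas : Measurable ((Ico b₀ b).indicator v) := by
    rw [← piecewise_eq_indicator]
    exact hc.measurable_piecewise continuousOn_const measurableSet_Ico
  have hind : LInfLoc univ ((Ico b₀ b).indicator v) :=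
    ⟨hmeas.aemeasurable, fun _ _ => mem_univ _, fun T _ => ⟨max B 0, fun t _ => by
      by_cases h1 : t ∈ Ico b₀ b
      · rw [indicator_of_mem h1]
        exact (hB t h1).trans (le_max_left _ _)
      · rw [indicator_of_notMem h1, norm_zero]
        exact le_max_right _ _⟩⟩
  refine (hv.glue hind b₀).congr fun t _ => ?_
  unfold _root_.truncate
  by_cases h1 : t < b₀
  · simp only [h1, h1.trans hb, if_true]
  · by_cases h2 : t < b
    · simp only [h1, h2, if_true, if_false]
      rw [indicator_of_mem (show t ∈ Ico b₀ b from ⟨not_lt.1 h1, h2⟩)]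
    · simp only [h1, h2, if_false]
      rw [indicator_of_notMem fun h3 => h2 h3.2]

/-- A primitive of a continuous function agrees with any absolutely continuous function that has
the same derivative almost everywhere. -/
theorem eq_add_integral_of_ae_hasDerivAt {p : ℕ} {w ρ : ℝ → Vec p} {a b : ℝ} (hab : a ≤ b)
    (hw : AbsolutelyContinuousOnInterval w a b) (hρ : ContinuousOn ρ (Icc a b))
    (hd : ∀ᵐ t ∂volume, t ∈ Ioo a b → HasDerivAt w (ρ t) t) : w b = w a + ∫ s in a..b, ρ s := by
  -- The constant extension of `ρ` has a primitive that is C¹ on the line. Its difference with `w`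
  -- is absolutely continuous with zero derivative almost everywhere, hence constant.
  set ρ' : ℝ → Vec p := IccExtend hab ((Icc a b).domRestrict ρ) with hρ'
  have hρ'c : Continuous ρ' := (continuousOn_iff_continuous_domRestrict.1 hρ).Icc_extend'
  have hρe : ∀ t ∈ Icc a b, ρ' t = ρ t := fun t ht => by
    rw [hρ', IccExtend_of_mem hab _ ht]
    rfl
  have hW : ∀ t, HasDerivAt (fun t => ∫ s in a..t, ρ' s) (ρ' t) t := fun t =>
    intervalIntegral.integral_hasDerivAt_right (hρ'c.intervalIntegrable _ _)
      (hρ'c.stronglyMeasurableAtFilter _ _) hρ'c.continuousAt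
  have hWc : ContDiff ℝ 1 fun t => ∫ s in a..t, ρ' s := by
    rw [contDiff_one_iff_deriv]
    refine ⟨fun t => (hW t).differentiableAt, ?_⟩
    rwa [show deriv (fun t => ∫ s in a..t, ρ' s) = ρ' from funext fun t => (hW t).deriv]
  have hAC := hw.fun_sub (hWc.contDiffOn.absolutelyContinuousOnInterval (a := a) (b := b))
  have ha : ∀ᵐ t ∂(volume : Measure ℝ), t ≠ a := by simp [ae_iff, measure_singleton]
  have hb : ∀ᵐ t ∂(volume : Measure ℝ), t ≠ b := by simp [ae_iff, measure_singleton]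
  obtain ⟨C, hC⟩ := hAC.const_of_ae_hasDerivAt_zero (by
    filter_upwards [hd, ha, hb] with t ht hta htb htm
    rw [uIcc_of_le hab] at htm
    have h1 := (ht ⟨lt_of_le_of_ne htm.1 (Ne.symm hta), lt_of_le_of_ne htm.2 htb⟩).fun_sub (hW t)
    rwa [hρe t htm, sub_self] at h1)
  have h1 := hC a left_mem_uIcc
  have h2 := hC b right_mem_uIcc
  simp only [intervalIntegral.integral_same, sub_zero] at h1
  have h3 : ∫ s in a..b, ρ s = ∫ s in a..b, ρ' s :=
    intervalIntegral.integral_congr fun s hs => (hρe s (by rwa [uIcc_of_le hab] at hs)).symm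
  rw [h3, h1, ← h2]
  abel

/-! ### The closed loop -/

section ClosedLoop

variable {r : ℝ≥0} {n m q k l : ℕ} {D : Set (Vec q)}
  {f : Hist r n → Vec m → Vec q → Vec n} {h : Hist r n → Vec k}
  {R : Hist r n → Vec m → Vec q → Vec k}
  {F : Hist r l → Vec k → Vec m → Vec l} {Ψ : Hist r l → Hist r n}
  {kf : Hist r n → Vec m} {σ γ : ℝ} {g a : ℝ → ℝ}
  {τ : ℕ → ℝ} {δ : ℝ} {d : ℝ → Vec q} {ξ : ℝ → Vec k} {x₀ : Hist r n} {z₀ : Hist r l}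

theorem IsClosedLoopSol.mono {J J' : Set ℝ} {x : ℝ → Vec n} {z : ℝ → Vec l} {w : ℝ → Vec k}
    {u : ℝ → Vec m} (hs : IsClosedLoopSol r f h R F Ψ kf τ d ξ x₀ z₀ J x z w u) (hJ : J' ⊆ J) :
    IsClosedLoopSol r f h R F Ψ kf τ d ξ x₀ z₀ J' x z w u where
  plant := hs.plant.mono hJ
  observer := hs.observer.mono hJ
  predictor_ac i c hc c' hc' := hs.predictor_ac i c ⟨hJ hc.1, hc.2⟩ c' ⟨hJ hc'.1, hc'.2⟩
  predictor_deriv i := by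
    filter_upwards [hs.predictor_deriv i] with t ht htm using ht ⟨hJ htm.1, htm.2⟩
  predictor_reset i hi := hs.predictor_reset i (hJ hi)
  feedback i t ht := hs.feedback i t ⟨hJ ht.1, ht.2⟩

/-- Global solutions of plant and observer whose driving signals `w` and `u` satisfy the
closed-loop laws on `[0, T)`. -/
structure LoopUpTo (r : ℝ≥0) {n m q k l : ℕ}
    (f : Hist r n → Vec m → Vec q → Vec n) (h : Hist r n → Vec k)
    (R : Hist r n → Vec m → Vec q → Vec k)
    (F : Hist r l → Vec k → Vec m → Vec l) (Ψ : Hist r l → Hist r n)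
    (kf : Hist r n → Vec m) (τ : ℕ → ℝ) (d : ℝ → Vec q) (ξ : ℝ → Vec k)
    (x₀ : Hist r n) (z₀ : Hist r l) (T : ℝ)
    (x : ℝ → Vec n) (z : ℝ → Vec l) (w : ℝ → Vec k) (u : ℝ → Vec m) : Prop where
  input : LInfLoc univ u
  signal : LInfLoc univ w
  plant : IsPlantSol r f u d x₀ x
  observer : IsDelaySol r (fun t φ => F φ (w t) (u t)) z₀ (Ici 0) z
  feedback : ∀ i, ∀ t ∈ Ico (τ i) (τ (i + 1)), t < T → u t = kf (Ψ (hist r z (τ i)))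
  predictor : ∀ i, ∀ t ∈ Ico (τ i) (τ (i + 1)), t < T → w t = h (hist r x (τ i)) + ξ (τ i) +
    ∫ s in τ i..t, R (Ψ (hist r z s)) (kf (Ψ (hist r z (τ i)))) 0

/-- Solutions driven by signals that agree with the given ones on `[0, T)`. -/
theorem LoopUpTo.transfer (S : ObserverLoop r D f h R F Ψ kf σ γ g a) (hτ : IsSampling τ δ)
    (hd : LInfLoc D d) {T : ℝ} {x x' : ℝ → Vec n} {z z' : ℝ → Vec l} {w w' : ℝ → Vec k}
    {u u' : ℝ → Vec m} (hs : LoopUpTo r f h R F Ψ kf τ d ξ x₀ z₀ T x z w u)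
    (hu' : LInfLoc univ u') (hw' : LInfLoc univ w') (hx' : IsPlantSol r f u' d x₀ x')
    (hz' : IsDelaySol r (fun t φ => F φ (w' t) (u' t)) z₀ (Ici 0) z')
    (hu : EqOn u u' (Ico 0 T)) (hw : EqOn w w' (Ico 0 T)) :
    (EqOn x x' (Ico 0 T) ∧ EqOn z z' (Ico 0 T)) ∧
      (∀ t ∈ Icc 0 T, hist r x t = hist r x' t ∧ hist r z t = hist r z' t) ∧
      LoopUpTo r f h R F Ψ kf τ d ξ x₀ z₀ T x' z' w' u' := by
  have hxx : EqOn x x' (Ico 0 T) := S.plant_causal hs.input hd hu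
    (IsDelaySol.mono hs.plant Ico_subset_Ici_self) (IsDelaySol.mono hx' Ico_subset_Ici_self)
  have hzz : EqOn z z' (Ico 0 T) := S.observer_causal hs.input hs.signal hu hw
    (hs.observer.mono Ico_subset_Ici_self) (hz'.mono Ico_subset_Ici_self)
  have hh : ∀ t ∈ Icc 0 T, hist r x t = hist r x' t ∧ hist r z t = hist r z' t := fun t ht =>
    ⟨ObserverLoop.hist_eq_of_eqOn_Icc hs.plant hx' hxx ht,
      ObserverLoop.hist_eq_of_eqOn_Icc hs.observer hz' hzz ht⟩
  refine ⟨⟨hxx, hzz⟩, hh, hu', hw', hx', hz', fun i t ht htT => ?_, fun i t ht htT => ?_⟩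
  · rw [← (hh (τ i) ⟨hτ.nonneg i, ht.1.trans htT.le⟩).2, ← hs.feedback i t ht htT]
    exact (hu ⟨(hτ.nonneg i).trans ht.1, htT⟩).symm
  · obtain ⟨e1, e2⟩ := hh (τ i) ⟨hτ.nonneg i, ht.1.trans htT.le⟩
    rw [← e1, ← e2, ← hw ⟨(hτ.nonneg i).trans ht.1, htT⟩, hs.predictor i t ht htT]
    congr 1
    refine intervalIntegral.integral_congr fun s hs' => ?_
    rw [uIcc_of_le ht.1] at hs'
    simp only [(hh s ⟨(hτ.nonneg i).trans hs'.1, hs'.2.trans htT.le⟩).2]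

/-- Continuation of the closed loop to the next sampling time. -/
theorem LoopUpTo.step (S : ObserverLoop r D f h R F Ψ kf σ γ g a) {L : ℝ} (hL : 0 ≤ L)
    (hR : ∀ x x' u, ‖R x' u 0 - R x u 0‖ ≤ L * ‖x' - x‖) (hτ : IsSampling τ δ)
    (hδ : δ * (L * γ) ≤ 1 / 2) (hd : LInfLoc D d) {T : ℝ} {i : ℕ}
    (hT : T ∈ Ico (τ i) (τ (i + 1))) {x : ℝ → Vec n} {z : ℝ → Vec l} {w : ℝ → Vec k}
    {u : ℝ → Vec m} (hs : LoopUpTo r f h R F Ψ kf τ d ξ x₀ z₀ T x z w u) :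
    ∃ x' z' w' u', LoopUpTo r f h R F Ψ kf τ d ξ x₀ z₀ (τ (i + 1)) x' z' w' u' ∧
      EqOn w w' (Ico 0 T) ∧ EqOn u u' (Ico 0 T) := by
  set u₀ := kf (Ψ (hist r z (τ i))) with hu₀
  -- The value that the predictor has reached at `T`, so that a continuation may start inside a
  -- sampling interval.
  set w₀ := h (hist r x (τ i)) + ξ (τ i) + ∫ s in τ i..T, R (Ψ (hist r z s)) u₀ 0 with hw₀
  have hτi := hτ.nonneg i
  have hT0 : 0 ≤ T := hτi.trans hT.1
  have hu' : LInfLoc univ fun t => if t < T then u t else u₀ := hs.input.glue (.const u₀) T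
  obtain ⟨x', hx'⟩ := S.exists_plant hu' hd x₀
  have hγ := S.observer.γ_pos
  have hlen : (τ (i + 1) - T) * (L * γ) ≤ 1 / 2 := by
    refine le_trans ?_ hδ
    have := hτ.le i
    have := hT.1
    gcongr
    linarith
  obtain ⟨v, z', hv, hz', hvw, hvz⟩ :=
    S.exists_predictor hL hR hu' hs.signal z₀ hT0 hT.2.le hlen u₀ w₀
  have heu : EqOn u (fun t => if t < T then u t else u₀) (Ico 0 T) := fun t ht => (if_pos ht.2).symm
  obtain ⟨-, hh, htr⟩ := hs.transfer S hτ hd hu' hv hx' hz' heu hvw.symm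
  refine ⟨x', z', v, _, ⟨hu', hv, hx', hz', fun j t ht htT => ?_, fun j t ht htT => ?_⟩,
    hvw.symm, heu⟩
  · rcases lt_or_ge t T with h1 | h1
    · exact htr.feedback j t ht h1
    · have hji : j = i := le_antisymm (hτ.le_of_mem_of_lt ht.1 htT)
        (hτ.le_of_mem_of_lt (hT.1.trans h1) ht.2)
      rw [if_neg (not_lt.2 h1), hji, ← (hh (τ i) ⟨hτi, hT.1⟩).2]
  · rcases lt_or_ge t T with h1 | h1
    · exact htr.predictor j t ht h1
    · have hji : j = i := le_antisymm (hτ.le_of_mem_of_lt ht.1 htT)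
        (hτ.le_of_mem_of_lt (hT.1.trans h1) ht.2)
      obtain ⟨e1, e2⟩ := hh (τ i) ⟨hτi, hT.1⟩
      have hρ := S.continuousOn_predictor u₀ hz'.continuousOn_hist
      have hadj := intervalIntegral.integral_add_adjacent_intervals (a := τ i) (b := T) (c := t)
        (μ := volume)
        (hρ.mono fun s hs' => hτi.trans ((uIcc_of_le hT.1 ▸ hs').1)).intervalIntegrable
        (hρ.mono fun s hs' => hT0.trans ((uIcc_of_le h1 ▸ hs').1)).intervalIntegrable
      rw [hji, ← e1, ← e2, hvz t ⟨h1, htT.le⟩, hw₀, ← hu₀, add_assoc _ (∫ s in τ i..T, _),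
        ← hadj]
      congr 2
      refine intervalIntegral.integral_congr fun s hs' => ?_
      rw [uIcc_of_le hT.1] at hs'
      simp only [(hh s ⟨hτi.trans hs'.1, hs'.2⟩).2]

/-- Continuation of the closed loop to all times. -/
theorem LoopUpTo.extend (S : ObserverLoop r D f h R F Ψ kf σ γ g a) {L : ℝ} (hL : 0 ≤ L)
    (hR : ∀ x x' u, ‖R x' u 0 - R x u 0‖ ≤ L * ‖x' - x‖) (hτ : IsSampling τ δ)
    (hδ : δ * (L * γ) ≤ 1 / 2) (hd : LInfLoc D d) {T : ℝ} (hT : 0 ≤ T) {x : ℝ → Vec n}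
    {z : ℝ → Vec l} {w : ℝ → Vec k} {u : ℝ → Vec m}
    (hs : LoopUpTo r f h R F Ψ kf τ d ξ x₀ z₀ T x z w u) :
    ∃ x' z' w' u', (∀ b, LoopUpTo r f h R F Ψ kf τ d ξ x₀ z₀ b x' z' w' u') ∧
      EqOn x x' (Ico 0 T) ∧ EqOn z z' (Ico 0 T) ∧ EqOn w w' (Ico 0 T) ∧ EqOn u u' (Ico 0 T) := by
  obtain ⟨i, hi⟩ := hτ.exists_mem_Ico hT
  -- Only the signals are carried through the recursion. They determine the plant and observer
  -- trajectories, which are solved anew at the end for the limiting signals.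
  let P : ℕ → (ℝ → Vec k) × (ℝ → Vec m) → Prop := fun j p =>
    ∃ x z, LoopUpTo r f h R F Ψ kf τ d ξ x₀ z₀ (τ (i + 1 + j)) x z p.1 p.2
  have hstep : ∀ j (p : {p // P j p}), ∃ p' : {p' // P (j + 1) p'},
      EqOn p.1.1 p'.1.1 (Ico 0 (τ (i + 1 + j))) ∧ EqOn p.1.2 p'.1.2 (Ico 0 (τ (i + 1 + j))) := by
    rintro j ⟨⟨w₁, u₁⟩, x₁, z₁, h₁⟩
    obtain ⟨x₂, z₂, w₂, u₂, h₂, e1, e2⟩ := h₁.step S hL hR hτ hδ hd (i := i + 1 + j)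
      ⟨le_rfl, hτ.strictMono (Nat.lt_succ_self _)⟩
    exact ⟨⟨(w₂, u₂), x₂, z₂, h₂⟩, e1, e2⟩
  obtain ⟨x₁, z₁, w₁, u₁, h₁, hw₁, hu₁⟩ := hs.step S hL hR hτ hδ hd hi
  choose next hnext using hstep
  let seq : ∀ j, {p // P j p} := fun j =>
    Nat.rec (motive := fun j => {p // P j p}) ⟨(w₁, u₁), x₁, z₁, h₁⟩ next j
  have hmono : ∀ j j', j ≤ j' →
      EqOn (seq j).1.1 (seq j').1.1 (Ico 0 (τ (i + 1 + j))) ∧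
      EqOn (seq j).1.2 (seq j').1.2 (Ico 0 (τ (i + 1 + j))) := by
    intro j j' hjj
    induction j', hjj using Nat.le_induction with
    | base => exact ⟨fun _ _ => rfl, fun _ _ => rfl⟩
    | succ j' hj ih =>
      have hsub : Ico 0 (τ (i + 1 + j)) ⊆ Ico 0 (τ (i + 1 + j')) :=
        Ico_subset_Ico_right (hτ.strictMono.monotone (by omega))
      exact ⟨ih.1.trans ((hnext j' (seq j')).1.mono hsub),
        ih.2.trans ((hnext j' (seq j')).2.mono hsub)⟩
  have hN : ∀ t : ℝ, ∃ j, t < τ (i + 1 + j) := by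
    intro t
    obtain ⟨j, hj⟩ := hτ.exists_lt t
    exact ⟨j, hj.trans_le (hτ.strictMono.monotone (by omega))⟩
  -- The signals at time `t` no longer change after stage `N t`.
  choose N hN using hN
  set w' : ℝ → Vec k := fun t => (seq (N t)).1.1 t with hw'
  set u' : ℝ → Vec m := fun t => (seq (N t)).1.2 t with hu'
  have hlim : ∀ j, EqOn (seq j).1.1 w' (Ico 0 (τ (i + 1 + j))) ∧
      EqOn (seq j).1.2 u' (Ico 0 (τ (i + 1 + j))) := by
    intro j
    constructor
    · intro t ht
      rcases le_total j (N t) with hj | hj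
      · exact (hmono j _ hj).1 ht
      · exact ((hmono _ j hj).1 ⟨ht.1, hN t⟩).symm
    · intro t ht
      rcases le_total j (N t) with hj | hj
      · exact (hmono j _ hj).2 ht
      · exact ((hmono _ j hj).2 ⟨ht.1, hN t⟩).symm
  have hwinf : LInfLoc univ w' := .of_truncate fun b => by
    obtain ⟨xb, zb, hb⟩ := (seq (N b)).2
    refine (hb.signal.truncate b).congr fun t ht => ?_
    unfold truncate
    split_ifs with h1
    · exact ((hlim (N b)).1 ⟨ht, h1.trans (hN b)⟩).symm
    · rfl
  have huinf : LInfLoc univ u' := .of_truncate fun b => by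
    obtain ⟨xb, zb, hb⟩ := (seq (N b)).2
    refine (hb.input.truncate b).congr fun t ht => ?_
    unfold truncate
    split_ifs with h1
    · exact ((hlim (N b)).2 ⟨ht, h1.trans (hN b)⟩).symm
    · rfl
  obtain ⟨x', hx'⟩ := S.exists_plant huinf hd x₀
  obtain ⟨z', hz'⟩ := S.exists_observer huinf hwinf z₀
  have hsub : Ico 0 T ⊆ Ico 0 (τ (i + 1 + 0)) := Ico_subset_Ico_right hi.2.le
  have hwT : EqOn w w' (Ico 0 T) := hw₁.trans ((hlim 0).1.mono hsub)
  have huT : EqOn u u' (Ico 0 T) := hu₁.trans ((hlim 0).2.mono hsub)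
  obtain ⟨⟨hxT, hzT⟩, -, -⟩ := hs.transfer S hτ hd huinf hwinf hx' hz' huT hwT
  refine ⟨x', z', w', u', fun b => ?_, hxT, hzT, hwT, huT⟩
  obtain ⟨xb, zb, hb⟩ := (seq (N b)).2
  obtain ⟨-, -, htr⟩ := hb.transfer S hτ hd huinf hwinf hx' hz' (hlim (N b)).2 (hlim (N b)).1
  exact ⟨huinf, hwinf, hx', hz', fun j t ht htb => htr.feedback j t ht (htb.trans (hN b)),
    fun j t ht htb => htr.predictor j t ht (htb.trans (hN b))⟩

/-- On each sampling interval `w` coincides with a function that is C¹ on the line, whence its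
absolute continuity and its derivative in the interior. The left endpoint, where `w` may jump, is a
null set. -/
theorem LoopUpTo.isClosedLoopSol (S : ObserverLoop r D f h R F Ψ kf σ γ g a)
    (hτ : IsSampling τ δ) {x : ℝ → Vec n} {z : ℝ → Vec l} {w : ℝ → Vec k} {u : ℝ → Vec m}
    (hs : ∀ b, LoopUpTo r f h R F Ψ kf τ d ξ x₀ z₀ b x z w u) :
    IsClosedLoopSol r f h R F Ψ kf τ d ξ x₀ z₀ (Ici 0) x z w u := by
  have hfb : ∀ i, ∀ t ∈ Ico (τ i) (τ (i + 1)), u t = kf (Ψ (hist r z (τ i))) := fun i t ht =>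
    (hs (τ (i + 1))).feedback i t ht ht.2
  have hwW : ∀ i, ∃ W : ℝ → Vec k, ContDiff ℝ 1 W ∧ EqOn w W (Ico (τ i) (τ (i + 1))) ∧
      ∀ t ∈ Ico (τ i) (τ (i + 1)), HasDerivAt W (R (Ψ (hist r z t)) (u t) 0) t := by
    intro i
    have hρ := S.continuousOn_predictor (kf (Ψ (hist r z (τ i)))) (hs 0).observer.continuousOn_hist
    set ρ : ℝ → Vec k := fun s => R (Ψ (hist r z (max 0 s))) (kf (Ψ (hist r z (τ i)))) 0 with hρd
    have hρc : Continuous ρ :=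
      hρ.comp_continuous (by fun_prop) fun s => mem_Ici.2 (le_max_left _ _)
    have hW : ∀ t, HasDerivAt (fun t => h (hist r x (τ i)) + ξ (τ i) + ∫ s in τ i..t, ρ s)
        (ρ t) t := fun t =>
      (intervalIntegral.integral_hasDerivAt_right (hρc.intervalIntegrable _ _)
        (hρc.stronglyMeasurableAtFilter _ _) hρc.continuousAt).const_add _
    refine ⟨fun t => h (hist r x (τ i)) + ξ (τ i) + ∫ s in τ i..t, ρ s, ?_, fun t ht => ?_,
      fun t ht => ?_⟩
    · rw [contDiff_one_iff_deriv]
      refine ⟨fun t => (hW t).differentiableAt, ?_⟩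
      rwa [show deriv _ = ρ from funext fun t => (hW t).deriv]
    · rw [(hs (τ (i + 1))).predictor i t ht ht.2]
      congr 1
      refine intervalIntegral.integral_congr fun s hs' => ?_
      rw [uIcc_of_le ht.1] at hs'
      simp only [hρd, max_eq_right ((hτ.nonneg i).trans hs'.1)]
    · have := hW t
      simpa only [hρd, max_eq_right ((hτ.nonneg i).trans ht.1), ← hfb i t ht] using this
  refine ⟨(hs 0).plant, (hs 0).observer, fun i => ?_, fun i => ?_, fun i _ => ?_,
    fun i t ht => hfb i t ht.2⟩
  · obtain ⟨W, hW, heq, -⟩ := hwW i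
    intro b hb c hc hbc
    refine hW.contDiffOn.absolutelyContinuousOnInterval.congr_on (heq.mono ?_)
    rw [uIcc_of_le hbc]
    exact fun t ht => ⟨hb.2.1.trans ht.1, ht.2.trans_lt hc.2.2⟩
  · obtain ⟨W, -, heq, hder⟩ := hwW i
    have h1 : ∀ᵐ t ∂(volume : Measure ℝ), t ≠ τ i := by simp [ae_iff, measure_singleton]
    filter_upwards [h1] with t ht htm
    refine (hder t htm.2).congr_of_eventuallyEq ?_
    filter_upwards [Ioo_mem_nhds (lt_of_le_of_ne htm.2.1 (Ne.symm ht)) htm.2.2] with s hs'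
    exact heq ⟨hs'.1.le, hs'.2⟩
  · have hi : τ i ∈ Ico (τ i) (τ (i + 1)) := ⟨le_rfl, hτ.strictMono (Nat.lt_succ_self _)⟩
    rw [(hs (τ (i + 1))).predictor i (τ i) hi hi.2, intervalIntegral.integral_same, add_zero]

end ClosedLoop

/-! ### Boundedness and continuation of arbitrary closed-loop solutions. -/

section ClosedLoop

variable {r : ℝ≥0} {n m q k l : ℕ} {D : Set (Vec q)}
  {f : Hist r n → Vec m → Vec q → Vec n} {h : Hist r n → Vec k}
  {R : Hist r n → Vec m → Vec q → Vec k}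
  {F : Hist r l → Vec k → Vec m → Vec l} {Ψ : Hist r l → Hist r n}
  {kf : Hist r n → Vec m} {σ γ : ℝ} {g a : ℝ → ℝ}
  {τ : ℕ → ℝ} {δ : ℝ} {d : ℝ → Vec q} {ξ : ℝ → Vec k} {x₀ : Hist r n} {z₀ : Hist r l}

namespace IsClosedLoopSol

variable {x : ℝ → Vec n} {z : ℝ → Vec l} {w : ℝ → Vec k} {u : ℝ → Vec m}

theorem predictor_eq (S : ObserverLoop r D f h R F Ψ kf σ γ g a) (hτ : IsSampling τ δ) {T : ℝ}
    (hs : IsClosedLoopSol r f h R F Ψ kf τ d ξ x₀ z₀ (Ico 0 T) x z w u) {i : ℕ} {t : ℝ}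
    (ht : t ∈ Ico (τ i) (τ (i + 1))) (htT : t < T) :
    w t = h (hist r x (τ i)) + ξ (τ i) +
      ∫ s in τ i..t, R (Ψ (hist r z s)) (kf (Ψ (hist r z (τ i)))) 0 := by
  have hτi := hτ.nonneg i
  have hmem : ∀ s ∈ Icc (τ i) t, s ∈ Ico 0 T ∩ Ico (τ i) (τ (i + 1)) := fun s hs' =>
    ⟨⟨hτi.trans hs'.1, hs'.2.trans_lt htT⟩, hs'.1, hs'.2.trans_lt ht.2⟩
  have hti : τ i ∈ Icc (τ i) t := ⟨le_rfl, ht.1⟩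
  have htt : t ∈ Icc (τ i) t := ⟨ht.1, le_rfl⟩
  have hz : ContinuousOn (hist r z) (Icc (τ i) t) :=
    (continuousOn_hist_Icc (hs.observer.continuousOn_Icc (c := t) fun s hs' =>
      ⟨hs'.1, hs'.2.trans_lt htT⟩)).mono (Icc_subset_Icc_left hτi)
  rw [← hs.predictor_reset i (hmem _ hti).1]
  refine eq_add_integral_of_ae_hasDerivAt ht.1
    (hs.predictor_ac i _ (hmem _ hti) _ (hmem _ htt) ht.1) (S.continuousOn_predictor _ hz) ?_
  filter_upwards [hs.predictor_deriv i] with s hs' hsm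
  have h1 := hmem s (Ioo_subset_Icc_self hsm)
  have h2 := hs' h1
  rwa [hs.feedback i s h1] at h2

theorem continuousOn_signal (hτ : IsSampling τ δ) {T : ℝ}
    (hs : IsClosedLoopSol r f h R F Ψ kf τ d ξ x₀ z₀ (Ico 0 T) x z w u) {i : ℕ} {b : ℝ}
    (hb : b ≤ τ (i + 1)) (hbT : b ≤ T) : ContinuousOn w (Ico (τ i) b) := by
  refine continuousOn_Ico_of_Icc fun c hc => ?_
  have hτi := hτ.nonneg i
  have hmem : ∀ s ∈ Icc (τ i) c, s ∈ Ico 0 T ∩ Ico (τ i) (τ (i + 1)) := fun s hs' =>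
    ⟨⟨hτi.trans hs'.1, hs'.2.trans_lt (hc.2.trans_le hbT)⟩, hs'.1,
      hs'.2.trans_lt (hc.2.trans_le hb)⟩
  have := (hs.predictor_ac i _ (hmem (τ i) ⟨le_rfl, hc.1⟩) c (hmem _ ⟨hc.1, le_rfl⟩)
    hc.1).continuousOn
  rwa [uIcc_of_le hc.1] at this

/-- Along a closed-loop solution on `[0, T)` the input and the predictor are bounded and
measurable. -/
theorem linfLoc_truncate (S : ObserverLoop r D f h R F Ψ kf σ γ g a) {L : ℝ} (hL : 0 ≤ L)
    (hR : ∀ x x' u, ‖R x' u 0 - R x u 0‖ ≤ L * ‖x' - x‖) (hτ : IsSampling τ δ)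
    (hδ : δ * (L * γ) ≤ 1 / 2) {T : ℝ}
    (hs : IsClosedLoopSol r f h R F Ψ kf τ d ξ x₀ z₀ (Ico 0 T) x z w u) :
    LInfLoc univ (truncate u T) ∧ LInfLoc univ (truncate w T) := by
  -- Induction over sampling intervals. The bound `b` may cut the current interval, so the last,
  -- incomplete one before `T` is covered.
  have key : ∀ i : ℕ, ∀ b ≤ T, b ≤ τ i →
      LInfLoc univ (truncate u b) ∧ LInfLoc univ (truncate w b) := by
    intro i
    induction i with
    | zero =>
      intro b _ hb0
      rw [hτ.zero] at hb0
      exact ⟨(LInfLoc.const 0).congr fun t ht => if_neg (not_lt.2 (hb0.trans ht)),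
        (LInfLoc.const 0).congr fun t ht => if_neg (not_lt.2 (hb0.trans ht))⟩
    | succ i ih =>
      intro b hbT hb
      rcases le_or_gt b (τ i) with hbi | hbi
      · exact ih b hbT hbi
      obtain ⟨hui, hwi⟩ := ih (τ i) (hbi.le.trans hbT) le_rfl
      have hτi := hτ.nonneg i
      set u₀ := kf (Ψ (hist r z (τ i))) with hu₀
      have hfb : ∀ t ∈ Ico (τ i) b, u t = u₀ := fun t ht =>
        hs.feedback i t ⟨⟨hτi.trans ht.1, ht.2.trans_le hbT⟩, ht.1, ht.2.trans_le hb⟩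
      have hub : LInfLoc univ (truncate u b) :=
        hui.truncate_extend (continuousOn_const.congr hfb) (B := ‖u₀‖) fun t ht => by
          rw [hfb t ht]
      refine ⟨hub, ?_⟩
      have hlen : (τ (i + 1) - τ i) * (L * γ) ≤ 1 / 2 := by
        refine le_trans ?_ hδ
        have := hτ.le i
        have := S.observer.γ_pos
        gcongr
      obtain ⟨B, -, hB⟩ := S.exists_predictor_bound hL hR hub hwi z₀ hτi
        (hτ.strictMono (Nat.lt_succ_self i)).le hlen u₀ (h (hist r x (τ i)) + ξ (τ i))
      refine hwi.truncate_extend (hs.continuousOn_signal hτ hb hbT) (B := B) fun t ht => ?_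
      -- A priori `w` might blow up at `b`. Cut off at `c < b`, it is an admissible signal, and the
      -- bound `B` does not depend on `c`.
      obtain ⟨c, htc, hcb⟩ := exists_between ht.2
      have hic : τ i < c := ht.1.trans_lt htc
      have hwc : LInfLoc univ (truncate w c) := by
        obtain ⟨B', hB'⟩ := isCompact_Icc.exists_bound_of_continuousOn
          ((hs.continuousOn_signal hτ hb hbT).mono (Icc_subset_Ico_right hcb))
        exact hwi.truncate_extend (hs.continuousOn_signal hτ (hcb.le.trans hb) (hcb.le.trans hbT))
          (B := B') fun s hs' => hB' s (Ico_subset_Icc_self hs')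
      obtain ⟨z', hz'⟩ := S.exists_observer hub hwc z₀
      have hzc : IsDelaySol r (fun t φ => F φ (truncate w c t) (truncate u b t)) z₀ (Ico 0 c) z :=
        (hs.observer.mono (Ico_subset_Ico_right (hcb.le.trans hbT))).congr_rhs fun s hs' => by
          rw [truncate_of_lt hs'.2, truncate_of_lt (hs'.2.trans hcb)]
      have hzz := S.observer_eqOn hub hwc hzc (hz'.mono Ico_subset_Ici_self)
      have hw_t := hB (truncate w c) z' t hwc hz' ⟨ht.1, ht.2.le.trans hb⟩
        (fun s hs' => by
          rw [truncate_of_lt (hs'.2.trans hic), truncate_of_lt hs'.2])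
        (fun s hs' C hC hle => by
          have hsc : s < c := hs'.2.trans_lt htc
          rw [truncate_of_lt hsc, hs.predictor_eq S hτ ⟨hs'.1, (hsc.trans hcb).trans_le hb⟩
            ((hsc.trans hcb).trans_le hbT)]
          refine (norm_add_le _ _).trans (add_le_add le_rfl ?_)
          refine (intervalIntegral.norm_integral_le_of_norm_le_const (C := C)
            fun y hy => ?_).trans ?_
          · rw [uIoc_of_le hs'.1] at hy
            rw [ObserverLoop.hist_eq_of_eqOn hs.observer hz' hzz
              ⟨hτi.trans hy.1.le, hy.2.trans_lt hsc⟩]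
            exact hle y ⟨hy.1.le, hy.2⟩
          · rw [abs_of_nonneg (by linarith [hs'.1]), mul_comm]
            gcongr
            exact hsc.le.trans (hcb.le.trans hb)) t ⟨ht.1, le_rfl⟩
      rw [truncate_of_lt htc] at hw_t
      exact hw_t.1
  obtain ⟨i, hi⟩ := hτ.exists_lt T
  exact key i T le_rfl hi.le

/-- Every closed-loop solution on `[0, T)` stems from global solutions of plant and observer. -/
theorem exists_loopUpTo (S : ObserverLoop r D f h R F Ψ kf σ γ g a) {L : ℝ} (hL : 0 ≤ L)
    (hR : ∀ x x' u, ‖R x' u 0 - R x u 0‖ ≤ L * ‖x' - x‖) (hτ : IsSampling τ δ)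
    (hδ : δ * (L * γ) ≤ 1 / 2) (hd : LInfLoc D d) {T : ℝ}
    (hs : IsClosedLoopSol r f h R F Ψ kf τ d ξ x₀ z₀ (Ico 0 T) x z w u) :
    ∃ x' z' w' u', LoopUpTo r f h R F Ψ kf τ d ξ x₀ z₀ T x' z' w' u' ∧
      EqOn x x' (Ico 0 T) ∧ EqOn z z' (Ico 0 T) ∧ EqOn w w' (Ico 0 T) ∧ EqOn u u' (Ico 0 T) := by
  obtain ⟨hu, hw⟩ := hs.linfLoc_truncate S hL hR hτ hδ
  obtain ⟨x', hx'⟩ := S.exists_plant hu hd x₀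
  obtain ⟨z', hz'⟩ := S.exists_observer hu hw z₀
  have hxx : EqOn x x' (Ico 0 T) := S.plant_eqOn hu hd
    (hs.plant.congr_rhs fun t ht => by rw [truncate_of_lt ht.2])
    (IsDelaySol.mono hx' Ico_subset_Ici_self)
  have hzz : EqOn z z' (Ico 0 T) := S.observer_eqOn hu hw
    (hs.observer.congr_rhs fun t ht => by rw [truncate_of_lt ht.2, truncate_of_lt ht.2])
    (hz'.mono Ico_subset_Ici_self)
  have hhx : ∀ t ∈ Ico 0 T, hist r x t = hist r x' t := fun t ht =>
    ObserverLoop.hist_eq_of_eqOn hs.plant hx' hxx ht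
  have hhz : ∀ t ∈ Ico 0 T, hist r z t = hist r z' t := fun t ht =>
    ObserverLoop.hist_eq_of_eqOn hs.observer hz' hzz ht
  refine ⟨x', z', _, _, ⟨hu, hw, hx', hz', fun i t ht htT => ?_, fun i t ht htT => ?_⟩, hxx, hzz,
    fun t ht => (truncate_of_lt ht.2).symm, fun t ht => (truncate_of_lt ht.2).symm⟩
  · have hi : τ i ∈ Ico 0 T := ⟨hτ.nonneg i, ht.1.trans_lt htT⟩
    rw [truncate_of_lt htT, ← hhz _ hi]
    exact hs.feedback i t ⟨⟨hi.1.trans ht.1, htT⟩, ht⟩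
  · have hi : τ i ∈ Ico 0 T := ⟨hτ.nonneg i, ht.1.trans_lt htT⟩
    rw [truncate_of_lt htT, ← hhz _ hi, ← hhx _ hi, hs.predictor_eq S hτ ht htT]
    congr 1
    refine intervalIntegral.integral_congr fun s hs' => ?_
    rw [uIcc_of_le ht.1] at hs'
    simp only [hhz s ⟨hi.1.trans hs'.1, hs'.2.trans_lt htT⟩]

/-- Along a closed-loop solution on `[0, ∞)` the input and the predictor are locally bounded and
measurable. -/
theorem linfLoc (S : ObserverLoop r D f h R F Ψ kf σ γ g a) {L : ℝ} (hL : 0 ≤ L)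
    (hR : ∀ x x' u, ‖R x' u 0 - R x u 0‖ ≤ L * ‖x' - x‖) (hτ : IsSampling τ δ)
    (hδ : δ * (L * γ) ≤ 1 / 2)
    (hs : IsClosedLoopSol r f h R F Ψ kf τ d ξ x₀ z₀ (Ici 0) x z w u) :
    LInfLoc univ u ∧ LInfLoc univ w :=
  ⟨.of_truncate fun _ => ((hs.mono Ico_subset_Ici_self).linfLoc_truncate S hL hR hτ hδ).1,
    .of_truncate fun _ => ((hs.mono Ico_subset_Ici_self).linfLoc_truncate S hL hR hτ hδ).2⟩

end IsClosedLoopSol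

/-- Existence of closed-loop solutions on `[0, ∞)`. -/
theorem ObserverLoop.exists_closedLoopSol (S : ObserverLoop r D f h R F Ψ kf σ γ g a) {L : ℝ}
    (hL : 0 ≤ L) (hR : ∀ x x' u, ‖R x' u 0 - R x u 0‖ ≤ L * ‖x' - x‖) (hτ : IsSampling τ δ)
    (hδ : δ * (L * γ) ≤ 1 / 2) (hd : LInfLoc D d) :
    ∃ x z w u, IsClosedLoopSol r f h R F Ψ kf τ d ξ x₀ z₀ (Ici 0) x z w u := by
  have h0 : LInfLoc univ fun _ : ℝ => (0 : Vec m) := .const 0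
  have h0' : LInfLoc univ fun _ : ℝ => (0 : Vec k) := .const 0
  obtain ⟨x, hx⟩ := S.exists_plant h0 hd x₀
  obtain ⟨z, hz⟩ := S.exists_observer h0 h0' z₀
  have hs : LoopUpTo r f h R F Ψ kf τ d ξ x₀ z₀ 0 x z _ _ := ⟨h0, h0', hx, hz,
    fun i t ht h1 => absurd ((hτ.nonneg i).trans ht.1) (not_le.2 h1),
    fun i t ht h1 => absurd ((hτ.nonneg i).trans ht.1) (not_le.2 h1)⟩
  obtain ⟨x', z', w', u', hs', -⟩ := hs.extend S hL hR hτ hδ hd le_rfl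
  exact ⟨x', z', w', u', LoopUpTo.isClosedLoopSol S hτ hs'⟩

/-- Closed-loop solutions on `[0, T)` extend to `[0, ∞)`. -/
theorem IsClosedLoopSol.exists_extension (S : ObserverLoop r D f h R F Ψ kf σ γ g a) {L : ℝ}
    (hL : 0 ≤ L) (hR : ∀ x x' u, ‖R x' u 0 - R x u 0‖ ≤ L * ‖x' - x‖) (hτ : IsSampling τ δ)
    (hδ : δ * (L * γ) ≤ 1 / 2) (hd : LInfLoc D d) {T : ℝ} (hT : 0 ≤ T)
    {x : ℝ → Vec n} {z : ℝ → Vec l} {w : ℝ → Vec k} {u : ℝ → Vec m}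
    (hs : IsClosedLoopSol r f h R F Ψ kf τ d ξ x₀ z₀ (Ico 0 T) x z w u) :
    ∃ x' z' w' u', IsClosedLoopSol r f h R F Ψ kf τ d ξ x₀ z₀ (Ici 0) x' z' w' u' ∧
      ∀ t ∈ Ico 0 T, x' t = x t ∧ z' t = z t ∧ w' t = w t ∧ u' t = u t := by
  obtain ⟨x₁, z₁, w₁, u₁, h₁, ex, ez, ew, eu⟩ := hs.exists_loopUpTo S hL hR hτ hδ hd
  obtain ⟨x₂, z₂, w₂, u₂, h₂, ex', ez', ew', eu'⟩ := h₁.extend S hL hR hτ hδ hd hT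
  exact ⟨x₂, z₂, w₂, u₂, LoopUpTo.isClosedLoopSol S hτ h₂, fun t ht =>
    ⟨((ex ht).trans (ex' ht)).symm, ((ez ht).trans (ez' ht)).symm, ((ew ht).trans (ew' ht)).symm,
      ((eu ht).trans (eu' ht)).symm⟩⟩

end ClosedLoop

/-! ### Sampled-data stabilization with perturbed input -/

section Stabilization

variable {r : ℝ≥0} {n m q : ℕ} {D : Set (Vec q)} {f : Hist r n → Vec m → Vec q → Vec n}
  {kf : Hist r n → Vec m} {Lb : ℝ} {kb : ℝ → ℝ}

theorem norm_nominal_sub_le (hLb : 0 < Lb)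
    (hlip : ∀ (x x' : Hist r n) (u u' : Vec m),
      ‖kf x' - kf x‖ + ‖f x' u' 0 - f x u 0‖ ≤ Lb * ‖x' - x‖ + Lb * ‖u' - u‖) (x x' : Hist r n) :
    ‖f x' (kf x') 0 - f x (kf x) 0‖ ≤ (Lb + Lb ^ 2) * ‖x' - x‖ := by
  have h1 := hlip x x' (kf x) (kf x')
  have h2 := hlip x x' 0 0
  rw [sub_self, norm_zero, mul_zero, add_zero] at h2
  have h3 := norm_nonneg (f x' 0 0 - f x 0 0)
  have h4 := norm_nonneg (kf x' - kf x)
  have h5 : Lb * ‖kf x' - kf x‖ ≤ Lb * (Lb * ‖x' - x‖) := by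
    gcongr
    linarith
  linarith

/-- Over a time `T`, a perturbed trajectory stays close to the nominal one with the same initial
condition. -/
theorem exists_perturbation_bound (hLb : 0 < Lb)
    (hlip : ∀ (x x' : Hist r n) (u u' : Vec m),
      ‖kf x' - kf x‖ + ‖f x' u' 0 - f x u 0‖ ≤ Lb * ‖x' - x‖ + Lb * ‖u' - u‖) {σ₀ M : ℝ}
    (hst : ∀ x₀ : Hist r n,
      (∃ x : ℝ → Vec n, IsDelaySol r (fun _ φ => f φ (kf φ) 0) x₀ (Ici 0) x) ∧
      ∀ x : ℝ → Vec n, IsDelaySol r (fun _ φ => f φ (kf φ) 0) x₀ (Ici 0) x →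
        ∀ t : ℝ, 0 ≤ t → ‖hist r x t‖ ≤ M * Real.exp (-σ₀ * t) * ‖x₀‖) {T : ℝ} (hT : 0 ≤ T) :
    ∃ C, 0 < C ∧ ∀ (x₀ : Hist r n) (u : ℝ → Vec m) (d : ℝ → Vec q) (x : ℝ → Vec n) (c ν : ℝ),
      IsPlantSol r f u d x₀ x → 0 ≤ c → 0 ≤ ν →
      (∀ s ∈ Icc c (c + T),
        ‖f (hist r x s) (u s) (d s) - f (hist r x s) (kf (hist r x s)) 0‖ ≤ ν) →
      ‖hist r x (c + T)‖ ≤ M * Real.exp (-σ₀ * T) * ‖hist r x c‖ + C * ν := by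
  set A := Lb + Lb ^ 2 + 1 with hA
  have hA0 : 0 < A := by positivity
  refine ⟨4 * (T + 1) * Real.exp (4 * A * T), by positivity, fun x₀ u d x c ν hx hc hν hpert => ?_⟩
  -- Gronwall gives the factor `T`; using `T + 1` makes `K ≥ 1`, so that `K ≤ K²` and no square root
  -- appears.
  set K := 4 * (T + 1) * Real.exp (4 * A * T) with hK
  have hK1 : 1 ≤ K := by
    have : 1 ≤ Real.exp (4 * A * T) := Real.one_le_exp (by positivity)
    nlinarith
  -- The nominal trajectory restarted from the state reached at time `c`.
  obtain ⟨⟨y, hy⟩, hdec⟩ := hst (hist r x c)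
  have hdec := hdec y hy T hT
  have hr : (0 : ℝ) ≤ r := r.2
  have hxs : ContinuousOn (fun s => x (c + s)) (Ici (-(r : ℝ))) :=
    (IsDelaySol.continuousOn_Ici hx).comp (by fun_prop) fun s hs => by
      rw [mem_Ici] at hs ⊢
      linarith
  have hwin : ∀ t : ℝ, 0 ≤ t → Icc (t - r) t ⊆ Ici (-(r : ℝ)) := fun t ht s hs => by
    have := hs.1
    rw [mem_Ici]
    linarith
  have hinit : ∀ s ∈ Icc (-(r : ℝ)) 0, ‖x (c + s) - y s‖ ≤ 0 := by
    intro s hs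
    have h1 := hy.history_eq ⟨s, hs⟩
    rw [hist_apply r (IsDelaySol.continuousOn_window hx hc)] at h1
    rw [h1, sub_self, norm_zero]
  have h00 : (0 : ℝ) ∈ Ici (0 : ℝ) := mem_Ici.2 le_rfl
  have hAC : AbsolutelyContinuousOnInterval (fun s => x (c + s) - y s) 0 T := by
    refine AbsolutelyContinuousOnInterval.fun_sub (f := fun s => x (c + s))
      (AbsolutelyContinuousOnInterval.comp_const_add ?_) (hy.locallyAC 0 h00 T hT hT)
    exact IsDelaySol.locallyAC hx _ (by rw [add_zero]; exact hc) _ (add_nonneg hc hT) (by linarith)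
  have hshift : ∀ᵐ s ∂(volume : Measure ℝ), c + s ∈ Ici (0 : ℝ) →
      HasDerivAt x (f (hist r x (c + s)) (u (c + s)) (d (c + s))) (c + s) :=
    (measurePreserving_add_left volume c).quasiMeasurePreserving.ae
      (IsDelaySol.deriv_eq hx)
  have hest := sq_norm_le_of_inner_le (a₀ := -(r : ℝ)) (A := A) (β := ν) (ε := 0) hT hA0 hAC hinit
    (by linarith) (by
      filter_upwards [hshift, hy.deriv_eq] with t ht ht' htm
      have ht0 : 0 ≤ t := htm.1.le
      have hct : c + t ∈ Ici (0 : ℝ) := add_nonneg hc ht0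
      refine ⟨_, ((ht hct).comp_const_add c t).sub (ht' ht0), fun N hN => ?_⟩
      have hN0 : 0 ≤ N := (norm_nonneg _).trans (hN t ⟨by linarith, le_rfl⟩)
      have hNt := hN t ⟨by linarith, le_rfl⟩
      have h1 := norm_nominal_sub_le hLb hlip (hist r y t) (hist r x (c + t))
      rw [← hist_comp_const_add x c t, ← hist_sub (hxs.mono (hwin t ht0))
        (hy.continuousOn_Ici.mono (hwin t ht0))] at h1
      have h2 : ‖hist r (fun s => x (c + s) - y s) t‖ ≤ N :=
        norm_hist_le hN0 fun s hs => hN s ⟨hwin t ht0 hs, hs.2⟩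
      have h3 := hpert (c + t) ⟨by linarith, by linarith [htm.2]⟩
      rw [← hist_comp_const_add x c t] at h3 ⊢
      set X := hist r (fun s => x (c + s)) t
      have h4 : ‖f X (u (c + t)) (d (c + t)) - f (hist r y t) (kf (hist r y t)) 0‖ ≤
          ν + (Lb + Lb ^ 2) * N := by
        have e : f X (u (c + t)) (d (c + t)) - f (hist r y t) (kf (hist r y t)) 0 =
            (f X (u (c + t)) (d (c + t)) - f X (kf X) 0) +
            (f X (kf X) 0 - f (hist r y t) (kf (hist r y t)) 0) := by abel
        rw [e]
        refine (norm_add_le _ _).trans (add_le_add h3 (h1.trans ?_))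
        gcongr
      refine (real_inner_le_norm _ _).trans ?_
      have h5 := mul_le_mul hNt h4 (norm_nonneg _) hN0
      refine h5.trans ?_
      nlinarith [sq_nonneg (N - ν), sq_nonneg N, sq_nonneg ν])
  have hclose : ∀ t ∈ Icc 0 T, ‖x (c + t) - y t‖ ≤ K * ν := by
    intro t ht
    refine abs_le_of_sq_le_sq' ?_ (by positivity) |>.2
    calc ‖x (c + t) - y t‖ ^ 2 ≤ 4 * T * Real.exp (4 * A * T) * ν ^ 2 := by
          refine (hest t ht).trans (le_of_eq ?_)
          rw [sub_zero]
          ring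
      _ ≤ K * ν ^ 2 := by
          rw [hK]
          gcongr
          linarith
      _ ≤ K * K * ν ^ 2 := by
          have : K ≤ K * K := le_mul_of_one_le_left (by positivity) hK1
          gcongr
      _ = (K * ν) ^ 2 := by ring
  have hKν : 0 ≤ K * ν := by positivity
  have hd : ‖hist r x (c + T) - hist r y T‖ ≤ K * ν := by
    rw [← hist_comp_const_add x c T]
    refine norm_hist_sub_le (hxs.mono (hwin T hT)) (hy.continuousOn_Ici.mono (hwin T hT)) hKν
      fun θ hθ => ?_
    rcases le_total (T + θ) 0 with h1 | h1
    · exact (hinit _ ⟨by linarith [hθ.1], h1⟩).trans hKν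
    · exact hclose _ ⟨h1, by linarith [hθ.2]⟩
  have h6 := norm_le_norm_add_norm_sub' (hist r x (c + T)) (hist r y T)
  linarith

/-- Bound on the velocity of the sampled-data closed loop. -/
theorem norm_velocity_le (hLb : 0 < Lb) (hf0 : f 0 0 0 = 0) (hkf0 : kf 0 = 0)
    (hlip : ∀ (x x' : Hist r n) (u u' : Vec m),
      ‖kf x' - kf x‖ + ‖f x' u' 0 - f x u 0‖ ≤ Lb * ‖x' - x‖ + Lb * ‖u' - u‖)
    (hdist : ∀ (x : Hist r n) (u : Vec m), ∀ d ∈ D, ‖f x u d - f x u 0‖ ≤ kb ‖d‖)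
    {φ φ' : Hist r n} {v : Vec m} {y : Vec q} {N η ρ : ℝ} (hφ : ‖φ‖ ≤ N) (hφ' : ‖φ'‖ ≤ N)
    (hv : ‖v - kf φ'‖ ≤ η) (hy : y ∈ D) (hρ : kb ‖y‖ ≤ ρ) :
    ‖f φ v y‖ ≤ (Lb + Lb ^ 2) * N + Lb * η + ρ := by
  have h1 := hlip 0 φ 0 v
  rw [hf0, hkf0] at h1
  simp only [sub_zero] at h1
  have h2 := hlip 0 φ' 0 0
  rw [hf0, hkf0] at h2
  simp only [sub_zero, norm_zero, mul_zero, add_zero] at h2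
  have h3 := (hdist φ v y hy).trans hρ
  have h4 := norm_le_norm_add_norm_sub' v (kf φ')
  have h5 := norm_le_norm_add_norm_sub' (f φ v y) (f φ v 0)
  have h6 : ‖kf φ'‖ ≤ Lb * N := by
    have : Lb * ‖φ'‖ ≤ Lb * N := by gcongr
    linarith [norm_nonneg (f φ' 0 0)]
  have h7 : Lb * ‖φ‖ ≤ Lb * N := by gcongr
  have h8 : Lb * ‖v‖ ≤ Lb * (Lb * N + η) := by
    gcongr
    linarith
  linarith [norm_nonneg (kf φ)]

/-- Growth of the perturbed sampled-data closed loop on a bounded time interval. -/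
theorem exists_growth_bound (hLb : 0 < Lb) (hf0 : f 0 0 0 = 0) (hkf0 : kf 0 = 0)
    (hlip : ∀ (x x' : Hist r n) (u u' : Vec m),
      ‖kf x' - kf x‖ + ‖f x' u' 0 - f x u 0‖ ≤ Lb * ‖x' - x‖ + Lb * ‖u' - u‖)
    (hdist : ∀ (x : Hist r n) (u : Vec m), ∀ d ∈ D, ‖f x u d - f x u 0‖ ≤ kb ‖d‖)
    {T₁ : ℝ} (hT₁0 : 0 ≤ T₁) :
    ∃ C, 1 ≤ C ∧ ∀ (τ : ℕ → ℝ) (δ : ℝ), IsSampling τ δ → ∀ (x₀ : Hist r n) (u : ℝ → Vec m)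
      (d : ℝ → Vec q) (x : ℝ → Vec n) (t₂ η ρ : ℝ), (∀ t, 0 ≤ t → d t ∈ D) →
      IsPlantSol r f u d x₀ x → 0 ≤ t₂ → t₂ ≤ T₁ → 0 ≤ η → 0 ≤ ρ →
      (∀ i, ∀ t ∈ Ico (τ i) (τ (i + 1)), t ≤ t₂ → ‖u t - kf (hist r x (τ i))‖ ≤ η) →
      (∀ t ∈ Icc 0 t₂, kb ‖d t‖ ≤ ρ) →
      ‖hist r x t₂‖ ≤ C * (‖x₀‖ + (Lb * η + ρ)) := by
  have hr : (0 : ℝ) ≤ r := r.2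
  set A := Lb + Lb ^ 2 + 1 with hA
  have hA0 : 0 < A := by positivity
  set C₂ := 2 * (1 + 2 * A * T₁ + 2 * T₁) * Real.exp (4 * A * T₁) with hC₂
  have hC₂1 : 1 ≤ C₂ := by
    have h1 : 1 ≤ Real.exp (4 * A * T₁) := Real.one_le_exp (by positivity)
    have h2 : 0 ≤ 2 * A * T₁ := by positivity
    nlinarith
  refine ⟨C₂, hC₂1, fun τ δ hτ x₀ u d x t₂ η ρ hd hx ht₂ ht₂T hη0 hρ hu hkb => ?_⟩
  have hwin : ∀ t : ℝ, 0 ≤ t → Icc (t - r) t ⊆ Ici (-(r : ℝ)) := fun t ht s hs => by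
    have := hs.1
    rw [mem_Ici]
    linarith
  have hinit : ∀ s ∈ Icc (-(r : ℝ)) 0, ‖x s‖ ≤ ‖x₀‖ := fun s hs => by
    have h1 := IsDelaySol.history_eq hx ⟨s, hs⟩
    simp only at h1
    rw [h1]
    exact x₀.norm_coe_le_norm _
  set β := Lb * η + ρ with hβ
  have hβ0 : 0 ≤ β := by positivity
  have h00 : (0 : ℝ) ∈ Ici (0 : ℝ) := mem_Ici.2 le_rfl
  have hest := sq_norm_le_of_inner_le (a₀ := -(r : ℝ)) (A := A) (β := β) (ε := ‖x₀‖) ht₂ hA0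
    (IsDelaySol.locallyAC hx 0 h00 t₂ ht₂ ht₂) hinit (by linarith) (by
      filter_upwards [IsDelaySol.deriv_eq hx] with t ht htm
      have ht0 : 0 ≤ t := htm.1.le
      have htb : t ≤ t₂ := htm.2.le
      refine ⟨_, ht ht0, fun N hN => ?_⟩
      have hNt := hN t ⟨by linarith, le_rfl⟩
      have hN0 : 0 ≤ N := (norm_nonneg _).trans hNt
      -- The input depends on the state at `τ_i ≤ t`; the running supremum in the Gronwall estimate
      -- covers this extra delay.
      obtain ⟨i, hi⟩ := hτ.exists_mem_Ico ht0
      have hhist : ∀ s, 0 ≤ s → s ≤ t → ‖hist r x s‖ ≤ N := fun s hs hst' =>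
        norm_hist_le hN0 fun y hy => hN y ⟨hwin s hs hy, hy.2.trans hst'⟩
      have hvel := norm_velocity_le hLb hf0 hkf0 hlip hdist (hhist t ht0 le_rfl)
        (hhist (τ i) (hτ.nonneg i) hi.1) (hu i t hi htb) (hd t ht0) (hkb t ⟨ht0, htb⟩)
      refine (real_inner_le_norm _ _).trans ((mul_le_mul hNt hvel (norm_nonneg _) hN0).trans ?_)
      nlinarith [sq_nonneg (N - β), sq_nonneg N, sq_nonneg β])
  have hpt : ∀ t ∈ Icc 0 t₂, ‖x t‖ ≤ C₂ * (‖x₀‖ + β) := by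
    intro t ht
    refine abs_le_of_sq_le_sq' ?_ (by positivity) |>.2
    have hX := norm_nonneg x₀
    calc ‖x t‖ ^ 2 ≤ 2 * (‖x₀‖ ^ 2 * (1 + 2 * A * (t₂ - 0)) + 2 * β ^ 2 * (t₂ - 0)) *
          Real.exp (4 * A * (t₂ - 0)) := hest t ht
      _ ≤ 2 * (‖x₀‖ ^ 2 * (1 + 2 * A * T₁) + 2 * β ^ 2 * T₁) * Real.exp (4 * A * T₁) := by
          rw [sub_zero]
          gcongr
      _ ≤ C₂ * (‖x₀‖ + β) ^ 2 := by
          have h1 : ‖x₀‖ ^ 2 * (1 + 2 * A * T₁) + 2 * β ^ 2 * T₁ ≤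
              (1 + 2 * A * T₁ + 2 * T₁) * (‖x₀‖ + β) ^ 2 := by
            have h2 : ‖x₀‖ ^ 2 ≤ (‖x₀‖ + β) ^ 2 := by
              gcongr
              linarith
            have h3 : β ^ 2 ≤ (‖x₀‖ + β) ^ 2 := by
              gcongr
              linarith
            have h4 : ‖x₀‖ ^ 2 * (1 + 2 * A * T₁) ≤ (‖x₀‖ + β) ^ 2 * (1 + 2 * A * T₁) := by
              gcongr
            have h5 : 2 * β ^ 2 * T₁ ≤ 2 * (‖x₀‖ + β) ^ 2 * T₁ := by gcongr
            linarith
          calc _ ≤ 2 * ((1 + 2 * A * T₁ + 2 * T₁) * (‖x₀‖ + β) ^ 2) *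
                Real.exp (4 * A * T₁) := by gcongr
            _ = _ := by rw [hC₂]; ring
      _ ≤ C₂ * C₂ * (‖x₀‖ + β) ^ 2 := by
          have : C₂ ≤ C₂ * C₂ := le_mul_of_one_le_left (by positivity) hC₂1
          gcongr
      _ = (C₂ * (‖x₀‖ + β)) ^ 2 := by ring
  refine norm_hist_le (by positivity) fun s hs => ?_
  rcases le_total s 0 with h1 | h1
  · refine (hinit s ⟨hwin t₂ ht₂ hs, h1⟩).trans ?_
    have : ‖x₀‖ + β ≤ C₂ * (‖x₀‖ + β) := le_mul_of_one_le_left (by positivity) hC₂1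
    linarith
  · exact hpt s ⟨h1, hs.2⟩

/-- The effect of sampling on the velocity, in terms of bounds over a preceding time window. -/
theorem norm_sampling_mismatch_le (hLb : 0 < Lb) (hf0 : f 0 0 0 = 0) (hkf0 : kf 0 = 0)
    (hlip : ∀ (x x' : Hist r n) (u u' : Vec m),
      ‖kf x' - kf x‖ + ‖f x' u' 0 - f x u 0‖ ≤ Lb * ‖x' - x‖ + Lb * ‖u' - u‖)
    (hdist : ∀ (x : Hist r n) (u : Vec m), ∀ d ∈ D, ‖f x u d - f x u 0‖ ≤ kb ‖d‖)
    {τ : ℕ → ℝ} {δ : ℝ} (hτ : IsSampling τ δ) (hδ1 : δ ≤ 1) {x₀ : Hist r n} {u : ℝ → Vec m}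
    {d : ℝ → Vec q} {x : ℝ → Vec n} {t T T₁ N η ρ : ℝ} (hd : ∀ t, 0 ≤ t → d t ∈ D)
    (hx : IsPlantSol r f u d x₀ x) (hT₁ : T₁ = T + r + 2) (htT : T₁ < t)
    (hN0 : 0 ≤ N) (hη0 : 0 ≤ η) (hρ : 0 ≤ ρ)
    (hNle : ∀ s, t - T₁ ≤ s → s ≤ t → ‖hist r x s‖ ≤ N)
    (huη : ∀ i, ∀ s ∈ Ico (τ i) (τ (i + 1)), t - T₁ ≤ s → s ≤ t →
      ‖u s - kf (hist r x (τ i))‖ ≤ η)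
    (hkb : ∀ t' ∈ Icc 0 t, kb ‖d t'‖ ≤ ρ) :
    ∀ s ∈ Icc (t - T) t,
      ‖f (hist r x s) (u s) (d s) - f (hist r x s) (kf (hist r x s)) 0‖ ≤
        ρ + Lb * (η + Lb * (((Lb + Lb ^ 2) * N + Lb * η + ρ) * δ)) := by
  have hr : (0 : ℝ) ≤ r := r.2
  have hδ0 : 0 < δ := (hτ.pos 0).trans_le (hτ.le 0)
  have hxc : ContinuousOn x (Ici (-(r : ℝ))) := IsDelaySol.continuousOn_Ici hx
  have hwin : ∀ t : ℝ, 0 ≤ t → Icc (t - r) t ⊆ Ici (-(r : ℝ)) := fun t ht s hs => by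
    have := hs.1
    rw [mem_Ici]
    linarith
  set V := (Lb + Lb ^ 2) * N + Lb * η + ρ with hV
  have hV0 : 0 ≤ V := by positivity
  have hτs : ∀ i, ∀ s ∈ Ico (τ i) (τ (i + 1)), s - δ ≤ τ i := fun i s hs => by
    linarith [hτ.le i, hs.2]
  -- Length of the window `T₁ = T + r + 2`: `T` for the comparison, `1` to reach the last sampling
  -- time, `r` for its history, and `1` more for the sampling time that governs the velocity there.
  have hvel : ∀ s, t - T₁ + 1 ≤ s → s ≤ t → ‖f (hist r x s) (u s) (d s)‖ ≤ V := by
    intro s hs hst'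
    have hs0 : 0 ≤ s := by linarith
    obtain ⟨i, hi⟩ := hτ.exists_mem_Ico hs0
    have := hτs i s hi
    exact norm_velocity_le hLb hf0 hkf0 hlip hdist (hNle s (by linarith) hst')
      (hNle (τ i) (by linarith) (hi.1.trans hst')) (huη i s hi (by linarith) hst') (hd s hs0)
      (hkb s ⟨hs0, hst'⟩)
  intro s hs
  have hst' : s ≤ t := by linarith [hs.2]
  have hs0 : 0 ≤ s := by linarith [hs.1]
  obtain ⟨i, hi⟩ := hτ.exists_mem_Ico hs0
  have hsi := hτs i s hi
  have h1 : ‖hist r x (τ i) - hist r x s‖ ≤ V * δ := by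
    refine norm_hist_sub_le (hxc.mono (hwin _ (hτ.nonneg i))) (hxc.mono (hwin _ hs0))
      (by positivity) fun θ hθ => ?_
    have hlow : t - T₁ + 1 ≤ τ i + θ := by linarith [hθ.1, hs.1]
    have hAC := IsDelaySol.locallyAC hx (τ i + θ) (mem_Ici.2 (by linarith)) (s + θ)
      (mem_Ici.2 (by linarith [hi.1])) (by linarith [hi.1])
    have h2 := hAC.norm_sub_le_of_norm_deriv_le (C := V) (by linarith [hi.1]) (by
      filter_upwards [IsDelaySol.deriv_eq hx] with y hy hym
      refine ⟨_, hy (mem_Ici.2 (by linarith [hym.1])), hvel y (by linarith [hym.1]) ?_⟩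
      linarith [hym.2, hθ.2])
    rw [norm_sub_rev]
    refine h2.trans ?_
    gcongr
    linarith
  have h3 := hlip (hist r x s) (hist r x (τ i)) 0 0
  rw [sub_self, norm_zero, mul_zero, add_zero] at h3
  have h4 : ‖kf (hist r x (τ i)) - kf (hist r x s)‖ ≤ Lb * (V * δ) := by
    have : Lb * ‖hist r x (τ i) - hist r x s‖ ≤ Lb * (V * δ) := by gcongr
    linarith [norm_nonneg (f (hist r x (τ i)) 0 0 - f (hist r x s) 0 0)]
  have h5 := huη i s hi (by linarith [hs.1]) hst'
  have h6 : ‖u s - kf (hist r x s)‖ ≤ η + Lb * (V * δ) := by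
    have := norm_sub_le_norm_sub_add_norm_sub (u s) (kf (hist r x (τ i))) (kf (hist r x s))
    linarith
  have h7 := hlip (hist r x s) (hist r x s) (kf (hist r x s)) (u s)
  rw [sub_self, sub_self, norm_zero, norm_zero, mul_zero, zero_add, zero_add] at h7
  have h8 := (hdist (hist r x s) (u s) (d s) (hd s hs0)).trans
    (hkb s ⟨hs0, hst'⟩)
  have h9 := norm_sub_le_norm_sub_add_norm_sub (f (hist r x s) (u s) (d s))
    (f (hist r x s) (u s) 0) (f (hist r x s) (kf (hist r x s)) 0)
  have h10 : Lb * ‖u s - kf (hist r x s)‖ ≤ Lb * (η + Lb * (V * δ)) := by gcongr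
  linarith

/-- The arithmetic for times up to `T₁`. Here `e`, `eb`, `E` stand for `exp(-ωt)`, `exp(ωb)`,
`exp(ωT₁)`. -/
theorem initial_growth_absorb {Lb C Q E A₀ ρ X e eb : ℝ} (hLb : 0 < Lb) (hC : 0 ≤ C)
    (hCQ : C * (Lb + 1) ≤ Q) (hA₀ : 0 ≤ A₀) (hρ : 0 ≤ ρ) (hX : 0 ≤ X) (hEe : 1 ≤ E * e)
    (hρe : ρ ≤ ρ * eb * e) :
    C * (X + (Lb * (A₀ + ρ) + ρ)) ≤ (Q * E * (X + A₀) + Q * ρ * eb) * e := by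
  have hQ0 : 0 ≤ Q := le_trans (by positivity) hCQ
  have h6 : C * (X + (Lb * (A₀ + ρ) + ρ)) ≤ C * (Lb + 1) * (X + A₀ + ρ) := by
    have h7 : 0 ≤ C * (Lb * X + A₀) := by positivity
    nlinarith
  have h8 : C * (Lb + 1) * (X + A₀ + ρ) ≤ Q * (X + A₀ + ρ) := by gcongr
  have h9 : Q * (X + A₀) ≤ Q * (X + A₀) * (E * e) := le_mul_of_one_le_right (by positivity) hEe
  have h10 : Q * ρ ≤ Q * (ρ * eb * e) := by gcongr
  linarith

/-- The arithmetic for times beyond `T₁`. The only term in `μ` carries a factor `δ`, and smallness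
of `δ` reduces its coefficient to `1 / 4`. -/
theorem sampling_mismatch_absorb {Lb C Q E A₀ ρ X e eb δ μ : ℝ} (hLb : 0 < Lb) (hC : 0 < C)
    (hCQ : C * (Lb ^ 3 + Lb ^ 2 + Lb + 1) ≤ Q) (hA₀ : 0 ≤ A₀) (hρ : 0 ≤ ρ) (hX : 0 ≤ X)
    (he : 0 < e) (hE : 0 ≤ E) (hρe : ρ ≤ ρ * eb * e) (hμ : 0 ≤ μ) (hδ0 : 0 ≤ δ) (hδ1 : δ ≤ 1)
    (hδ : C * (Lb * (Lb * δ * (Lb + Lb ^ 2))) * E ≤ 1 / 4) :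
    C * (ρ + Lb * ((A₀ * (E * e) + ρ) + Lb * (((Lb + Lb ^ 2) * (μ * (E * e)) +
      Lb * (A₀ * (E * e) + ρ) + ρ) * δ))) ≤
        μ / 4 * e + (Q * E * (X + A₀) + Q * ρ * eb) * e := by
  have hη0 : 0 ≤ A₀ * (E * e) := by positivity
  set η := A₀ * (E * e) + ρ with hη
  have hρη : ρ ≤ η := by linarith
  have hQ0 : 0 ≤ Q := le_trans (by positivity) hCQ
  have e1 : C * (ρ + Lb * (η + Lb * (((Lb + Lb ^ 2) * (μ * (E * e)) + Lb * η + ρ) * δ))) =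
      C * (Lb * (Lb * δ * (Lb + Lb ^ 2))) * E * (μ * e) +
        C * (Lb * η + ρ + Lb ^ 2 * (Lb * η + ρ) * δ) := by ring
  have e2 : C * (Lb * (Lb * δ * (Lb + Lb ^ 2))) * E * (μ * e) ≤ 1 / 4 * (μ * e) := by gcongr
  have e3 : C * (Lb * η + ρ + Lb ^ 2 * (Lb * η + ρ) * δ) ≤
      C * (Lb ^ 3 + Lb ^ 2 + Lb + 1) * η := by
    have h2 : Lb ^ 2 * (Lb * η + ρ) * δ ≤ Lb ^ 2 * (Lb * η + η) * 1 := by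
      have : 0 ≤ η := by linarith
      gcongr
    have h3 : Lb * η + ρ + Lb ^ 2 * (Lb * η + ρ) * δ ≤
        (Lb ^ 3 + Lb ^ 2 + Lb + 1) * η := by linarith
    have h4 := mul_le_mul_of_nonneg_left h3 hC.le
    linarith
  have e4 : C * (Lb ^ 3 + Lb ^ 2 + Lb + 1) * η ≤ Q * η := by
    have : 0 ≤ η := by linarith
    gcongr
  have h4 : Q * ρ ≤ Q * (ρ * eb * e) := by gcongr
  have h5 : 0 ≤ Q * E * X * e := by positivity
  have e5 : Q * η = Q * (A₀ * (E * e)) + Q * ρ := by rw [hη, mul_add]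
  linarith

/-- The sampled-data closed loop with input errors is practically exponentially stable. -/
theorem Stabilizable.exists_decay (hS : Stabilizable r univ D f kf) (hLb : 0 < Lb)
    (hlip : ∀ (x x' : Hist r n) (u u' : Vec m),
      ‖kf x' - kf x‖ + ‖f x' u' 0 - f x u 0‖ ≤ Lb * ‖x' - x‖ + Lb * ‖u' - u‖)
    (hdist : ∀ (x : Hist r n) (u : Vec m), ∀ d ∈ D, ‖f x u d - f x u 0‖ ≤ kb ‖d‖)
    {σ : ℝ} (hσ : 0 < σ) :
    ∃ ω C δ₀ : ℝ, 0 < ω ∧ ω ≤ σ ∧ 0 < C ∧ 0 < δ₀ ∧ ∀ (τ : ℕ → ℝ) (δ : ℝ), IsSampling τ δ →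
      δ ≤ 1 → δ ≤ δ₀ → ∀ (x₀ : Hist r n) (u : ℝ → Vec m) (d : ℝ → Vec q) (x : ℝ → Vec n)
      (b A₀ ρ : ℝ), (∀ t, 0 ≤ t → d t ∈ D) → IsPlantSol r f u d x₀ x → 0 ≤ b → 0 ≤ A₀ → 0 ≤ ρ →
      (∀ i, ∀ t ∈ Ico (τ i) (τ (i + 1)), t ≤ b →
        ‖u t - kf (hist r x (τ i))‖ ≤ A₀ * Real.exp (-σ * t) + ρ) →
      (∀ t ∈ Icc 0 b, kb ‖d t‖ ≤ ρ) →
      ‖hist r x b‖ ≤ C * (‖x₀‖ + A₀) * Real.exp (-ω * b) + C * ρ := by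
  obtain ⟨σ₀, M, hσ₀, hM, hst⟩ := hS.stable
  have hr : (0 : ℝ) ≤ r := r.2
  -- Half of the nominal decay rate is spent on the contraction by `1 / 4`; the other half remains
  -- for the weight `exp(ωT)`.
  obtain ⟨T, hT, hMT⟩ : ∃ T : ℝ, 0 ≤ T ∧ M * Real.exp (-(σ₀ / 2) * T) ≤ 1 / 4 := by
    have h1 : Tendsto (fun T : ℝ => M * Real.exp (-(σ₀ / 2) * T)) atTop (𝓝 (M * 0)) := by
      refine Tendsto.const_mul M (Real.tendsto_exp_atBot.comp ?_)
      exact tendsto_id.const_mul_atTop_of_neg (by linarith)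
    rw [mul_zero] at h1
    have h2 := h1.eventually (ge_mem_nhds (show (0 : ℝ) < 1 / 4 by norm_num))
    obtain ⟨T, hT, hT'⟩ := (h2.and (eventually_ge_atTop 0)).exists
    exact ⟨T, hT', hT⟩
  obtain ⟨C₁, hC₁, hpert⟩ := exists_perturbation_bound (q := q) hLb hlip hst hT
  set ω := min σ (σ₀ / 2) with hω
  have hω0 : 0 < ω := lt_min hσ (by linarith)
  have hωσ : ω ≤ σ := min_le_left _ _
  have hωσ₀ : ω ≤ σ₀ / 2 := min_le_right _ _
  set T₁ : ℝ := T + r + 2 with hT₁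
  have hT₁0 : 0 ≤ T₁ := by positivity
  obtain ⟨C₂, hC₂1, hgrow⟩ := exists_growth_bound hLb hS.f_zero hS.kf_zero hlip hdist hT₁0
  set E := Real.exp (ω * T₁) with hE
  have hE1 : 1 ≤ E := Real.one_le_exp (by positivity)
  set Q := C₁ * (Lb ^ 3 + Lb ^ 2 + Lb + 1) + C₂ * (Lb + 1) with hQ
  have hQ0 : 0 < Q := by positivity
  have hC₁Q : C₁ * (Lb ^ 3 + Lb ^ 2 + Lb + 1) ≤ Q := le_add_of_nonneg_right (by positivity)
  have hC₂Q : C₂ * (Lb + 1) ≤ Q := le_add_of_nonneg_left (by positivity)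
  -- This `δ₀` gives the sampling mismatch the gain `1 / 4`, so that together with the nominal
  -- contraction the total is `1 / 2`.
  refine ⟨ω, 2 * Q * E, 1 / (4 * (C₁ * Lb ^ 2 * (Lb + Lb ^ 2) * E)), hω0, hωσ, by positivity,
    by positivity, ?_⟩
  intro τ δ hτ hδ1 hδ₀ x₀ u d x b A₀ ρ hd hx hb hA₀ hρ hu hkb
  have hδ : C₁ * (Lb * (Lb * δ * (Lb + Lb ^ 2))) * E ≤ 1 / 4 := by
    rw [le_div_iff₀ (by positivity)] at hδ₀
    linarith
  have hδ0 : 0 < δ := (hτ.pos 0).trans_le (hτ.le 0)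
  have hexp1 : ∀ s : ℝ, 0 ≤ s → Real.exp (-σ * s) ≤ 1 := fun s hs => by
    rw [Real.exp_le_one_iff]
    have := mul_nonneg hσ.le hs
    linarith
  -- With the final time `b` fixed, the persistent error `ρ` is at most `ρ exp(ωb) exp(-ωt)` for `t
  -- ≤ b`. It thus fits an exponential bound, and the two exponentials cancel at `t = b`.
  set c := Q * E * (‖x₀‖ + A₀) + Q * ρ * Real.exp (ω * b) with hc
  have hc0 : 0 ≤ c := by positivity
  have hρexp : ∀ t ≤ b, ρ ≤ ρ * Real.exp (ω * b) * Real.exp (-ω * t) := fun t ht => by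
    rw [mul_assoc, ← Real.exp_add]
    refine le_mul_of_one_le_right hρ (Real.one_le_exp ?_)
    have := mul_le_mul_of_nonneg_left ht hω0.le
    linarith
  have hmain := le_exp_of_self_improving (φ := fun t => ‖hist r x t‖) (a := 0) (b := b) (c := c)
    (ℓ := -ω)
    (isCompact_Icc.bddAbove_image
      ((IsDelaySol.continuousOn_hist hx).norm.mono Icc_subset_Ici_self)) hc0 (by
    intro t ht μ hμ hμt
    have hexpt := Real.exp_pos (-ω * t)
    -- Up to `T₁` there is not enough past for the comparison; crude growth suffices there.
    rcases le_or_gt t T₁ with htT | htT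
    · have h1 := hgrow τ δ hτ x₀ u d x t (A₀ + ρ) ρ hd hx ht.1 htT (by positivity) hρ
        (fun i s hs hst' => by
          refine (hu i s hs (hst'.trans ht.2)).trans ?_
          have := mul_le_of_le_one_right hA₀ (hexp1 s ((hτ.nonneg i).trans hs.1))
          linarith)
        fun s hs => hkb s ⟨hs.1, hs.2.trans ht.2⟩
      have h2 : 1 ≤ E * Real.exp (-ω * t) := by
        rw [hE, ← Real.exp_add]
        refine Real.one_le_exp ?_
        have := mul_le_mul_of_nonneg_left htT hω0.le
        linarith
      have h3 := hρexp t ht.2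
      have h4 := initial_growth_absorb hLb (zero_le_one.trans hC₂1) hC₂Q hA₀ hρ (norm_nonneg x₀)
        h2 h3
      have h11 : 0 ≤ μ / 2 * Real.exp (-ω * t) := by positivity
      exact (h1.trans h4).trans (le_add_of_nonneg_right h11)
    · set N := μ * (E * Real.exp (-ω * t)) with hN
      have hN0 : 0 ≤ N := by positivity
      have hEt : E * Real.exp (-ω * t) = Real.exp (-ω * (t - T₁)) := by
        rw [hE, ← Real.exp_add]
        congr 1
        ring
      have hNle : ∀ s, t - T₁ ≤ s → s ≤ t → ‖hist r x s‖ ≤ N := by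
        intro s hs hst'
        refine (hμt s ⟨by linarith, hst'⟩).trans ?_
        rw [hN, hEt]
        gcongr μ * Real.exp ?_
        exact mul_le_mul_of_nonpos_left hs (by linarith)
      set η := A₀ * (E * Real.exp (-ω * t)) + ρ with hη
      have hη0 : 0 ≤ η := by positivity
      have huη : ∀ i, ∀ s ∈ Ico (τ i) (τ (i + 1)), t - T₁ ≤ s → s ≤ t →
          ‖u s - kf (hist r x (τ i))‖ ≤ η := by
        intro i s hsi hs hst'
        refine (hu i s hsi (hst'.trans ht.2)).trans ?_
        rw [hη, hEt]
        have h1 : -σ * s ≤ -ω * (t - T₁) := by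
          have h2 : 0 ≤ s := by linarith
          have h3 : ω * s ≤ σ * s := mul_le_mul_of_nonneg_right hωσ h2
          have h4 := mul_le_mul_of_nonneg_left hs hω0.le
          linarith
        gcongr
      have hν := norm_sampling_mismatch_le hLb hS.f_zero hS.kf_zero hlip hdist hτ hδ1 hd hx hT₁
        htT hN0 hη0 hρ hNle huη fun s hs => hkb s ⟨hs.1, hs.2.trans ht.2⟩
      have hfin := hpert x₀ u d x (t - T)
        (ρ + Lb * (η + Lb * (((Lb + Lb ^ 2) * N + Lb * η + ρ) * δ))) hx (by linarith) (by positivity)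
        (by rwa [sub_add_cancel])
      rw [sub_add_cancel] at hfin
      have hfirst : M * Real.exp (-σ₀ * T) * ‖hist r x (t - T)‖ ≤
          μ / 4 * Real.exp (-ω * t) := by
        have h1 := hμt (t - T) ⟨by linarith, by linarith⟩
        calc M * Real.exp (-σ₀ * T) * ‖hist r x (t - T)‖
            ≤ M * Real.exp (-σ₀ * T) * (μ * Real.exp (-ω * (t - T))) := by gcongr
          _ = M * Real.exp (-σ₀ * T + ω * T) * (μ * Real.exp (-ω * t)) := by
            rw [show -ω * (t - T) = ω * T + -ω * t by ring, Real.exp_add, Real.exp_add]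
            ring
          _ ≤ M * Real.exp (-(σ₀ / 2) * T) * (μ * Real.exp (-ω * t)) := by
            gcongr M * Real.exp ?_ * _
            have := mul_le_mul_of_nonneg_right hωσ₀ hT
            linarith
          _ ≤ 1 / 4 * (μ * Real.exp (-ω * t)) := by gcongr
          _ = _ := by ring
      have hsecond := sampling_mismatch_absorb hLb hC₁ hC₁Q hA₀ hρ (norm_nonneg x₀) hexpt
        (zero_le_one.trans hE1) (hρexp t ht.2) hμ hδ0.le hδ1 hδ
      refine hfin.trans ((add_le_add hfirst hsecond).trans (le_of_eq ?_))
      ring) b ⟨hb, le_rfl⟩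
  refine hmain.trans ?_
  have e1 : 2 * c * Real.exp (-ω * b) = 2 * Q * E * (‖x₀‖ + A₀) * Real.exp (-ω * b) +
      2 * Q * ρ * (Real.exp (ω * b) * Real.exp (-ω * b)) := by
    rw [hc]
    ring
  have e2 : Real.exp (ω * b) * Real.exp (-ω * b) = 1 := by
    rw [← Real.exp_add, neg_mul, add_neg_cancel, Real.exp_zero]
  rw [e1, e2, mul_one]
  have e3 : 2 * Q * ρ ≤ 2 * Q * ρ * E := le_mul_of_one_le_right (by positivity) hE1
  linarith

end Stabilization

/-! ### Observer error and the closed-loop estimate -/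

theorem ClassK.add {ρ ρ' : ℝ → ℝ} (h : ClassK ρ) (h' : ClassK ρ') :
    ClassK fun s => ρ s + ρ' s where
  strictMonoOn := h.strictMonoOn.add h'.strictMonoOn
  continuousOn := h.continuousOn.add h'.continuousOn
  map_zero := by simp only [h.map_zero, h'.map_zero, add_zero]

theorem ClassK.const_mul {ρ : ℝ → ℝ} (h : ClassK ρ) {c : ℝ} (hc : 0 < c) :
    ClassK fun s => c * ρ s where
  strictMonoOn _ hs _ ht hst := mul_lt_mul_of_pos_left (h.strictMonoOn hs ht hst) hc
  continuousOn := h.continuousOn.const_mul c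
  map_zero := by simp only [h.map_zero, mul_zero]

theorem ClassK.id : ClassK fun s => s where
  strictMonoOn := strictMonoOn_id
  continuousOn := continuousOn_id
  map_zero := rfl

namespace IsClosedLoopSol

variable {r : ℝ≥0} {n m q k l : ℕ} {D : Set (Vec q)}
  {f : Hist r n → Vec m → Vec q → Vec n} {h : Hist r n → Vec k}
  {R : Hist r n → Vec m → Vec q → Vec k}
  {F : Hist r l → Vec k → Vec m → Vec l} {Ψ : Hist r l → Hist r n}
  {kf : Hist r n → Vec m} {σ γ : ℝ} {g a : ℝ → ℝ}
  {τ : ℕ → ℝ} {δ : ℝ} {d : ℝ → Vec q} {ξ : ℝ → Vec k} {x₀ : Hist r n} {z₀ : Hist r l}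
  {x : ℝ → Vec n} {z : ℝ → Vec l} {w : ℝ → Vec k} {u : ℝ → Vec m}

/-- The inter-sample predictor tracks the output up to the noise at the last sampling time and
the growth due to the observer error and the disturbance. -/
theorem norm_predictor_sub_le (S : ObserverLoop r D f h R F Ψ kf σ γ g a) {L : ℝ} {κ : ℝ → ℝ}
    (hR : ∀ x x' u, ∀ d ∈ D, ‖R x' u 0 - R x u d‖ ≤ L * ‖x' - x‖ + κ ‖d‖)
    (hτ : IsSampling τ δ) (hd : LInfLoc D d) (hu : LInfLoc univ u)
    (hs : IsClosedLoopSol r f h R F Ψ kf τ d ξ x₀ z₀ (Ici 0) x z w u) {i : ℕ} {t B : ℝ}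
    (ht : t ∈ Ico (τ i) (τ (i + 1)))
    (hB : ∀ s ∈ Icc (τ i) t, L * ‖Ψ (hist r z s) - hist r x s‖ + κ ‖d s‖ ≤ B) :
    ‖w t - h (hist r x t)‖ ≤ ‖ξ (τ i)‖ + δ * B := by
  have hτi := hτ.nonneg i
  obtain ⟨hac, hder⟩ := S.output.deriv_output x₀ u d x hu hd hs.plant
  have hmem : ∀ s ∈ Icc (τ i) t, s ∈ Ici 0 ∩ Ico (τ i) (τ (i + 1)) := fun s hs' =>
    ⟨hτi.trans hs'.1, hs'.1, hs'.2.trans_lt ht.2⟩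
  have hw := hs.predictor_ac i _ (hmem (τ i) ⟨le_rfl, ht.1⟩) t (hmem t ⟨ht.1, le_rfl⟩) ht.1
  have key := (hw.fun_sub (hac _ hτi t (hτi.trans ht.1) ht.1)).norm_sub_le_of_norm_deriv_le
    (C := B) ht.1 (by
      filter_upwards [hder, hs.predictor_deriv i] with s h1 h2 hst
      have hst' := Ioo_subset_Icc_self hst
      have h0 : (0 : ℝ) ≤ s := hτi.trans hst'.1
      exact ⟨_, (h2 (hmem s hst')).sub (h1 h0),
        (hR _ _ _ _ (hd.mem s h0)).trans (hB s hst')⟩)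
  rw [hs.predictor_reset i hτi, add_sub_cancel_left] at key
  have hB0 : 0 ≤ B := by
    refine le_trans (le_trans (norm_nonneg _) (hR _ _ (u t) _ (hd.mem t (hτi.trans ht.1))))
      (hB t ⟨ht.1, le_rfl⟩)
  have hδt : t - τ i ≤ δ := by
    have := hτ.le i
    linarith [ht.2]
  calc ‖w t - h (hist r x t)‖
      ≤ ‖ξ (τ i)‖ + ‖w t - h (hist r x t) - ξ (τ i)‖ := norm_le_norm_add_norm_sub' _ _
    _ ≤ ‖ξ (τ i)‖ + B * (t - τ i) := by gcongr
    _ ≤ ‖ξ (τ i)‖ + δ * B := by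
      rw [mul_comm δ]
      gcongr

/-- Exponential estimate of the observer error along closed-loop solutions. -/
theorem norm_observer_error_le (S : ObserverLoop r D f h R F Ψ kf σ γ g a) {L : ℝ} {κ : ℝ → ℝ}
    (hL : 0 ≤ L) (hR : ∀ x x' u, ∀ d ∈ D, ‖R x' u 0 - R x u d‖ ≤ L * ‖x' - x‖ + κ ‖d‖)
    (hτ : IsSampling τ δ) (hδ1 : δ ≤ 1) (hδ : δ * (L * γ * Real.exp σ) ≤ 1 / 2)
    (hd : LInfLoc D d) (hu : LInfLoc univ u) (hw : LInfLoc univ w)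
    (hs : IsClosedLoopSol r f h R F Ψ kf τ d ξ x₀ z₀ (Ici 0) x z w u) {b X N : ℝ} (hb : 0 ≤ b)
    (hX : ∀ s ∈ Icc 0 b, ‖ξ s‖ ≤ X) (hκ : ∀ s ∈ Icc 0 b, κ ‖d s‖ ≤ N)
    (hg : ∀ s ∈ Icc 0 b, g ‖d s‖ ≤ N) :
    ‖Ψ (hist r z b) - hist r x b‖ ≤
      2 * Real.exp (-σ * b) * a (‖x₀‖ + ‖z₀‖) + 2 * (γ * X + (γ + 1) * N) := by
  have hσ := S.observer.σ_pos
  have hγ := S.observer.γ_pos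
  have hδ0 : 0 < δ := (hτ.pos 0).trans_le (hτ.le 0)
  have hX0 : 0 ≤ X := (norm_nonneg _).trans (hX 0 ⟨le_rfl, hb⟩)
  have hN0 : 0 ≤ N := (S.observer.classK_g.nonneg (norm_nonneg _)).trans (hg 0 ⟨le_rfl, hb⟩)
  set a₀ := a (‖x₀‖ + ‖z₀‖) with ha₀
  have ha₀0 : 0 ≤ a₀ := S.observer.classKInf_a.toClassK.nonneg (by positivity)
  set P := γ * X + (γ + 1) * N with hP
  have hP0 : 0 ≤ P := by positivity
  have hcont : ContinuousOn (fun t => ‖Ψ (hist r z t) - hist r x t‖) (Icc 0 b) :=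
    ((S.observer.continuous_Ψ.comp_continuousOn
      (IsDelaySol.continuousOn_hist hs.observer)).sub
      (IsDelaySol.continuousOn_hist hs.plant)).norm.mono Icc_subset_Ici_self
  -- As for the state, the persistent part `P` is written as an exponential with weight `exp(σb)`.
  have hmain := le_exp_of_self_improving (φ := fun t => ‖Ψ (hist r z t) - hist r x t‖)
    (a := 0) (b := b) (c := a₀ + P * Real.exp (σ * b)) (ℓ := -σ)
    (isCompact_Icc.bddAbove_image hcont) (by positivity) (by
    intro t ht μ hμ hμt
    have herr := S.error_le hu hw hd hs.plant hs.observer ht.1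
      (N := X + δ * N + δ * (L * (μ * Real.exp σ)) * Real.exp (-σ * t)) (N' := N) (by
      intro s hst
      obtain ⟨i, hi⟩ := hτ.exists_mem_Ico hst.1
      have hτi := hτ.nonneg i
      have h1 := hs.norm_predictor_sub_le S hR hτ hd hu hi
        (B := L * (μ * (Real.exp σ * Real.exp (-σ * s))) + N) fun s' hs' => by
          have h0 : 0 ≤ s' := hτi.trans hs'.1
          have h2 := hμt s' ⟨h0, hs'.2.trans hst.2⟩
          -- `s'` precedes `s` by at most `δ ≤ 1`; this is the origin of `exp σ` in the gain.
          have h3 : Real.exp (-σ * s') ≤ Real.exp σ * Real.exp (-σ * s) := by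
            rw [← Real.exp_add, Real.exp_le_exp]
            have h4 : s - s' ≤ 1 := by
              have := hτ.le i
              linarith [hi.2, hs'.1]
            have := mul_le_mul_of_nonneg_left h4 hσ.le
            linarith
          have h4 := hκ s' ⟨h0, (hs'.2.trans hst.2).trans ht.2⟩
          gcongr
          exact h2.trans (by gcongr)
      have h2 := hX (τ i) ⟨hτi, (hi.1.trans hst.2).trans ht.2⟩
      have h3 : Real.exp (-σ * (t - s)) ≤ 1 := by
        rw [Real.exp_le_one_iff]
        have := mul_nonneg hσ.le (sub_nonneg.2 hst.2)
        linarith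
      -- The fading weight on the noise in the observer estimate turns decay at time `s` into the
      -- same decay at time `t`, so the loop closes at the full rate `σ`.
      have h4 : Real.exp (-σ * s) * Real.exp (-σ * (t - s)) = Real.exp (-σ * t) := by
        rw [← Real.exp_add]
        congr 1
        ring
      calc ‖w s - h (hist r x s)‖ * Real.exp (-σ * (t - s))
          ≤ (X + δ * (L * (μ * (Real.exp σ * Real.exp (-σ * s))) + N)) *
              Real.exp (-σ * (t - s)) := by
            gcongr
            exact h1.trans (by gcongr)
        _ = (X + δ * N) * Real.exp (-σ * (t - s)) + δ * (L * (μ * Real.exp σ)) *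
              (Real.exp (-σ * s) * Real.exp (-σ * (t - s))) := by ring
        _ ≤ X + δ * N + δ * (L * (μ * Real.exp σ)) * Real.exp (-σ * t) := by
            rw [h4]
            gcongr
            exact mul_le_of_le_one_right (by positivity) h3)
      fun s hst => hg s ⟨hst.1, hst.2.trans ht.2⟩
    refine herr.trans ?_
    have he := Real.exp_pos (-σ * t)
    have h1 : P ≤ P * Real.exp (σ * b) * Real.exp (-σ * t) := by
      rw [mul_assoc, ← Real.exp_add]
      refine le_mul_of_one_le_right hP0 (Real.one_le_exp ?_)
      have := mul_le_mul_of_nonneg_left ht.2 hσ.le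
      linarith
    have h2 : δ * (L * γ * Real.exp σ) * (μ * Real.exp (-σ * t)) ≤
        1 / 2 * (μ * Real.exp (-σ * t)) := by gcongr
    have h3 : γ * (δ * N) ≤ γ * N := by
      gcongr
      exact mul_le_of_le_one_left hN0 hδ1
    rw [hP] at h1 ⊢
    linarith) b ⟨hb, le_rfl⟩
  have e2 : Real.exp (σ * b) * Real.exp (-σ * b) = 1 := by
    rw [← Real.exp_add, neg_mul, add_neg_cancel, Real.exp_zero]
  refine hmain.trans (le_of_eq ?_)
  linear_combination 2 * P * e2

end IsClosedLoopSol

/-! ### Choice of the constants and the combined estimate. -/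

theorem corollary2p4 (r : ℝ≥0) (hr : 0 < r) (n m q k l : ℕ)
    (U : Set (Vec m)) (hU : Convex ℝ U) (hU0 : (0 : Vec m) ∈ U)
    (D : Set (Vec q)) (hD : Convex ℝ D) (hD0 : (0 : Vec q) ∈ D)
    (f : Hist r n → Vec m → Vec q → Vec n) (h : Hist r n → Vec k)
    (R : Hist r n → Vec m → Vec q → Vec k)
    (F : Hist r l → Vec k → Vec m → Vec l) (Ψ : Hist r l → Hist r n)
    (kf : Hist r n → Vec m) (σ γ : ℝ) (g a : ℝ → ℝ)
    (H1 : RegularSystem r U D f h)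
    (H2 : ForwardComplete r U D f)
    (H3 : OutputDerivative r U D f h R)
    (H4 : Stabilizable r U D f kf)
    (hREO : IsREOWith r U D f h F Ψ σ γ g a)
    (hPred : PredictorLipschitz r U R Ψ) :
    ∃ (δ ω γ' : ℝ) (g' a' : ℝ → ℝ), 0 < δ ∧ 0 < ω ∧ 0 < γ' ∧ ClassK g' ∧ ClassK a' ∧
      (IsLinearGain a → IsLinearGain a') ∧
      ∀ τ : ℕ → ℝ, IsSampling τ δ →
      ∀ (x₀ : Hist r n) (z₀ : Hist r l) (ξ : ℝ → Vec k) (d : ℝ → Vec q),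
        LInfLoc univ ξ → LInfLoc D d →
        -- a solution exists for all `t ≥ 0`
        (∃ x z w u, IsClosedLoopSol r f h R F Ψ kf τ d ξ x₀ z₀ (Ici 0) x z w u) ∧
        -- every solution on `[0, T)` is the restriction of a solution on `[0, ∞)`
        (∀ T : ℝ, 0 < T → ∀ x z w u,
          IsClosedLoopSol r f h R F Ψ kf τ d ξ x₀ z₀ (Ico 0 T) x z w u →
          ∃ x' z' w' u', IsClosedLoopSol r f h R F Ψ kf τ d ξ x₀ z₀ (Ici 0) x' z' w' u' ∧
            ∀ t ∈ Ico 0 T, x' t = x t ∧ z' t = z t ∧ w' t = w t ∧ u' t = u t) ∧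
        -- every solution satisfies the stability estimate
        (∀ x z w u, IsClosedLoopSol r f h R F Ψ kf τ d ξ x₀ z₀ (Ici 0) x z w u →
          ∀ t : ℝ, 0 ≤ t →
            ‖hist r x t‖ + ‖Ψ (hist r z t)‖ ≤ Real.exp (-ω * t) * a' (‖x₀‖ + ‖z₀‖)
              + γ' * (⨆ s : Icc (0 : ℝ) t, ‖ξ s‖)
              + ⨆ s : Icc (0 : ℝ) t, g' ‖d s‖) := by
  obtain rfl : U = univ := H4.input_set
  have S : ObserverLoop r D f h R F Ψ kf σ γ g a := ⟨hD0, H1, H2, H3, H4, hREO, hPred⟩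
  obtain ⟨L, hL, κ, hκ, hR⟩ := H3.lipschitz
  obtain ⟨Lb, hLb, hlip⟩ := H4.lipschitz
  obtain ⟨kb, hkb, hdist⟩ := H4.disturbance
  have hσ := hREO.σ_pos
  have hγ := hREO.γ_pos
  obtain ⟨ω, C, δ₀, hω, hωσ, hC, hδ₀, hdecay⟩ := H4.exists_decay hLb hlip hdist hσ
  have hR' : ∀ x x' u, ∀ d ∈ D, ‖R x' u 0 - R x u d‖ ≤ L * ‖x' - x‖ + κ ‖d‖ :=
    fun x x' u d hd => hR x x' u (mem_univ _) d hd
  have hR0 : ∀ x x' u, ‖R x' u 0 - R x u 0‖ ≤ L * ‖x' - x‖ := fun x x' u => by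
    simpa [hκ.map_zero] using hR' x x' u 0 hD0
  have hkf : ∀ x x', ‖kf x' - kf x‖ ≤ Lb * ‖x' - x‖ := fun x x' => by
    have := hlip x x' 0 0
    rw [sub_self, norm_zero, mul_zero, add_zero] at this
    linarith [norm_nonneg (f x' 0 0 - f x 0 0)]
  set A := L * γ * Real.exp σ with hA
  have hA0 : 0 ≤ A := by positivity
  -- The three bounds limit the sampling lag, the gain of the state loop and the gain of the
  -- observer loop; `A + 1` covers the case `A = 0`.
  set δ := min 1 (min δ₀ (1 / (2 * (A + 1)))) with hδ
  have hδ0 : 0 < δ := by positivity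
  have hδ1 : δ ≤ 1 := min_le_left _ _
  have hδδ₀ : δ ≤ δ₀ := (min_le_right _ _).trans (min_le_left _ _)
  have hδA : δ * A ≤ 1 / 2 := by
    have h1 : δ ≤ 1 / (2 * (A + 1)) := (min_le_right _ _).trans (min_le_right _ _)
    rw [le_div_iff₀ (by positivity)] at h1
    linarith
  have hδγ : δ * (L * γ) ≤ 1 / 2 := by
    refine le_trans ?_ hδA
    have : L * γ ≤ A := le_mul_of_one_le_right (by positivity) (Real.one_le_exp hσ.le)
    gcongr
  have hg₀ : ClassK fun s => g s + κ s + kb s := (hREO.classK_g.add hκ).add hkb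
  -- The total coefficient of `P`: the state counts twice and is driven by `2 Lb P`, and the
  -- observer error contributes `2 P`.
  set c := 2 * C * (2 * Lb) + 2 with hc
  have hc0 : 0 < c := by positivity
  have ha := hREO.classKInf_a.toClassK
  refine ⟨δ, ω, c * γ, fun s => (c * (γ + 1) + 2 * C) * (g s + κ s + kb s),
    fun s => 2 * C * s + (2 * C * (2 * Lb * Real.exp σ) + 2) * a s, hδ0, hω, by positivity,
    hg₀.const_mul (by positivity),
    (ClassK.id.const_mul (by positivity)).add (ha.const_mul (by positivity)), ?_, ?_⟩
  · rintro ⟨c', hc'⟩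
    refine ⟨2 * C + (2 * C * (2 * Lb * Real.exp σ) + 2) * c', fun s hs => ?_⟩
    simp only [hc' s hs]
    ring
  intro τ hτ x₀ z₀ ξ d hξ hd
  refine ⟨S.exists_closedLoopSol hL hR0 hτ hδγ hd,
    fun T hT x z w u hs => hs.exists_extension S hL hR0 hτ hδγ hd hT.le, ?_⟩
  intro x z w u hs b hb
  -- Measurability and local boundedness of the signals are not part of being a solution, yet the
  -- observer estimate requires them.
  obtain ⟨hu, hw⟩ := hs.linfLoc S hL hR0 hτ hδγ
  set X := ⨆ s : Icc (0 : ℝ) b, ‖ξ s‖ with hX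
  set G := ⨆ s : Icc (0 : ℝ) b, (g ‖d s‖ + κ ‖d s‖ + kb ‖d s‖) with hG
  have hXs : ∀ s ∈ Icc 0 b, ‖ξ s‖ ≤ X := fun s hs' =>
    le_ciSup (hξ.bddAbove_norm hb) ⟨s, hs'⟩
  have hGs : ∀ s ∈ Icc 0 b, g ‖d s‖ + κ ‖d s‖ + kb ‖d s‖ ≤ G := fun s hs' =>
    le_ciSup (hd.bddAbove_classK hg₀ hb) ⟨s, hs'⟩
  have hg0 : ∀ s, 0 ≤ g ‖d s‖ := fun s => hREO.classK_g.nonneg (norm_nonneg _)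
  have hκ0 : ∀ s, 0 ≤ κ ‖d s‖ := fun s => hκ.nonneg (norm_nonneg _)
  have hkb0 : ∀ s, 0 ≤ kb ‖d s‖ := fun s => hkb.nonneg (norm_nonneg _)
  have hX0 : 0 ≤ X := (norm_nonneg _).trans (hXs 0 ⟨le_rfl, hb⟩)
  have hG0 : 0 ≤ G := by linarith [hg0 0, hκ0 0, hkb0 0, hGs 0 ⟨le_rfl, hb⟩]
  have herr : ∀ t ∈ Icc 0 b, ‖Ψ (hist r z t) - hist r x t‖ ≤
      2 * Real.exp (-σ * t) * a (‖x₀‖ + ‖z₀‖) + 2 * (γ * X + (γ + 1) * G) := fun t ht =>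
    hs.norm_observer_error_le S hL hR' hτ hδ1 hδA hd hu hw ht.1
      (fun s hs' => hXs s ⟨hs'.1, hs'.2.trans ht.2⟩)
      (fun s hs' => by linarith [hg0 s, hκ0 s, hkb0 s, hGs s ⟨hs'.1, hs'.2.trans ht.2⟩])
      (fun s hs' => by linarith [hg0 s, hκ0 s, hkb0 s, hGs s ⟨hs'.1, hs'.2.trans ht.2⟩])
  set a₀ := a (‖x₀‖ + ‖z₀‖) with ha₀
  have ha₀0 : 0 ≤ a₀ := ha.nonneg (by positivity)
  set P := γ * X + (γ + 1) * G with hP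
  have hP0 : 0 ≤ P := by positivity
  -- The input error is `Lb` times the observer error at the last sampling time; the lag of at most
  -- `1` costs `exp σ`. The summand `G` makes the constant part dominate `kb ‖d‖` as well.
  have hxb := hdecay τ δ hτ hδ1 hδδ₀ x₀ u d x b (2 * Lb * Real.exp σ * a₀) (2 * Lb * P + G)
    hd.mem hs.plant hb (by positivity) (by positivity) (fun i t ht htb => by
      have hτi := hτ.nonneg i
      have h1 := herr (τ i) ⟨hτi, ht.1.trans htb⟩
      have h2 : Real.exp (-σ * τ i) ≤ Real.exp σ * Real.exp (-σ * t) := by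
        rw [← Real.exp_add, Real.exp_le_exp]
        have h4 : t - τ i ≤ 1 := by
          have := hτ.le i
          linarith [ht.2]
        have := mul_le_mul_of_nonneg_left h4 hσ.le
        linarith
      rw [hs.feedback i t ⟨hτi.trans ht.1, ht⟩]
      calc ‖kf (Ψ (hist r z (τ i))) - kf (hist r x (τ i))‖
          ≤ Lb * (2 * (Real.exp σ * Real.exp (-σ * t)) * a₀ + 2 * P) :=
            (hkf _ _).trans (by gcongr; exact h1.trans (by gcongr))
        _ ≤ 2 * Lb * Real.exp σ * a₀ * Real.exp (-σ * t) + (2 * Lb * P + G) := by linarith)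
    fun s hs' => by
      have : 0 ≤ 2 * Lb * P := by positivity
      linarith [hg0 s, hκ0 s, hGs s hs']
  have hsup : ⨆ s : Icc (0 : ℝ) b,
      (c * (γ + 1) + 2 * C) * (g ‖d s‖ + κ ‖d s‖ + kb ‖d s‖) = (c * (γ + 1) + 2 * C) * G :=
    (Real.mul_iSup_of_nonneg (by positivity) _).symm
  have hΨ : ‖Ψ (hist r z b)‖ ≤ ‖hist r x b‖ + ‖Ψ (hist r z b) - hist r x b‖ :=
    norm_le_norm_add_norm_sub' _ _
  have heb := herr b ⟨hb, le_rfl⟩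
  have hexp : Real.exp (-σ * b) ≤ Real.exp (-ω * b) := by
    have := mul_le_mul_of_nonneg_right hωσ hb
    rw [Real.exp_le_exp]
    linarith
  have heb' : 2 * Real.exp (-σ * b) * a₀ ≤ 2 * Real.exp (-ω * b) * a₀ := by gcongr
  have hx₀ : 2 * C * ‖x₀‖ * Real.exp (-ω * b) ≤
      2 * C * (‖x₀‖ + ‖z₀‖) * Real.exp (-ω * b) := by
    gcongr
    exact le_add_of_nonneg_right (norm_nonneg _)
  rw [hsup]
  have hfin : Real.exp (-ω * b) *
      (2 * C * (‖x₀‖ + ‖z₀‖) + (2 * C * (2 * Lb * Real.exp σ) + 2) * a₀) +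
        c * γ * X + (c * (γ + 1) + 2 * C) * G =
      2 * C * (‖x₀‖ + ‖z₀‖) * Real.exp (-ω * b) +
        2 * C * (2 * Lb * Real.exp σ * a₀) * Real.exp (-ω * b) +
        2 * Real.exp (-ω * b) * a₀ + (2 * C * (2 * Lb * P + G) + 2 * P) := by
    rw [hc, hP]
    ring
  refine le_trans ?_ hfin.ge
  linarith
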